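/- For an interval $J\subset[0,1]$ and an integrable $g:[0,1]\to\mathbb{C}$, let $$(\mathcal{E}_J g)(x) = \int_J g(\xi)\, e^{2\pi i(\xi x_1+\xi^2 x_2)}\,d\xi, \qquad x=(x_1,x_2)\in\mathbb{R}^2.$$ For a square $B\subset\mathbb{R}^2$ with centre $c$, side length $R$ and sides parallel to the axes, let $w_B(x) = (1+|x-c|/R)^{-100}$ and $\|f\|_{L^6(w_B)} = (\int_{\mathbb{R}^2}|f|^6 w_B)^{1/6}$. For $\delta>0$ with $\delta^{-1}\in\mathbb{N}=\{1,2,\dots\}$, let $P_\delta([0,1])$ be the partition of $[0,1]$ into $\delta^{-1}$ intervals of length $\delta$, and let $D(\delta)$ be the best (smallest) constant such that $$\|\mathcal{E}_{[0,1]}g\|_{L^6(B)} \le D(\delta)\Big(\sum_{J\in P_\delta([0,1])}\|\mathcal{E}_J g\|_{L^6(w_B)}^2\Big)^{1/2}$$ for all such $g$ and all such squares $B$ of side length $\delta^{-2}$. Let $N\ge 1$ be an integer and let $\delta>0$ be such that $\delta^{-1/2^N}\in\mathbb{N}$ and $\delta<100^{-2^N}$. Then $$D(\delta)\le 10^{10^5}\Big(D\big(\delta^{1-\frac{1}{2^N}}\big)+\delta^{-\frac{4}{3\cdot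 2^N}}\,D\big(\delta^{1/2}\big)^{\frac{1}{3\cdot 2^N}}\prod_{j=0}^{N-1}D\big(\delta^{1-\frac{1}{2^{N-j}}}\big)^{\frac{1}{2^{j+1}}}\Big).$$ -/

import Mathlib

open MeasureTheory Set
open scoped ENNReal

namespace ParabolaDecoupling

noncomputable section

/-- The plane `ℝ²` with its Euclidean norm and Lebesgue measure. -/
abbrev Plane : Type := EuclideanSpace ℝ (Fin 2)

/-- The character `e(a) = exp(2 π i a)`. -/
def e (a : ℝ) : ℂ := Complex.exp (2 * Real.pi * Complex.I * a)

/-- The extension operator of the parabola,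
`(E_J g)(x) = ∫_J g(ξ) e(ξ x₁ + ξ² x₂) dξ`. -/
def ext (J : Set ℝ) (g : ℝ → ℂ) (x : Plane) : ℂ :=
  ∫ ξ in J, g ξ * e (ξ * x 0 + ξ ^ 2 * x 1)

/-- The square `B(c, R)` with centre `c`, side length `R` and sides parallel to the axes. -/
def square (c : Plane) (R : ℝ) : Set Plane := {x | ∀ k, |x k - c k| ≤ R / 2}

/-- The weight `w_B(x) = (1 + |x - c| / R)⁻¹⁰⁰` of the square `B = B(c, R)`
(`|·|` is the Euclidean norm). -/
def weight (c : Plane) (R : ℝ) (x : Plane) : ℝ := ((1 + ‖x - c‖ / R) ^ 100)⁻¹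

/-- The norm `‖f‖_{L⁶(B)}`, `B = B(c, R)`. -/
def norm6 (c : Plane) (R : ℝ) (f : Plane → ℂ) : ℝ≥0∞ :=
  eLpNorm f 6 (volume.restrict (square c R))

/-- The weighted norm `‖f‖_{L⁶(w_B)} = (∫ |f|⁶ w_B)^{1/6}`, `B = B(c, R)`. -/
def norm6w (c : Plane) (R : ℝ) (f : Plane → ℂ) : ℝ≥0∞ :=
  eLpNorm f 6 (volume.withDensity fun x => ENNReal.ofReal (weight c R x))

/-- The `i`-th interval `[i δ, (i + 1) δ]` of length `δ`. For `δ⁻¹` a positive integer, the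
partition `P_δ([0, 1])` consists of `piece δ i` with `0 ≤ i < δ⁻¹`. -/
def piece (δ : ℝ) (i : ℕ) : Set ℝ := Icc (i * δ) ((i + 1) * δ)

/-- The square function `(∑_{J ∈ P_δ([0, 1])} ‖E_J g‖²_{L⁶(w_B)})^{1/2}`, `B = B(c, δ⁻²)`
(meant for `δ⁻¹` a positive integer, where the floor is `δ⁻¹` itself). -/
def squareSum (δ : ℝ) (c : Plane) (g : ℝ → ℂ) : ℝ≥0∞ :=
  (∑ i ∈ Finset.range ⌊δ⁻¹⌋₊, norm6w c ((δ ^ 2)⁻¹) (ext (piece δ i) g) ^ 2) ^ (1 / 2 : ℝ)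

/-- `C` is admissible in the decoupling inequality at scale `δ`: for every integrable
`g` on `[0, 1]` and every square `B` of side length `δ⁻²`,
`‖E_{[0,1]} g‖_{L⁶(B)} ≤ C (∑_{J ∈ P_δ([0, 1])} ‖E_J g‖²_{L⁶(w_B)})^{1/2}`. -/
def IsDecouplingBound (δ : ℝ) (C : ℝ≥0∞) : Prop :=
  ∀ g : ℝ → ℂ, IntegrableOn g (Icc 0 1) → ∀ c : Plane,
    norm6 c ((δ ^ 2)⁻¹) (ext (Icc 0 1) g) ≤ C * squareSum δ c g

/-- The decoupling constant `D(δ)`: the best (least) admissible constant. -/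
def D (δ : ℝ) : ℝ≥0∞ := sInf {C | IsDecouplingBound δ C}

end

end ParabolaDecoupling

namespace ParabolaDecoupling

theorem continuous_phase (x : Plane) :
    Continuous fun ξ : ℝ => e (ξ * x 0 + ξ ^ 2 * x 1) := by
  unfold e; fun_prop

theorem norm_e (a : ℝ) : ‖e a‖ = 1 := by
  have : (2 * Real.pi * Complex.I * a : ℂ) = ((2 * Real.pi * a : ℝ) : ℂ) * Complex.I := by
    push_cast; ring
  rw [e, this, Complex.norm_exp_ofReal_mul_I]

theorem integrableOn_phase {g : ℝ → ℂ} {s : Set ℝ} (hg : IntegrableOn g s) (x : Plane) :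
    IntegrableOn (fun ξ => g ξ * e (ξ * x 0 + ξ ^ 2 * x 1)) s := by
  refine Integrable.mul_bdd (c := 1) hg (continuous_phase x).aestronglyMeasurable ?_
  exact Filter.Eventually.of_forall fun ξ => (norm_e _).le

theorem continuous_ext {g : ℝ → ℂ} {s : Set ℝ} (hg : IntegrableOn g s) :
    Continuous (ext s g) := by
  refine continuous_of_dominated (bound := fun ξ => ‖g ξ‖) ?_ ?_ hg.norm ?_
  · exact fun x => (integrableOn_phase hg x).aestronglyMeasurable
  · refine fun x => Filter.Eventually.of_forall fun ξ => ?_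
    rw [norm_mul, norm_e, mul_one]
  · refine Filter.Eventually.of_forall fun ξ => ?_
    unfold e; fun_prop

theorem ext_eq_sum {n : ℕ} (hn : 0 < n) {g : ℝ → ℂ} (hg : IntegrableOn g (Icc 0 1)) :
    ext (Icc 0 1) g = ∑ i ∈ Finset.range n, ext (piece (n : ℝ)⁻¹ i) g := by
  have hn' : (0 : ℝ) < n := by exact_mod_cast hn
  funext x
  rw [Finset.sum_apply]
  set F : ℝ → ℂ := fun ξ => g ξ * e (ξ * x 0 + ξ ^ 2 * x 1) with hF
  have hFi : IntegrableOn F (Icc 0 1) := integrableOn_phase hg x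
  have hp : ∀ i : ℕ, ext (piece (n : ℝ)⁻¹ i) g x =
      ∫ ξ in ((i : ℝ) * (n : ℝ)⁻¹)..(((i + 1 : ℕ) : ℝ) * (n : ℝ)⁻¹), F ξ := by
    intro i
    rw [intervalIntegral.integral_of_le (by push_cast; gcongr; linarith), ← integral_Icc_eq_integral_Ioc]
    simp [ext, piece, hF]
  simp_rw [hp]
  rw [intervalIntegral.sum_integral_adjacent_intervals (a := fun i : ℕ => (i : ℝ) * (n : ℝ)⁻¹)]
  · simp only [Nat.cast_zero, zero_mul, mul_inv_cancel₀ hn'.ne']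
    rw [intervalIntegral.integral_of_le zero_le_one, ← integral_Icc_eq_integral_Ioc, ext]
  · intro k hk
    rw [intervalIntegrable_iff_integrableOn_Ioc_of_le (by push_cast; gcongr; linarith)]
    refine hFi.mono_set (Ioc_subset_Icc_self.trans (Icc_subset_Icc (by positivity) ?_))
    rw [← div_eq_mul_inv, div_le_one hn']
    exact_mod_cast hk

theorem norm6_le {c : Plane} {R : ℝ} (hR : 0 < R) (f : Plane → ℂ) :
    norm6 c R f ≤ (2 ^ 100 : ℝ≥0∞) ^ (1 / 6 : ℝ) * norm6w c R f := by
  have hmeas : Measurable fun x => ENNReal.ofReal (weight c R x) := by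
    unfold weight; fun_prop
  have hle : volume.restrict (square c R) ≤
      (2 ^ 100 : ℝ≥0∞) • volume.withDensity fun x => ENNReal.ofReal (weight c R x) := by
    have hsq : MeasurableSet (square c R) := by
      have : IsClosed (square c R) := by
        simp only [square, ofPred_forall]
        exact isClosed_iInter fun k => isClosed_le (by fun_prop) (by fun_prop)
      exact this.measurableSet
    rw [← withDensity_indicator_one hsq, ← withDensity_smul _ hmeas]
    refine withDensity_mono (Filter.Eventually.of_forall fun x => ?_)
    by_cases hx : x ∈ square c R
    · simp only [hx, indicator_of_mem, Pi.one_apply, Pi.smul_apply, smul_eq_mul]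
      have hn : ‖x - c‖ ≤ R := by
        have h0 := hx 0
        have h1 := hx 1
        rw [EuclideanSpace.norm_eq, Fin.sum_univ_two]
        refine Real.sqrt_le_iff.2 ⟨hR.le, ?_⟩
        simp only [PiLp.sub_apply, Real.norm_eq_abs]
        nlinarith [abs_nonneg (x 0 - c 0), abs_nonneg (x 1 - c 1)]
      have hw : (1 : ℝ) ≤ 2 ^ 100 * weight c R x := by
        rw [weight, ← div_eq_mul_inv, one_le_div (by positivity)]
        have : ‖x - c‖ / R ≤ 1 := (div_le_one hR).2 hn
        gcongr
        linarith
      calc (1 : ℝ≥0∞) = ENNReal.ofReal 1 := by simp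
        _ ≤ ENNReal.ofReal (2 ^ 100 * weight c R x) := ENNReal.ofReal_le_ofReal hw
        _ = _ := by rw [ENNReal.ofReal_mul (by positivity), ENNReal.ofReal_pow (by norm_num)]; simp
    · simp [hx]
  calc norm6 c R f ≤ eLpNorm f 6 _ := eLpNorm_mono_measure f hle
    _ = _ := by
      rw [eLpNorm_smul_measure_of_ne_top (by norm_num), norm6w]
      simp

/-- The trivial bound: at scales `1 / n` the best constant is a genuine finite number. -/
theorem D_lt_top {n : ℕ} (hn : 0 < n) : D (n : ℝ)⁻¹ < ∞ := by
  have key : IsDecouplingBound (n : ℝ)⁻¹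
      ((2 ^ 100 : ℝ≥0∞) ^ (1 / 6 : ℝ) * n) := by
    intro g hg c
    have hn' : (0 : ℝ) < n := by exact_mod_cast hn
    set R : ℝ := (((n : ℝ)⁻¹) ^ 2)⁻¹ with hRdef
    have hR : 0 < R := by positivity
    have hfl : ⌊((n : ℝ)⁻¹)⁻¹⌋₊ = n := by simp
    have hpi : ∀ i ∈ Finset.range n, IntegrableOn g (piece (n : ℝ)⁻¹ i) := by
      intro i hi
      refine hg.mono_set (Icc_subset_Icc (by positivity) ?_)
      rw [← div_eq_mul_inv, div_le_one hn']
      exact_mod_cast Finset.mem_range.1 hi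
    have hterm : ∀ i ∈ Finset.range n,
        norm6w c R (ext (piece (n : ℝ)⁻¹ i) g) ≤ squareSum (n : ℝ)⁻¹ c g := by
      intro i hi
      rw [squareSum, hfl]
      calc norm6w c R (ext (piece (n : ℝ)⁻¹ i) g)
          = (norm6w c R (ext (piece (n : ℝ)⁻¹ i) g) ^ 2) ^ (1 / 2 : ℝ) := by
            rw [← ENNReal.rpow_natCast, ← ENNReal.rpow_mul]; norm_num
        _ ≤ _ := by
            refine ENNReal.rpow_le_rpow ?_ (by norm_num)
            exact Finset.single_le_sum
              (f := fun i => norm6w c R (ext (piece (n : ℝ)⁻¹ i) g) ^ 2) (fun _ _ => zero_le) hi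
    calc norm6 c R (ext (Icc 0 1) g)
        ≤ ∑ i ∈ Finset.range n, norm6 c R (ext (piece (n : ℝ)⁻¹ i) g) := by
          rw [ext_eq_sum hn hg]
          exact eLpNorm_sum_le (fun i hi => (continuous_ext (hpi i hi)).aestronglyMeasurable)
            (by norm_num)
      _ ≤ ∑ i ∈ Finset.range n, (2 ^ 100 : ℝ≥0∞) ^ (1 / 6 : ℝ) * squareSum (n : ℝ)⁻¹ c g :=
          Finset.sum_le_sum fun i hi => (norm6_le hR _).trans (by gcongr; exact hterm i hi)
      _ = _ := by simp; ring
  refine lt_of_le_of_lt (sInf_le key) ?_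
  exact ENNReal.mul_lt_top (ENNReal.rpow_lt_top_of_nonneg (by norm_num) (by norm_num)) (by simp)

end ParabolaDecoupling

/-!
The proof is a bilinear iteration (a form of efficient congruencing). Write `m = δ ^ (-1 / 2 ^ N)`, so
that all scales are powers of `1 / m`, and let `B` be a square of side length `δ⁻²`. For intervals
`I`, `I'` which are separated by a gap of length `1 / m`, consider `∫ |E_I g|² |E_{I'} g|⁴ w_B`, the
function `mixed`. Three facts move between scales.

* Orthogonality (`mixed_le_sum_mixed`): if `I'` has length `1 / M`, then `I` may be replaced by its
  pieces of length `1 / M²`, at the cost of a factor of order `m`. Six frequencies, four of them in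
  `I'` and two in pieces of `I` that are further than about `2 m` pieces apart, cannot cancel in both
  coordinates of the parabola (`not_resonant`), so that such cross terms vanish when integrated
  against a function whose Fourier transform is supported near `0`.
* Cauchy–Schwarz (`MixedBound.swap`) exchanges the roles of `I` and `I'`. It produces a factor
  `(∫ |E_{I'} g|⁶ w_B) ^ (1/2)`, to which decoupling at a larger scale applies.
* Parabolic rescaling (`rescaling`): decoupling of an interval of length `1 / k` into pieces of length
  `1 / (k l)` holds with the constant `D (1 / l)`.

Starting from the lengths `m ^ (-2 ^ (N - 1))` and `m ^ (-2 ^ N)`, where Hölder and rescaling give the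
bound `mixedBound_base` with `D 1 ≤ 2 ^ 17`, the iteration reaches intervals of length `1 / m` after
`N` steps (`MixedBound.iterate`); each step halves the weight of all earlier decoupling constants,
whence the exponents of the product. To return to the linear inequality, `|E g|²` is expanded over
pairs of intervals of length `1 / m`. Equal or neighbouring intervals are treated by rescaling and
give `D (δ ^ (1 - 1 / 2 ^ N))`; the others are separated and give the product
(`intSix_le_of_mixedBound`, `D_le_of_mixedBound`). The power of `m` which this yields is `5 / 6`,
less than the `4 / 3` allowed.

The delicate point is the weight. Rescaling turns a square into a thin parallelogram, and averaging
`w_B` over parallelograms requires localisations which decay faster than `w_B` itself, whereas the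
definition of `D` provides only the exponent `100`. The decoupling inequality is therefore first
improved to weights with the exponent `118` (`decoupling_improved`). The function `E g` on the square
is multiplied by a nonnegative function `bump2` with compactly supported Fourier transform; the
product has Fourier transform in the `1 / R`-neighbourhood of the parabola, `R = δ⁻²`, and is an
average over translates of the parabola of functions in the range of the extension operator
(`bump2_mul_extC_eq_integral`). These are cut, by a smooth partition of unity in five families, into
functions carried by the intervals of shifted partitions, to which the original inequality applies
(`decoupling_shifted`). Each resulting piece is the convolution of `bump2 * E_J g` with a kernel that
is integrable in the first variable (`lintegral_extC_cutoff_le`), so that the rapid decay of `bump2`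
passes to the weight (`lintegral_convolution_pow_six_le`). The improved inequality is then averaged
over translates against `w_B` (`averaging`, `wt_le_average`, `average_le_wt`).
-/

namespace ParabolaDecoupling

/-! ### A bump function with compactly supported Fourier transform -/

section FourierPair
open scoped FourierTransform Convolution

/-- The half-width `1/480` of the box whose 120-fold convolution power is `spec`. -/
noncomputable def boxHalf : ℝ := 1 / 480

/-- The normalised box `1_{[-a, a]} / (2a)`, `a = boxHalf`. -/
noncomputable def box : ℝ → ℂ := (Icc (-boxHalf) boxHalf).indicator fun _ => 240

/-- The B-splines: `spline k` is the `(k + 1)`-fold convolution power of `box`. -/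
noncomputable def spline : ℕ → ℝ → ℂ
  | 0 => box
  | k + 1 => spline k ⋆[ContinuousLinearMap.mul ℂ ℂ] box

theorem integrable_box : Integrable box := by
  unfold box
  rw [integrable_indicator_iff measurableSet_Icc]
  exact integrableOn_const (by simp)

theorem integrable_spline (k : ℕ) : Integrable (spline k) := by
  induction k with
  | zero => exact integrable_box
  | succ k ih => exact ih.integrable_convolution _ integrable_box

/-- Convolution with the box is a moving average; continuity and the size of the support follow. -/
theorem spline_succ_apply (k : ℕ) (x : ℝ) :
    spline (k + 1) x = 240 * ∫ t in (x - boxHalf)..(x + boxHalf), spline k t := by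
  have hb : (0 : ℝ) < boxHalf := by norm_num [boxHalf]
  rw [intervalIntegral.integral_of_le (by linarith), ← integral_Icc_eq_integral_Ioc,
    ← integral_const_mul, ← integral_indicator measurableSet_Icc]
  change ∫ t, spline k t * box (x - t) = _
  refine integral_congr_ae (Filter.Eventually.of_forall fun t => ?_)
  simp only [box, indicator_apply, mem_Icc]
  by_cases h : x - boxHalf ≤ t ∧ t ≤ x + boxHalf
  · rw [if_pos h, if_pos ⟨by linarith [h.2], by linarith [h.1]⟩, mul_comm]
  · rw [if_neg h, if_neg fun h' => h ⟨by linarith [h'.2], by linarith [h'.1]⟩, mul_zero]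

theorem continuous_spline_succ (k : ℕ) : Continuous (spline (k + 1)) := by
  have h := intervalIntegral.continuous_primitive
    (fun a b => (integrable_spline k).intervalIntegrable (a := a) (b := b)) 0
  have : spline (k + 1) = fun x => 240 * ((∫ t in (0 : ℝ)..(x + boxHalf), spline k t) -
      ∫ t in (0 : ℝ)..(x - boxHalf), spline k t) := by
    funext x
    rw [spline_succ_apply, intervalIntegral.integral_interval_sub_left] <;>
      exact (integrable_spline k).intervalIntegrable
  rw [this]
  exact continuous_const.mul ((h.comp (by fun_prop)).sub (h.comp (by fun_prop)))

theorem spline_eq_zero (k : ℕ) {x : ℝ} (hx : (k + 1) * boxHalf < |x|) : spline k x = 0 := by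
  induction k generalizing x with
  | zero =>
    rw [spline, box, indicator_of_notMem]
    intro h
    have := abs_le.2 h
    simp only [Nat.cast_zero, zero_add, one_mul] at hx
    linarith
  | succ k ih =>
    have hb : (0 : ℝ) < boxHalf := by norm_num [boxHalf]
    rw [spline_succ_apply, intervalIntegral.integral_congr (g := fun _ => (0 : ℂ))]
    · simp
    · intro t ht
      rw [uIcc_of_le (by linarith)] at ht
      refine ih ?_
      push_cast at hx
      have h1 : |x - t| ≤ boxHalf := abs_le.2 ⟨by linarith [ht.2], by linarith [ht.1]⟩
      have := abs_sub_abs_le_abs_sub x t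
      linarith

theorem fourier_box (w : ℝ) : 𝓕 box w = Real.sinc (Real.pi / 240 * w) := by
  have hb : (0 : ℝ) < boxHalf := by norm_num [boxHalf]
  rw [Real.fourier_eq']
  have h1 : ∀ v : ℝ, Complex.exp (↑(-2 * Real.pi * inner ℝ v w) * Complex.I) • box v =
      (Icc (-boxHalf) boxHalf).indicator
        (fun v : ℝ => 240 * Complex.exp ((-2 * Real.pi * w * Complex.I) * v)) v := by
    intro v
    simp only [box, indicator_apply]
    split_ifs
    · simp only [RCLike.inner_apply, conj_trivial, smul_eq_mul]
      push_cast
      rw [mul_comm]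
      congr 2
      ring
    · simp
  simp_rw [h1]
  rw [integral_indicator measurableSet_Icc, integral_Icc_eq_integral_Ioc,
    ← intervalIntegral.integral_of_le (by linarith), intervalIntegral.integral_const_mul]
  by_cases hw : w = 0
  · subst hw
    simp [boxHalf]
    norm_num
  have hpi : (Real.pi : ℂ) ≠ 0 := by exact_mod_cast Real.pi_ne_zero
  have hwc : (w : ℂ) ≠ 0 := by exact_mod_cast hw
  rw [integral_exp_mul_complex (by simp [hpi, hwc]), Real.sinc_of_ne_zero (by positivity)]
  push_cast
  rw [Complex.sin]
  have e1 : (-2 * Real.pi * w * Complex.I) * (boxHalf : ℂ) = -(Real.pi / 240 * w) * Complex.I := by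
    simp [boxHalf]; ring
  have e2 : (-2 * Real.pi * w * Complex.I) * (-boxHalf : ℂ) = (Real.pi / 240 * w) * Complex.I := by
    simp [boxHalf]; ring
  rw [e1, e2]
  field_simp
  ring_nf
  rw [Complex.I_sq]
  ring

theorem fourier_spline (k : ℕ) (w : ℝ) :
    𝓕 (spline k) w = (Real.sinc (Real.pi / 240 * w) : ℂ) ^ (k + 1) := by
  induction k with
  | zero => simp [spline, fourier_box]
  | succ k ih =>
    rw [spline, Real.fourier_mul_convolution_eq (integrable_spline k) integrable_box, ih,
      fourier_box, ← pow_succ]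

/-- A continuous function with support in `[-1/4, 1/4]`, the Fourier transform of `bump`. The power
`120` leaves room above the exponent `100` of the weights; the half-width of the box is chosen so
that `120 * boxHalf = 1 / 4`. -/
noncomputable def spec (w : ℝ) : ℂ := 2 * spline 119 w

/-- A nonnegative function on the line which is at least `1` on `[-1/2, 1/2]`, decays like
`|t|⁻¹²⁰` and has Fourier transform supported in `[-1/4, 1/4]`. -/
noncomputable def bump (t : ℝ) : ℝ := 2 * Real.sinc (Real.pi / 240 * t) ^ 120

theorem continuous_spec : Continuous spec :=
  continuous_const.mul (continuous_spline_succ 118)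

theorem spec_eq_zero {w : ℝ} (hw : 1 / 4 < |w|) : spec w = 0 := by
  rw [spec, spline_eq_zero, mul_zero]
  refine lt_of_eq_of_lt ?_ hw
  norm_num [boxHalf]

theorem integrable_spec : Integrable spec := (integrable_spline 119).const_mul 2

theorem continuous_bump : Continuous bump := by
  unfold bump
  exact continuous_const.mul ((Real.continuous_sinc.comp (by fun_prop)).pow _)

theorem bump_nonneg (t : ℝ) : 0 ≤ bump t := by
  unfold bump
  have : Even 120 := by decide
  exact mul_nonneg zero_le_two (this.pow_nonneg _)

theorem bump_neg (t : ℝ) : bump (-t) = bump t := by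
  rw [bump, mul_neg, Real.sinc_neg, bump]

theorem one_le_bump {t : ℝ} (ht : |t| ≤ 1 / 2) : 1 ≤ bump t := by
  have hx : |Real.pi / 240 * t| ≤ 1 / 120 := by
    rw [abs_mul, abs_of_pos (by positivity)]
    have := Real.pi_le_four
    have h0 := Real.pi_pos
    nlinarith [abs_nonneg t]
  set x := Real.pi / 240 * t
  have h1 : 1 - 1 / 240 ≤ Real.sinc |x| := by
    rcases eq_or_ne x 0 with h | h
    · rw [h]; norm_num
    have hx0 : 0 < |x| := abs_pos.2 h
    rw [Real.sinc_of_ne_zero hx0.ne', le_div_iff₀ hx0]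
    have := Real.sin_gt_sub_cube hx0
    have h3 : |x| ^ 3 / 6 ≤ 1 / 240 * |x| := by
      have : |x| ^ 2 ≤ (1 / 120) ^ 2 := by gcongr
      nlinarith
    linarith
  have h2 : Real.sinc |x| = Real.sinc x := by
    rcases abs_cases x with h | h <;> rw [h.1]
    rw [Real.sinc_neg]
  rw [h2] at h1
  -- Bernoulli: `(1 - 1/240) ^ 120 ≥ 1/2`, which the factor `2` in `bump` compensates
  have h3 := one_add_mul_le_pow (a := (-1 / 240 : ℝ)) (by norm_num) 120
  have h4 : (1 + (-1 / 240 : ℝ)) ^ 120 ≤ Real.sinc x ^ 120 := by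
    apply pow_le_pow_left₀ (by norm_num)
    linarith
  rw [bump]
  norm_num at h3 h4 ⊢
  linarith

/-- A constant in the decay of `bump`. -/
noncomputable def bumpC : ℝ := 10 ^ 300

set_option exponentiation.threshold 400 in
theorem bump_le (t : ℝ) : bump t ≤ bumpC * ((1 + |t|) ^ 120)⁻¹ := by
  have ht := abs_nonneg t
  have h1 : |Real.sinc (Real.pi / 240 * t)| ≤ 160 / (1 + |t|) := by
    rw [le_div_iff₀ (by positivity)]
    rcases le_total |t| 1 with h | h
    · have := Real.abs_sinc_le_one (Real.pi / 240 * t)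
      nlinarith [abs_nonneg (Real.sinc (Real.pi / 240 * t))]
    · have ht0 : t ≠ 0 := by rintro rfl; simp at h; linarith
      have hpi := Real.pi_gt_three
      rw [Real.sinc_of_ne_zero (by positivity), abs_div, abs_mul,
        abs_of_pos (show 0 < Real.pi / 240 by positivity), div_mul_eq_mul_div,
        div_le_iff₀ (by positivity)]
      have := Real.abs_sin_le_one (Real.pi / 240 * t)
      nlinarith
  have h2 : Real.sinc (Real.pi / 240 * t) ^ 120 ≤ (160 / (1 + |t|)) ^ 120 := by
    rw [← (show Even 120 by decide).pow_abs]
    gcongr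
  rw [bump, bumpC]
  calc 2 * Real.sinc (Real.pi / 240 * t) ^ 120 ≤ 2 * (160 / (1 + |t|)) ^ 120 := by gcongr
    _ = (2 * 160 ^ 120) * ((1 + |t|) ^ 120)⁻¹ := by rw [div_pow]; ring
    _ ≤ _ := by
      gcongr
      norm_num

theorem integrable_inv_pow {k : ℕ} (hk : 2 ≤ k) : Integrable fun t : ℝ => ((1 + |t|) ^ k)⁻¹ := by
  refine integrable_inv_one_add_sq.mul_const 2 |>.mono' (by fun_prop) ?_
  refine Filter.Eventually.of_forall fun t => ?_
  have ht := abs_nonneg t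
  rw [Real.norm_of_nonneg (by positivity), ← div_eq_inv_mul, inv_eq_one_div, div_le_div_iff₀
    (by positivity) (by positivity)]
  have : (1 + |t|) ^ 2 ≤ (1 + |t|) ^ k := pow_le_pow_right₀ (by linarith) hk
  nlinarith [sq_abs t]

theorem integrable_bump : Integrable bump := by
  refine ((integrable_inv_pow (k := 120) (by norm_num)).const_mul bumpC).mono'
    continuous_bump.aestronglyMeasurable (Filter.Eventually.of_forall fun t => ?_)
  rw [Real.norm_of_nonneg (bump_nonneg t)]
  exact bump_le t

theorem fourier_spec : 𝓕 spec = fun t => (bump t : ℂ) := by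
  funext t
  have : spec = (2 : ℂ) • spline 119 := by funext w; simp [spec]
  rw [this, Real.fourier_eq']
  have h := fourier_spline 119 t
  rw [Real.fourier_eq'] at h
  simp only [Pi.smul_apply, smul_eq_mul] at h ⊢
  simp_rw [mul_left_comm _ (2 : ℂ)]
  rw [integral_const_mul, h, bump]
  push_cast
  ring

/-- `bump` is the Fourier transform of `spec`. -/
theorem integral_spec_mul_e (t : ℝ) : ∫ w, spec w * e (w * t) = bump t := by
  have h := congrFun fourier_spec (-t)
  simp only [bump_neg, Real.fourier_eq'] at h
  rw [← h]
  refine integral_congr_ae (Filter.Eventually.of_forall fun w => ?_)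
  simp only [RCLike.inner_apply, conj_trivial, smul_eq_mul, e]
  rw [mul_comm]
  congr 2
  push_cast
  ring

/-- `spec` is the Fourier transform of `bump`. -/
theorem integral_bump_mul_e (w : ℝ) : ∫ t, (bump t : ℂ) * e (-(w * t)) = spec w := by
  have h := congrFun (Continuous.fourier_fourierInv_eq continuous_spec integrable_spec
    (by rw [fourier_spec]; exact integrable_bump.ofReal)) w
  have h2 : 𝓕⁻ spec = fun t => (bump t : ℂ) := by
    funext t
    rw [Real.fourierInv_eq_fourier_neg, fourier_spec]
    simp only [bump_neg]
  rw [h2, Real.fourier_eq'] at h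
  rw [← h]
  refine integral_congr_ae (Filter.Eventually.of_forall fun t => ?_)
  simp only [RCLike.inner_apply, conj_trivial, smul_eq_mul, e]
  rw [mul_comm]
  congr 2
  push_cast
  ring

end FourierPair

/-! ### Inequalities for Lebesgue integrals -/

/-- Minkowski's inequality in `L³`, written for the cubes of the summands. -/
theorem lintegral_sum_rpow_third_pow_le {α ι : Type*} [MeasurableSpace α] (μ : Measure α)
    (s : Finset ι) {A : ι → α → ℝ≥0∞} (hA : ∀ j ∈ s, AEMeasurable (A j) μ) :
    ∫⁻ z, (∑ j ∈ s, A j z ^ (1 / 3 : ℝ)) ^ 3 ∂μ ≤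
      (∑ j ∈ s, (∫⁻ z, A j z ∂μ) ^ (1 / 3 : ℝ)) ^ 3 := by
  have key : (∫⁻ z, (∑ j ∈ s, A j z ^ (1 / 3 : ℝ)) ^ (3 : ℝ) ∂μ) ^ (1 / 3 : ℝ) ≤
      ∑ j ∈ s, (∫⁻ z, A j z ∂μ) ^ (1 / 3 : ℝ) := by
    classical
    induction s using Finset.induction_on with
    | empty => simp
    | insert a s ha ih =>
      simp only [Finset.sum_insert ha]
      refine (ENNReal.lintegral_Lp_add_le ((hA a (by simp)).pow_const _)
        (Finset.aemeasurable_fun_sum _ fun j hj => (hA j (by simp [hj])).pow_const _)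
        (by norm_num)).trans ?_
      refine add_le_add (le_of_eq ?_) (ih fun j hj => hA j (by simp [hj]))
      simp_rw [← ENNReal.rpow_mul]
      norm_num
  have h := ENNReal.rpow_le_rpow key (show (0 : ℝ) ≤ 3 by norm_num)
  rw [← ENNReal.rpow_mul] at h
  simp only [← ENNReal.rpow_natCast]
  push_cast
  norm_num at h ⊢
  exact h

/-- Hölder's inequality with a weight `b`. -/
theorem lintegral_mul_pow_six_le {α : Type*} [MeasurableSpace α] (μ : Measure α)
    {a b : α → ℝ≥0∞} (ha : AEMeasurable a μ) (hb : AEMeasurable b μ) :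
    (∫⁻ z, a z * b z ∂μ) ^ 6 ≤ (∫⁻ z, b z ∂μ) ^ 5 * ∫⁻ z, a z ^ 6 * b z ∂μ := by
  have hpq : (6 : ℝ).HolderConjugate (6 / 5) := by
    rw [Real.holderConjugate_iff]; norm_num
  have h := ENNReal.lintegral_mul_le_Lp_mul_Lq μ hpq
    (f := fun z => a z * b z ^ (1 / 6 : ℝ)) (g := fun z => b z ^ (5 / 6 : ℝ))
    (ha.mul (hb.pow_const _)) (hb.pow_const _)
  have e1 : ∀ z, ((fun z => a z * b z ^ (1 / 6 : ℝ)) * fun z => b z ^ (5 / 6 : ℝ)) z = a z * b z := by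
    intro z
    simp only [Pi.mul_apply]
    rw [mul_assoc, ← ENNReal.rpow_add_of_nonneg _ _ (by norm_num) (by norm_num)]
    norm_num
  simp_rw [e1] at h
  have e2 : ∀ z, (a z * b z ^ (1 / 6 : ℝ)) ^ (6 : ℝ) = a z ^ 6 * b z := by
    intro z
    rw [ENNReal.mul_rpow_of_nonneg _ _ (by norm_num), ← ENNReal.rpow_mul]
    norm_num
  have e3 : ∀ z, (b z ^ (5 / 6 : ℝ)) ^ (6 / 5 : ℝ) = b z := by
    intro z
    rw [← ENNReal.rpow_mul]
    norm_num
  simp_rw [e2, e3] at h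
  have h6 := pow_le_pow_left' h 6
  refine h6.trans (le_of_eq ?_)
  rw [mul_pow, mul_comm]
  congr 1
  · rw [← ENNReal.rpow_natCast, ← ENNReal.rpow_mul, ← ENNReal.rpow_natCast]
    norm_num
  · rw [← ENNReal.rpow_natCast, ← ENNReal.rpow_mul]
    norm_num

/-- An `ℓ²L⁶` inequality valid for all translates of the localisations `k₁`, `k₂` holds for a
weight which is comparable to its averages against `k₁` and `k₂`. -/
theorem averaging {ι : Type*} (s : Finset ι) {k₁ k₂ W F : ℝ × ℝ → ℝ≥0∞} {G : ι → ℝ × ℝ → ℝ≥0∞}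
    (hk₁ : Measurable k₁) (hk₂ : Measurable k₂) (hW : Measurable W) (hF : Measurable F)
    (hG : ∀ j, Measurable (G j)) {A B C : ℝ≥0∞}
    (h : ∀ z, ∫⁻ p, F p * k₁ (p - z) ≤
      A * (∑ j ∈ s, (∫⁻ p, G j p * k₂ (p - z)) ^ (1 / 3 : ℝ)) ^ 3)
    (h₁ : ∀ p, B * W p ≤ ∫⁻ z, k₁ (p - z) * W z)
    (h₂ : ∀ p, ∫⁻ z, k₂ (p - z) * W z ≤ C * W p) :
    B * ∫⁻ p, F p * W p ≤ A * C * (∑ j ∈ s, (∫⁻ p, G j p * W p) ^ (1 / 3 : ℝ)) ^ 3 := by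
  have swap : ∀ {k F : ℝ × ℝ → ℝ≥0∞}, Measurable k → Measurable F →
      ∫⁻ z, W z * ∫⁻ p, F p * k (p - z) = ∫⁻ p, F p * ∫⁻ z, k (p - z) * W z := by
    intro k F hk hF
    have e1 : ∀ z, W z * ∫⁻ p, F p * k (p - z) = ∫⁻ p, W z * (F p * k (p - z)) := fun z => by
      rw [lintegral_const_mul _ (by fun_prop)]
    have e2 : ∀ p, F p * ∫⁻ z, k (p - z) * W z = ∫⁻ z, W z * (F p * k (p - z)) := fun p => by
      rw [← lintegral_const_mul _ (by fun_prop)]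
      exact lintegral_congr fun z => by ring
    simp_rw [e1, e2]
    exact lintegral_lintegral_swap (by fun_prop)
  calc B * ∫⁻ p, F p * W p = ∫⁻ p, F p * (B * W p) := by
        rw [← lintegral_const_mul _ (by fun_prop)]
        exact lintegral_congr fun z => by ring
    _ ≤ ∫⁻ p, F p * ∫⁻ z, k₁ (p - z) * W z := lintegral_mono fun p => by
        exact mul_le_mul_right (h₁ p) _
    _ = ∫⁻ z, W z * ∫⁻ p, F p * k₁ (p - z) := (swap hk₁ hF).symm
    _ ≤ ∫⁻ z, W z * (A * (∑ j ∈ s, (∫⁻ p, G j p * k₂ (p - z)) ^ (1 / 3 : ℝ)) ^ 3) :=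
        lintegral_mono fun z => mul_le_mul_right (h z) _
    _ = A * ∫⁻ z, (∑ j ∈ s, (W z * ∫⁻ p, G j p * k₂ (p - z)) ^ (1 / 3 : ℝ)) ^ 3 := by
        rw [← lintegral_const_mul]
        · refine lintegral_congr fun z => ?_
          have : ∀ x : ℝ≥0∞, (W z * x) ^ (1 / 3 : ℝ) = W z ^ (1 / 3 : ℝ) * x ^ (1 / 3 : ℝ) :=
            fun x => ENNReal.mul_rpow_of_nonneg _ _ (by norm_num)
          simp_rw [this, ← Finset.mul_sum, mul_pow]
          rw [← ENNReal.rpow_natCast (W z ^ _), ← ENNReal.rpow_mul]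
          norm_num
          ring
        · refine Measurable.pow_const (Finset.measurable_fun_sum _ fun j _ => ?_) _
          refine Measurable.pow_const (hW.mul ?_) _
          have : Measurable fun q : (ℝ × ℝ) × (ℝ × ℝ) => G j q.2 * k₂ (q.2 - q.1) := by
            have := hG j
            fun_prop
          exact this.lintegral_prod_right'
    _ ≤ A * (∑ j ∈ s, (∫⁻ z, W z * ∫⁻ p, G j p * k₂ (p - z)) ^ (1 / 3 : ℝ)) ^ 3 := by
        gcongr
        refine lintegral_sum_rpow_third_pow_le _ _ fun j _ => (hW.mul ?_).aemeasurable
        have : Measurable fun q : (ℝ × ℝ) × (ℝ × ℝ) => G j q.2 * k₂ (q.2 - q.1) := by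
          have := hG j
          fun_prop
        exact this.lintegral_prod_right'
    _ ≤ A * (∑ j ∈ s, (C * ∫⁻ p, G j p * W p) ^ (1 / 3 : ℝ)) ^ 3 := by
        gcongr with j hj
        rw [swap hk₂ (hG j), ← lintegral_const_mul _ (by have := hG j; fun_prop)]
        refine lintegral_mono fun p => ?_
        rw [mul_left_comm]
        exact mul_le_mul_right (h₂ p) _
    _ = _ := by
        have : ∀ x : ℝ≥0∞, (C * x) ^ (1 / 3 : ℝ) = C ^ (1 / 3 : ℝ) * x ^ (1 / 3 : ℝ) :=
          fun x => ENNReal.mul_rpow_of_nonneg _ _ (by norm_num)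
        simp_rw [this, ← Finset.mul_sum, mul_pow]
        rw [← ENNReal.rpow_natCast (C ^ _), ← ENNReal.rpow_mul]
        norm_num
        ring

/-! ### Weights -/

/-- The profile `(1 + |t| / R)⁻ᵏ` on the line. -/
noncomputable def decay (k : ℕ) (R t : ℝ) : ℝ≥0∞ := ENNReal.ofReal (((1 + |t| / R) ^ k)⁻¹)

theorem measurable_decay (k : ℕ) (R : ℝ) : Measurable (decay k R) := by
  unfold decay; fun_prop

theorem lintegral_decay_le {k : ℕ} (hk : 2 ≤ k) {R : ℝ} (hR : 0 < R) :
    ∫⁻ t, decay k R t ≤ ENNReal.ofReal (4 * R) := by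
  have h1 : ∀ t, decay k R t ≤ ENNReal.ofReal ((1 + (R⁻¹ * t) ^ 2)⁻¹) := by
    intro t
    refine ENNReal.ofReal_le_ofReal (inv_anti₀ (by positivity) ?_)
    have ht : 0 ≤ |t| / R := by positivity
    have : (1 + |t| / R) ^ 2 ≤ (1 + |t| / R) ^ k := pow_le_pow_right₀ (by linarith) hk
    have e1 : (R⁻¹ * t) ^ 2 = (|t| / R) ^ 2 := by
      rw [div_eq_inv_mul, mul_pow, mul_pow, sq_abs]
    rw [e1]
    nlinarith
  have hi : Integrable fun t : ℝ => (1 + (R⁻¹ * t) ^ 2)⁻¹ :=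
    integrable_inv_one_add_sq.comp_mul_left' (inv_ne_zero hR.ne')
  refine (lintegral_mono h1).trans ?_
  rw [← ofReal_integral_eq_lintegral_ofReal hi
    (Filter.Eventually.of_forall fun t => by simp only [Pi.zero_apply]; positivity),
    Measure.integral_comp_mul_left (fun t : ℝ => (1 + t ^ 2)⁻¹), integral_univ_inv_one_add_sq,
    inv_inv, abs_of_pos hR, smul_eq_mul]
  refine ENNReal.ofReal_le_ofReal ?_
  nlinarith [Real.pi_le_four]

theorem decay_le_one {k : ℕ} {R : ℝ} (hR : 0 < R) (t : ℝ) : decay k R t ≤ 1 := by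
  refine ENNReal.ofReal_le_one.2 (inv_le_one_of_one_le₀ (one_le_pow₀ ?_))
  have : 0 ≤ |t| / R := by positivity
  linarith

/-- The point of the plane with the given coordinates. -/
noncomputable def toPlane (p : ℝ × ℝ) : Plane := !₂[p.1, p.2]

/-- The weight `w_B`, `B = B(c, R)`, in coordinates. -/
noncomputable def wt (R : ℝ) (c p : ℝ × ℝ) : ℝ≥0∞ :=
  ENNReal.ofReal (weight (toPlane c) R (toPlane p))

theorem norm_toPlane_sub (p q : ℝ × ℝ) :
    ‖toPlane p - toPlane q‖ = √((p.1 - q.1) ^ 2 + (p.2 - q.2) ^ 2) := by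
  rw [EuclideanSpace.norm_eq, Fin.sum_univ_two]
  simp [toPlane]

theorem wt_eq (R : ℝ) (c p : ℝ × ℝ) : wt R c p =
    ENNReal.ofReal (((1 + √((p.1 - c.1) ^ 2 + (p.2 - c.2) ^ 2) / R) ^ 100)⁻¹) := by
  rw [wt, weight, norm_toPlane_sub]

theorem measurable_wt (R : ℝ) (c : ℝ × ℝ) : Measurable (wt R c) := by
  have : wt R c = fun p => _ := funext (wt_eq R c)
  rw [this]
  fun_prop

theorem wt_le_decay {R : ℝ} (hR : 0 < R) (c p : ℝ × ℝ) : wt R c p ≤ decay 100 R (p.2 - c.2) := by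
  rw [wt_eq, decay]
  have : |p.2 - c.2| ≤ √((p.1 - c.1) ^ 2 + (p.2 - c.2) ^ 2) := Real.abs_le_sqrt (by nlinarith [sq_nonneg (p.1 - c.1)])
  gcongr

/-- The Euclidean weight is dominated by a product of integrable profiles, hence is integrable. -/
theorem wt_le_decay_mul_decay {R : ℝ} (hR : 0 < R) (c p : ℝ × ℝ) :
    wt R c p ≤ decay 50 R (p.1 - c.1) * decay 50 R (p.2 - c.2) := by
  rw [wt_eq, decay, decay, ← ENNReal.ofReal_mul (by positivity), ← mul_inv, ← mul_pow]
  have h2 : |p.2 - c.2| ≤ √((p.1 - c.1) ^ 2 + (p.2 - c.2) ^ 2) := Real.abs_le_sqrt (by nlinarith [sq_nonneg (p.1 - c.1)])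
  have h1 : |p.1 - c.1| ≤ √((p.1 - c.1) ^ 2 + (p.2 - c.2) ^ 2) := Real.abs_le_sqrt (by nlinarith [sq_nonneg (p.2 - c.2)])
  rw [show 100 = 2 * 50 by norm_num, pow_mul, pow_two]
  gcongr

/-- The weight `w_B` is slowly varying at the scale of `B`. -/
theorem wt_le_mul {R : ℝ} (hR : 0 < R) (c p q : ℝ × ℝ) :
    wt R c p ≤ ENNReal.ofReal (1 + (|p.1 - q.1| + |p.2 - q.2|) / R) ^ 100 * wt R c q := by
  rw [wt, wt, ← ENNReal.ofReal_pow (by positivity), ← ENNReal.ofReal_mul (by positivity), weight,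
    weight]
  refine ENNReal.ofReal_le_ofReal ?_
  rw [← div_eq_mul_inv, inv_eq_one_div, div_le_div_iff₀ (by positivity) (by positivity), one_mul,
    ← mul_pow]
  have h1 : ‖toPlane q - toPlane p‖ ≤ |p.1 - q.1| + |p.2 - q.2| := by
    rw [norm_sub_rev, norm_toPlane_sub]
    refine Real.sqrt_le_iff.2 ⟨by positivity, ?_⟩
    nlinarith [abs_nonneg (p.1 - q.1), abs_nonneg (p.2 - q.2), sq_abs (p.1 - q.1), sq_abs (p.2 - q.2)]
  have h2 : ‖toPlane q - toPlane c‖ ≤ ‖toPlane p - toPlane c‖ + (|p.1 - q.1| + |p.2 - q.2|) := by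
    have := norm_sub_le_norm_sub_add_norm_sub (toPlane q) (toPlane p) (toPlane c)
    linarith
  gcongr
  have h3 : ‖toPlane q - toPlane c‖ / R ≤
      ‖toPlane p - toPlane c‖ / R + (|p.1 - q.1| + |p.2 - q.2|) / R := by
    rw [← add_div]; gcongr
  have ha : 0 ≤ ‖toPlane p - toPlane c‖ / R := by positivity
  have hb : 0 ≤ (|p.1 - q.1| + |p.2 - q.2|) / R := by positivity
  nlinarith [mul_nonneg ha hb]

theorem lintegral_mul_prod {f g : ℝ → ℝ≥0∞} (hf : Measurable f) (hg : Measurable g) :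
    ∫⁻ p : ℝ × ℝ, f p.1 * g p.2 = (∫⁻ x, f x) * ∫⁻ y, g y :=
  lintegral_prod_mul hf.aemeasurable hg.aemeasurable

theorem lintegral_wt_lt_top {R : ℝ} (hR : 0 < R) (c : ℝ × ℝ) : ∫⁻ p, wt R c p < ∞ := by
  refine (lintegral_mono fun p => wt_le_decay_mul_decay hR c p).trans_lt ?_
  have h1 := measurable_decay 50 R
  rw [lintegral_mul_prod (f := fun x => decay 50 R (x - c.1)) (g := fun y => decay 50 R (y - c.2))
    (by fun_prop) (by fun_prop), lintegral_sub_right_eq_self, lintegral_sub_right_eq_self]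
  have := (lintegral_decay_le (k := 50) (by norm_num) hR).trans_lt ENNReal.ofReal_lt_top
  exact ENNReal.mul_lt_top this this

/-! ### The extension operator in coordinates -/

/-- The extension operator as a function of the coordinate pair. -/
noncomputable def extC (J : Set ℝ) (g : ℝ → ℂ) (p : ℝ × ℝ) : ℂ :=
  ∫ ξ in J, g ξ * e (ξ * p.1 + ξ ^ 2 * p.2)

theorem ext_toPlane (J : Set ℝ) (g : ℝ → ℂ) (p : ℝ × ℝ) : ext J g (toPlane p) = extC J g p := by
  simp [ext, extC, toPlane]

theorem continuous_e : Continuous e := by unfold e; fun_prop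

theorem e_add (a b : ℝ) : e (a + b) = e a * e b := by
  rw [e, e, e, ← Complex.exp_add]; congr 1; push_cast; ring

theorem continuous_toPlane : Continuous toPlane := by
  unfold toPlane
  fun_prop

theorem continuous_extC {J : Set ℝ} {g : ℝ → ℂ} (hg : IntegrableOn g J) : Continuous (extC J g) := by
  have : extC J g = fun p => ext J g (toPlane p) := funext fun p => (ext_toPlane J g p).symm
  rw [this]
  exact (continuous_ext hg).comp continuous_toPlane

theorem integrableOn_char {J : Set ℝ} {g : ℝ → ℂ} (hg : IntegrableOn g J) (p : ℝ × ℝ) :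
    IntegrableOn (fun ξ => g ξ * e (ξ * p.1 + ξ ^ 2 * p.2)) J := by
  simpa [toPlane] using integrableOn_phase hg (toPlane p)

theorem norm_extC_le (J : Set ℝ) (g : ℝ → ℂ) (p : ℝ × ℝ) : ‖extC J g p‖ ≤ ∫ ξ in J, ‖g ξ‖ := by
  refine (norm_integral_le_integral_norm _).trans (le_of_eq ?_)
  simp [norm_e]

theorem lintegral_plane (F : Plane → ℝ≥0∞) : ∫⁻ x, F x = ∫⁻ p, F (toPlane p) := by
  have h1 := (PiLp.volume_preserving_toLp (Fin 2)).lintegral_comp_emb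
    (MeasurableEquiv.toLp 2 (Fin 2 → ℝ)).measurableEmbedding F
  have h2 := (volume_preserving_finTwoArrow ℝ).symm.lintegral_comp_emb
    (MeasurableEquiv.finTwoArrow (α := ℝ)).symm.measurableEmbedding
    (fun y : Fin 2 → ℝ => F (WithLp.toLp 2 y))
  rw [← h1]
  erw [← h2]
  rfl

/-- `∫ |f|⁶ w`. -/
noncomputable def intSix (w : ℝ × ℝ → ℝ≥0∞) (f : ℝ × ℝ → ℂ) : ℝ≥0∞ := ∫⁻ p, ‖f p‖ₑ ^ 6 * w p

/-- The indicator function of the square with centre `0` and side length `R`. -/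
noncomputable def box2 (R : ℝ) (p : ℝ × ℝ) : ℝ≥0∞ :=
  {p : ℝ × ℝ | |p.1| ≤ R / 2 ∧ |p.2| ≤ R / 2}.indicator (fun _ => 1) p

theorem measurableSet_box2 (R : ℝ) :
    MeasurableSet {p : ℝ × ℝ | |p.1| ≤ R / 2 ∧ |p.2| ≤ R / 2} := by
  have h : {p : ℝ × ℝ | |p.1| ≤ R / 2 ∧ |p.2| ≤ R / 2} =
      {p : ℝ × ℝ | |p.1| ≤ R / 2} ∩ {p : ℝ × ℝ | |p.2| ≤ R / 2} := by ext p; simp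
  rw [h]
  exact (measurableSet_le (by fun_prop) (by fun_prop)).inter
    (measurableSet_le (by fun_prop) (by fun_prop))

theorem measurable_box2 (R : ℝ) : Measurable (box2 R) :=
  measurable_const.indicator (measurableSet_box2 R)

theorem measurableSet_square (c : Plane) (R : ℝ) : MeasurableSet (square c R) := by
  have : IsClosed (square c R) := by
    simp only [square, ofPred_forall]
    exact isClosed_iInter fun k => isClosed_le (by fun_prop) (by fun_prop)
  exact this.measurableSet

/-- The norms of the decoupling inequality, raised to suitable powers, are Lebesgue
integrals in coordinates. -/
theorem norm6_pow (c : ℝ × ℝ) (R : ℝ) (J : Set ℝ) (g : ℝ → ℂ) :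
    norm6 (toPlane c) R (ext J g) ^ 6 = intSix (fun p => box2 R (p - c)) (extC J g) := by
  rw [norm6, eLpNorm_eq_lintegral_rpow_enorm_toReal (by norm_num) (by norm_num),
    ← ENNReal.rpow_natCast, ← ENNReal.rpow_mul, ← lintegral_indicator (measurableSet_square _ _),
    lintegral_plane]
  norm_num
  refine lintegral_congr fun p => ?_
  have : toPlane p ∈ square (toPlane c) R ↔ p - c ∈ {p : ℝ × ℝ | |p.1| ≤ R / 2 ∧ |p.2| ≤ R / 2} := by
    simp [square, toPlane, Fin.forall_fin_two]
  by_cases h : toPlane p ∈ square (toPlane c) R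
  · simp only [box2]
    rw [indicator_of_mem h, indicator_of_mem (this.1 h), mul_one, ext_toPlane]
  · simp only [box2]
    rw [indicator_of_notMem h, indicator_of_notMem (mt this.2 h), mul_zero]

theorem norm6w_sq (c : ℝ × ℝ) (R : ℝ) (J : Set ℝ) (g : ℝ → ℂ) :
    norm6w (toPlane c) R (ext J g) ^ 2 = intSix (wt R c) (extC J g) ^ (1 / 3 : ℝ) := by
  have hm : Measurable fun x => ENNReal.ofReal (weight (toPlane c) R x) := by
    unfold weight; fun_prop
  rw [norm6w, eLpNorm_eq_lintegral_rpow_enorm_toReal (by norm_num) (by norm_num),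
    lintegral_withDensity_eq_lintegral_mul_non_measurable _ hm
      (Filter.Eventually.of_forall fun _ => ENNReal.ofReal_lt_top),
    ← ENNReal.rpow_natCast, ← ENNReal.rpow_mul, lintegral_plane]
  norm_num
  congr 1
  refine lintegral_congr fun p => ?_
  simp only [wt, ext_toPlane]
  rw [mul_comm]

theorem toPlane_surjective (c : Plane) : ∃ q, toPlane q = c :=
  ⟨(c 0, c 1), by ext k; fin_cases k <;> simp [toPlane]⟩

theorem floor_inv_inv (n : ℕ) : ⌊((n : ℝ)⁻¹)⁻¹⌋₊ = n := by simp

theorem sq_inv_inv (n : ℕ) : ((((n : ℝ)⁻¹) ^ 2)⁻¹ : ℝ) = (n : ℝ) ^ 2 := by simp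

theorem squareSum_pow (n : ℕ) (c : ℝ × ℝ) (g : ℝ → ℂ) :
    squareSum (n : ℝ)⁻¹ (toPlane c) g ^ 6 =
      (∑ i ∈ Finset.range n,
        intSix (wt ((n : ℝ) ^ 2) c) (extC (piece (n : ℝ)⁻¹ i) g) ^ (1 / 3 : ℝ)) ^ 3 := by
  rw [squareSum, floor_inv_inv, sq_inv_inv]
  simp_rw [norm6w_sq]
  rw [← ENNReal.rpow_natCast, ← ENNReal.rpow_mul, ← ENNReal.rpow_natCast]
  norm_num

/-- The decoupling inequality for sixth powers, in coordinates. -/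
theorem isDecouplingBound_iff (n : ℕ) (C : ℝ≥0∞) :
    IsDecouplingBound (n : ℝ)⁻¹ C ↔ ∀ g : ℝ → ℂ, IntegrableOn g (Icc 0 1) → ∀ c : ℝ × ℝ,
      intSix (fun p => box2 ((n : ℝ) ^ 2) (p - c)) (extC (Icc 0 1) g) ≤
        C ^ 6 * (∑ i ∈ Finset.range n,
          intSix (wt ((n : ℝ) ^ 2) c) (extC (piece (n : ℝ)⁻¹ i) g) ^ (1 / 3 : ℝ)) ^ 3 := by
  have key : ∀ (g : ℝ → ℂ) (c : ℝ × ℝ),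
      norm6 (toPlane c) ((((n : ℝ)⁻¹) ^ 2)⁻¹) (ext (Icc 0 1) g) ≤
        C * squareSum (n : ℝ)⁻¹ (toPlane c) g ↔
      intSix (fun p => box2 ((n : ℝ) ^ 2) (p - c)) (extC (Icc 0 1) g) ≤
        C ^ 6 * (∑ i ∈ Finset.range n,
          intSix (wt ((n : ℝ) ^ 2) c) (extC (piece (n : ℝ)⁻¹ i) g) ^ (1 / 3 : ℝ)) ^ 3 := by
    intro g c
    rw [← squareSum_pow, ← mul_pow, ← norm6_pow, sq_inv_inv]
    exact (ENNReal.pow_le_pow_left_iff (by norm_num)).symm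
  constructor
  · intro h g hg c
    exact (key g c).1 (h g hg (toPlane c))
  · intro h g hg c
    obtain ⟨c, rfl⟩ := toPlane_surjective c
    exact (key g c).2 (h g hg c)

/-- Finiteness of the right-hand side, so that it may be divided by in `isDecouplingBound_D`. -/
theorem intSix_lt_top {w : ℝ × ℝ → ℝ≥0∞} (hw : ∫⁻ p, w p < ∞) (J : Set ℝ) (g : ℝ → ℂ) :
    intSix w (extC J g) < ∞ := by
  have h1 : ∀ p, ‖extC J g p‖ₑ ^ 6 * w p ≤ ENNReal.ofReal (∫ ξ in J, ‖g ξ‖) ^ 6 * w p := by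
    intro p
    gcongr
    rw [← ofReal_norm]
    exact ENNReal.ofReal_le_ofReal (norm_extC_le J g p)
  refine (lintegral_mono h1).trans_lt ?_
  rw [lintegral_const_mul' _ _ (by simp)]
  exact ENNReal.mul_lt_top (by simp) hw

/-- The infimum defining `D` is attained, so that `D` may be used as a decoupling constant. -/
theorem isDecouplingBound_D {n : ℕ} (hn : 0 < n) : IsDecouplingBound (n : ℝ)⁻¹ (D (n : ℝ)⁻¹) := by
  intro g hg c
  obtain ⟨c, rfl⟩ := toPlane_surjective c
  have hn' : (0 : ℝ) < (n : ℝ) ^ 2 := by positivity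
  have hfin : squareSum (n : ℝ)⁻¹ (toPlane c) g ≠ ∞ := by
    rw [squareSum, floor_inv_inv, sq_inv_inv]
    refine ENNReal.rpow_ne_top_of_nonneg (by norm_num) (ENNReal.sum_ne_top.2 fun i _ => ?_)
    rw [norm6w_sq]
    exact ENNReal.rpow_ne_top_of_nonneg (by norm_num)
      (intSix_lt_top (lintegral_wt_lt_top hn' c) _ _).ne
  by_cases h0 : squareSum (n : ℝ)⁻¹ (toPlane c) g = 0
  · obtain ⟨C, hC, -⟩ := sInf_lt_iff.1 (D_lt_top hn)
    have := hC g hg (toPlane c)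
    rwa [h0, mul_zero] at this ⊢
  rw [← ENNReal.div_le_iff h0 hfin]
  refine le_sInf fun C hC => ?_
  rw [ENNReal.div_le_iff h0 hfin]
  exact hC g hg (toPlane c)

theorem decoupling_D {n : ℕ} (hn : 0 < n) {g : ℝ → ℂ} (hg : IntegrableOn g (Icc 0 1))
    (c : ℝ × ℝ) :
    intSix (fun p => box2 ((n : ℝ) ^ 2) (p - c)) (extC (Icc 0 1) g) ≤
      D (n : ℝ)⁻¹ ^ 6 * (∑ i ∈ Finset.range n,
        intSix (wt ((n : ℝ) ^ 2) c) (extC (piece (n : ℝ)⁻¹ i) g) ^ (1 / 3 : ℝ)) ^ 3 :=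
  (isDecouplingBound_iff n _).1 (isDecouplingBound_D hn) g hg c

/-! ### Affine symmetries of the parabola -/

/-- The linear map of the plane dual to the affine change of frequency `ξ = α + σ s`. -/
def para (α σ : ℝ) (p : ℝ × ℝ) : ℝ × ℝ := (σ * (p.1 + 2 * α * p.2), σ ^ 2 * p.2)

theorem continuous_para (α σ : ℝ) : Continuous (para α σ) := by unfold para; fun_prop

theorem para_sub (α σ : ℝ) (p q : ℝ × ℝ) : para α σ (p - q) = para α σ p - para α σ q := by
  simp only [para, Prod.fst_sub, Prod.snd_sub, Prod.mk_sub_mk, Prod.mk.injEq]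
  constructor <;> ring

/-- An affine change of frequency `ξ = α + σ s` acts on the plane by `para α σ`, up to a phase. -/
theorem extC_affine (α σ : ℝ) {u v : ℝ} (huv : u ≤ v) (hσ : 0 < σ) (g : ℝ → ℂ) (p : ℝ × ℝ) :
    extC (Icc (α + σ * u) (α + σ * v)) g p =
      σ * (e (α * p.1 + α ^ 2 * p.2) * extC (Icc u v) (fun s => g (α + σ * s)) (para α σ p)) := by
  rw [extC, extC, integral_Icc_eq_integral_Ioc, integral_Icc_eq_integral_Ioc,
    ← intervalIntegral.integral_of_le huv, ← intervalIntegral.integral_of_le (by gcongr),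
    ← intervalIntegral.smul_integral_comp_add_mul, ← intervalIntegral.integral_const_mul]
  simp only [Complex.real_smul]
  congr 1
  refine intervalIntegral.integral_congr fun s _ => ?_
  simp only [para]
  rw [mul_left_comm, ← e_add]
  congr 2
  ring

theorem enorm_extC_affine (α σ : ℝ) {u v : ℝ} (huv : u ≤ v) (hσ : 0 < σ) (g : ℝ → ℂ)
    (p : ℝ × ℝ) :
    ‖extC (Icc (α + σ * u) (α + σ * v)) g p‖ₑ =
      ENNReal.ofReal σ * ‖extC (Icc u v) (fun s => g (α + σ * s)) (para α σ p)‖ₑ := by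
  rw [extC_affine α σ huv hσ, enorm_mul, enorm_mul]
  have h1 : ‖e (α * p.1 + α ^ 2 * p.2)‖ₑ = 1 := by
    rw [← ofReal_norm, norm_e]; simp
  have h2 : ‖(σ : ℂ)‖ₑ = ENNReal.ofReal σ := by
    rw [← ofReal_norm, Complex.norm_real, Real.norm_of_nonneg hσ.le]
  rw [h1, h2, one_mul]

theorem lintegral_comp_mul_add {σ : ℝ} (hσ : 0 < σ) (t : ℝ) {f : ℝ → ℝ≥0∞} (hf : Measurable f) :
    ∫⁻ x, f (σ * (x + t)) = ENNReal.ofReal σ⁻¹ * ∫⁻ x, f x := by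
  rw [lintegral_add_right_eq_self (fun x => f (σ * x)) t,
    ← lintegral_map (f := f) hf (measurable_const_mul σ), Real.map_volume_mul_left hσ.ne',
    lintegral_smul_measure, abs_of_pos (by positivity), smul_eq_mul]

theorem lintegral_comp_para (α : ℝ) {σ : ℝ} (hσ : 0 < σ) {F : ℝ × ℝ → ℝ≥0∞} (hF : Measurable F) :
    ∫⁻ p, F (para α σ p) = ENNReal.ofReal (σ⁻¹ ^ 3) * ∫⁻ p, F p := by
  have hc := continuous_para α σ
  rw [Measure.volume_eq_prod, lintegral_prod_symm' (fun p => F (para α σ p)) (hF.comp hc.measurable),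
    lintegral_prod_symm' _ hF]
  have h1 : ∀ y, ∫⁻ x, F (para α σ (x, y)) = ENNReal.ofReal σ⁻¹ * ∫⁻ x, F (x, σ ^ 2 * y) :=
    fun y => lintegral_comp_mul_add hσ (2 * α * y) (f := fun x => F (x, σ ^ 2 * y)) (by fun_prop)
  simp_rw [h1]
  rw [lintegral_const_mul']
  · have h2 := lintegral_comp_mul_add (σ := σ ^ 2) (by positivity) 0
      (f := fun y => ∫⁻ x, F (x, y)) (hF.lintegral_prod_left')
    simp only [add_zero] at h2
    rw [h2, ← mul_assoc, ← ENNReal.ofReal_mul (by positivity)]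
    congr 2
    field_simp
  · simp

theorem extC_modulate (J : Set ℝ) (g : ℝ → ℂ) (z p : ℝ × ℝ) :
    extC J (fun ξ => g ξ * e (ξ * z.1 + ξ ^ 2 * z.2)) p = extC J g (p + z) := by
  unfold extC
  congr 1
  funext ξ
  rw [mul_assoc, ← e_add]
  congr 2
  simp only [Prod.fst_add, Prod.snd_add]
  ring

theorem integrableOn_comp_affine {α σ u v : ℝ} (hσ : 0 < σ) {g : ℝ → ℂ}
    (hg : IntegrableOn g (Icc (α + σ * u) (α + σ * v))) :
    IntegrableOn (fun s => g (α + σ * s)) (Icc u v) := by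
  have h := (integrable_indicator_iff measurableSet_Icc).2 hg
  have h2 := (h.comp_add_left α).comp_mul_left' hσ.ne'
  rw [← integrable_indicator_iff measurableSet_Icc]
  refine h2.congr (Filter.Eventually.of_forall fun s => ?_)
  simp only [indicator_apply, mem_Icc, add_le_add_iff_left, mul_le_mul_iff_right₀ hσ]

/-! ### Decoupling for a shifted partition -/

/-- The image of a square under a shear of slope at most `2` is covered by three translates of the
square. -/
theorem box2_le_sum {R a : ℝ} (ha : |a| ≤ 1) (p : ℝ × ℝ) :
    box2 R p ≤ ∑ k ∈ Finset.range 3, box2 R (para a 1 p - (((k : ℝ) - 1) * R, 0)) := by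
  by_cases hp : p ∈ {p : ℝ × ℝ | |p.1| ≤ R / 2 ∧ |p.2| ≤ R / 2}
  swap
  · rw [box2, indicator_of_notMem hp]; exact zero_le
  have hp' : |p.1| ≤ R / 2 ∧ |p.2| ≤ R / 2 := hp
  have h2 : |2 * a * p.2| ≤ R := by
    rw [abs_mul, abs_mul, abs_two]
    nlinarith [abs_nonneg a, abs_nonneg p.2]
  have h1 := abs_le.1 hp'.1
  have h3 := abs_le.1 h2
  have hk : ∃ k ∈ Finset.range 3, |p.1 + 2 * a * p.2 - ((k : ℝ) - 1) * R| ≤ R / 2 := by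
    by_cases hc : p.1 + 2 * a * p.2 < -(R / 2)
    · exact ⟨0, by simp, abs_le.2 ⟨by push_cast; linarith, by push_cast; linarith⟩⟩
    by_cases hc' : R / 2 < p.1 + 2 * a * p.2
    · exact ⟨2, by simp, abs_le.2 ⟨by push_cast; linarith, by push_cast; linarith⟩⟩
    · exact ⟨1, by simp, abs_le.2 ⟨by push_cast; linarith, by push_cast; linarith⟩⟩
  obtain ⟨k, hk, hk'⟩ := hk
  refine le_trans ?_ (Finset.single_le_sum
    (f := fun k : ℕ => box2 R (para a 1 p - (((k : ℝ) - 1) * R, 0))) (fun _ _ => zero_le) hk)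
  have hm : para a 1 p - (((k : ℝ) - 1) * R, 0) ∈ {p : ℝ × ℝ | |p.1| ≤ R / 2 ∧ |p.2| ≤ R / 2} := by
    refine ⟨?_, ?_⟩
    · simpa [para] using hk'
    · simpa [para] using hp'.2
  simp only [box2]
  rw [indicator_of_mem hm, indicator_of_mem hp]

/-- Decoupling for the partition of `[a, a + 1]`. The weights only need to record the decay in
the second variable, which the shear does not affect. -/
theorem decoupling_shifted {n : ℕ} (hn : 0 < n) {a : ℝ} (ha : |a| ≤ 1) {h : ℝ → ℂ}
    (hh : IntegrableOn h (Icc a (a + 1))) :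
    intSix (box2 ((n : ℝ) ^ 2)) (extC (Icc a (a + 1)) h) ≤
      3 * D (n : ℝ)⁻¹ ^ 6 * (∑ i ∈ Finset.range n,
        intSix (fun p => decay 100 ((n : ℝ) ^ 2) p.2)
          (extC (Icc (a + i * (n : ℝ)⁻¹) (a + (i + 1) * (n : ℝ)⁻¹)) h) ^ (1 / 3 : ℝ)) ^ 3 := by
  have hn' : (0 : ℝ) < n := by exact_mod_cast hn
  set R : ℝ := (n : ℝ) ^ 2 with hRdef
  have hR : 0 < R := by positivity
  set g : ℝ → ℂ := fun s => h (a + 1 * s) with hg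
  have hgi : IntegrableOn g (Icc 0 1) := by
    refine integrableOn_comp_affine one_pos ?_
    simpa using hh
  have hen : ∀ u v : ℝ, u ≤ v → ∀ p, ‖extC (Icc (a + u) (a + v)) h p‖ₑ =
      ‖extC (Icc u v) g (para a 1 p)‖ₑ := by
    intro u v huv p
    have := enorm_extC_affine a 1 huv one_pos h p
    simpa [hg] using this
  have hpc := (continuous_para a 1).measurable
  have hsub : ∀ i ∈ Finset.range n, piece (n : ℝ)⁻¹ i ⊆ Icc 0 1 := by
    intro i hi
    refine Icc_subset_Icc (by positivity) ?_
    rw [← div_eq_mul_inv, div_le_one hn']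
    exact_mod_cast Finset.mem_range.1 hi
  have hmain : Measurable fun q => ‖extC (Icc 0 1) g q‖ₑ := (continuous_extC hgi).measurable.enorm
  calc intSix (box2 R) (extC (Icc a (a + 1)) h)
      ≤ ∫⁻ p, ∑ k ∈ Finset.range 3, ‖extC (Icc 0 1) g (para a 1 p)‖ₑ ^ 6 *
          box2 R (para a 1 p - (((k : ℝ) - 1) * R, 0)) := by
        refine lintegral_mono fun p => ?_
        have := hen 0 1 zero_le_one p
        rw [add_zero] at this
        simp only [this]
        rw [← Finset.mul_sum]
        exact mul_le_mul_right (box2_le_sum ha p) _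
    _ = ∑ k ∈ Finset.range 3, intSix (fun q => box2 R (q - (((k : ℝ) - 1) * R, 0)))
          (extC (Icc 0 1) g) := by
        have hb := measurable_box2 R
        rw [lintegral_finsetSum]
        · refine Finset.sum_congr rfl fun k _ => ?_
          rw [lintegral_comp_para a one_pos (F := fun q => ‖extC (Icc 0 1) g q‖ₑ ^ 6 *
            box2 R (q - (((k : ℝ) - 1) * R, 0))) (by fun_prop)]
          simp [intSix]
        · intro k _
          have := hmain.comp hpc
          simp only [Function.comp_def] at this
          fun_prop
    _ ≤ ∑ k ∈ Finset.range 3, D (n : ℝ)⁻¹ ^ 6 * (∑ i ∈ Finset.range n,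
        intSix (fun p => decay 100 R p.2)
          (extC (Icc (a + i * (n : ℝ)⁻¹) (a + (i + 1) * (n : ℝ)⁻¹)) h) ^ (1 / 3 : ℝ)) ^ 3 := by
        refine Finset.sum_le_sum fun k _ => (decoupling_D hn hgi _).trans ?_
        gcongr with i hi
        calc intSix (wt R ((k - 1) * R, 0)) (extC (piece (n : ℝ)⁻¹ i) g)
            ≤ ∫⁻ q, ‖extC (piece (n : ℝ)⁻¹ i) g q‖ₑ ^ 6 * decay 100 R q.2 := by
              refine lintegral_mono fun q => mul_le_mul_right ?_ _
              simpa using wt_le_decay hR ((k - 1) * R, 0) q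
          _ = ∫⁻ p, ‖extC (piece (n : ℝ)⁻¹ i) g (para a 1 p)‖ₑ ^ 6 *
                decay 100 R (para a 1 p).2 := by
              have h1 : Measurable fun q => ‖extC (piece (n : ℝ)⁻¹ i) g q‖ₑ :=
                (continuous_extC (hgi.mono_set (hsub i hi))).measurable.enorm
              have h2 := measurable_decay 100 R
              rw [lintegral_comp_para a one_pos (F := fun q =>
                ‖extC (piece (n : ℝ)⁻¹ i) g q‖ₑ ^ 6 * decay 100 R q.2) (by fun_prop)]
              simp
          _ = _ := by
              refine lintegral_congr fun p => ?_
              rw [hen _ _ (by gcongr; linarith), piece]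
              simp [para]
    _ = _ := by
        rw [Finset.sum_const, Finset.card_range, nsmul_eq_mul, mul_assoc]
        norm_cast

/-! ### The kernel of a smooth frequency cutoff -/

/-- The frequency cutoff `sin² (π s)`, used on `[0, 1]`. -/
noncomputable def cutoff (s : ℝ) : ℂ := Complex.sin (Real.pi * s) ^ 2

theorem continuous_cutoff : Continuous cutoff := by unfold cutoff; fun_prop

theorem norm_sin_ofReal_le (x : ℝ) : ‖Complex.sin (x : ℂ)‖ ≤ 1 := by
  rw [← Complex.ofReal_sin, Complex.norm_real]; exact Real.abs_sin_le_one x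

theorem norm_cos_ofReal_le (x : ℝ) : ‖Complex.cos (x : ℂ)‖ ≤ 1 := by
  rw [← Complex.ofReal_cos, Complex.norm_real]; exact Real.abs_cos_le_one x

theorem norm_cutoff_le (s : ℝ) : ‖cutoff s‖ ≤ 1 := by
  rw [cutoff, norm_pow, ← Complex.ofReal_mul]
  exact pow_le_one₀ (norm_nonneg _) (norm_sin_ofReal_le _)

theorem norm_extC_cutoff_le_one (p : ℝ × ℝ) : ‖extC (Icc 0 1) cutoff p‖ ≤ 1 := by
  refine (norm_extC_le _ _ p).trans ?_
  calc ∫ ξ in Icc (0 : ℝ) 1, ‖cutoff ξ‖ ≤ ∫ ξ in Icc (0 : ℝ) 1, (1 : ℝ) :=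
        integral_mono_of_nonneg (Filter.Eventually.of_forall fun _ => norm_nonneg _)
          (integrableOn_const (by simp)) (Filter.Eventually.of_forall norm_cutoff_le)
    _ = 1 := by simp

/-- Decay of the kernel in the first variable: the cutoff and its derivative vanish at `0` and `1`, so
that one can integrate by parts twice. -/
theorem norm_extC_cutoff_le {u b : ℝ} (hu : u ≠ 0) :
    ‖extC (Icc 0 1) cutoff (u, b)‖ ≤ 6 * (1 + |b|) ^ 2 / u ^ 2 := by
  -- `f0` is the amplitude of the oscillatory integral, `f1` and `f2` are its derivatives
  set I2 : ℂ := 2 * Real.pi * Complex.I with hI2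
  set π' : ℂ := (Real.pi : ℂ) with hπ
  have hI2n : ‖I2‖ = 2 * Real.pi := by
    simp [hI2, hπ, abs_of_pos Real.pi_pos]
  have hI20 : I2 ≠ 0 := by
    rw [← norm_ne_zero_iff, hI2n]; positivity
  have huc : (u : ℂ) ≠ 0 := by exact_mod_cast hu
  have hsq : ∀ z : ℂ, HasDerivAt (fun z : ℂ => Complex.exp (I2 * b * z ^ 2))
      (2 * I2 * b * z * Complex.exp (I2 * b * z ^ 2)) z := by
    intro z
    refine ((((hasDerivAt_id' z).pow 2).const_mul (I2 * b)).cexp).congr_deriv ?_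
    simp only [Pi.pow_apply]; push_cast; ring
  have hsin : ∀ z : ℂ, HasDerivAt (fun z : ℂ => Complex.sin (π' * z)) (π' * Complex.cos (π' * z)) z := by
    intro z
    refine (((hasDerivAt_id' z).const_mul π').csin).congr_deriv ?_
    ring
  have hcos : ∀ z : ℂ, HasDerivAt (fun z : ℂ => Complex.cos (π' * z)) (-(π' * Complex.sin (π' * z))) z := by
    intro z
    refine (((hasDerivAt_id' z).const_mul π').ccos).congr_deriv ?_
    ring
  set f0 : ℂ → ℂ := fun z => Complex.sin (π' * z) ^ 2 * Complex.exp (I2 * b * z ^ 2) with hf0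
  set f1 : ℂ → ℂ := fun z => (2 * π' * (Complex.sin (π' * z) * Complex.cos (π' * z)) +
    2 * I2 * b * (z * Complex.sin (π' * z) ^ 2)) * Complex.exp (I2 * b * z ^ 2) with hf1
  set f2 : ℂ → ℂ := fun z => (2 * π' ^ 2 * (Complex.cos (π' * z) ^ 2 - Complex.sin (π' * z) ^ 2) +
    8 * π' * I2 * b * (z * (Complex.sin (π' * z) * Complex.cos (π' * z))) +
    2 * I2 * b * Complex.sin (π' * z) ^ 2 + 4 * I2 ^ 2 * b ^ 2 * (z ^ 2 * Complex.sin (π' * z) ^ 2)) *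
      Complex.exp (I2 * b * z ^ 2) with hf2
  have d0 : ∀ z, HasDerivAt f0 (f1 z) z := by
    intro z
    refine (((hsin z).pow 2).mul (hsq z)).congr_deriv ?_
    simp only [hf1, Pi.pow_apply]; push_cast; ring
  have d1 : ∀ z, HasDerivAt f1 (f2 z) z := by
    intro z
    refine (((((hsin z).mul (hcos z)).const_mul (2 * π')).add
      (((hasDerivAt_id' z).mul ((hsin z).pow 2)).const_mul (2 * I2 * b))).mul (hsq z)).congr_deriv ?_
    simp only [hf2, Pi.pow_apply, Pi.mul_apply, Pi.add_apply]; push_cast; ring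
  set v : ℂ → ℂ := fun z => Complex.exp (I2 * u * z) with hv
  have dv : ∀ z, HasDerivAt (fun z => v z / (I2 * u)) (v z) z := by
    intro z
    refine ((((hasDerivAt_id' z).const_mul (I2 * u)).cexp).div_const (I2 * u)).congr_deriv ?_
    simp only [hv]
    field_simp
  have c1 : Continuous f1 := by simp only [hf1]; fun_prop
  have c2 : Continuous f2 := by simp only [hf2]; fun_prop
  have cv : Continuous v := by simp only [hv]; fun_prop
  have eq1 : ∫ s in (0 : ℝ)..1, f0 s * v s = -(∫ s in (0 : ℝ)..1, f1 s * v s) / (I2 * u) := by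
    rw [intervalIntegral.integral_mul_deriv_eq_deriv_mul (u := fun s : ℝ => f0 s)
      (u' := fun s : ℝ => f1 s) (v := fun s : ℝ => v s / (I2 * u)) (v' := fun s : ℝ => v s)
      (fun s _ => (d0 s).comp_ofReal) (fun s _ => (dv s).comp_ofReal)
      ((c1.comp Complex.continuous_ofReal).intervalIntegrable _ _)
      ((cv.comp Complex.continuous_ofReal).intervalIntegrable _ _)]
    simp only [hf0, ← mul_div_assoc, intervalIntegral.integral_div]
    simp [hπ, neg_div]
  have eq2 : ∫ s in (0 : ℝ)..1, f1 s * v s = -(∫ s in (0 : ℝ)..1, f2 s * v s) / (I2 * u) := by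
    rw [intervalIntegral.integral_mul_deriv_eq_deriv_mul (u := fun s : ℝ => f1 s)
      (u' := fun s : ℝ => f2 s) (v := fun s : ℝ => v s / (I2 * u)) (v' := fun s : ℝ => v s)
      (fun s _ => (d1 s).comp_ofReal) (fun s _ => (dv s).comp_ofReal)
      ((c2.comp Complex.continuous_ofReal).intervalIntegrable _ _)
      ((cv.comp Complex.continuous_ofReal).intervalIntegrable _ _)]
    simp only [hf1, ← mul_div_assoc, intervalIntegral.integral_div]
    simp [hπ, neg_div]
  have hE : extC (Icc 0 1) cutoff (u, b) = ∫ s in (0 : ℝ)..1, f0 s * v s := by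
    rw [extC, integral_Icc_eq_integral_Ioc, ← intervalIntegral.integral_of_le zero_le_one]
    refine intervalIntegral.integral_congr fun s _ => ?_
    simp only [cutoff, hf0, hv, e, mul_assoc, ← Complex.exp_add]
    congr 2
    simp only [hI2]
    push_cast; ring
  have hexp : ∀ x : ℝ, ‖Complex.exp (I2 * x)‖ = 1 := by
    intro x
    have := norm_e x
    rwa [e] at this
  have hb2 : ∀ s ∈ Ioc (0 : ℝ) 1, ‖f2 s * v s‖ ≤ 216 * (1 + |b|) ^ 2 := by
    intro s hs
    have hs1 : ‖(s : ℂ)‖ ≤ 1 := by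
      rw [Complex.norm_real, Real.norm_of_nonneg hs.1.le]; exact hs.2
    have hS : ‖Complex.sin (π' * s)‖ ≤ 1 := by
      rw [hπ, ← Complex.ofReal_mul]; exact norm_sin_ofReal_le _
    have hC : ‖Complex.cos (π' * s)‖ ≤ 1 := by
      rw [hπ, ← Complex.ofReal_mul]; exact norm_cos_ofReal_le _
    have n1 : ‖Complex.exp (I2 * b * (s : ℂ) ^ 2)‖ = 1 := by
      have := hexp (b * s ^ 2); push_cast at this; rwa [← mul_assoc] at this
    have n2 : ‖v s‖ = 1 := by
      have := hexp (u * s); push_cast at this; rwa [← mul_assoc] at this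
    have hπn : ‖π'‖ = Real.pi := by
      rw [hπ, Complex.norm_real, Real.norm_of_nonneg Real.pi_pos.le]
    have hbn : ‖(b : ℂ)‖ = |b| := by rw [Complex.norm_real, Real.norm_eq_abs]
    rw [norm_mul, n2, mul_one, hf2]
    simp only
    rw [norm_mul, n1, mul_one]
    have t1 : ‖2 * π' ^ 2 * (Complex.cos (π' * s) ^ 2 - Complex.sin (π' * s) ^ 2)‖ ≤
        2 * Real.pi ^ 2 * 2 := by
      rw [norm_mul, norm_mul, norm_pow, hπn, Complex.norm_ofNat]
      gcongr
      refine (norm_sub_le _ _).trans ?_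
      rw [norm_pow, norm_pow]
      have := pow_le_one₀ (n := 2) (norm_nonneg _) hS
      have := pow_le_one₀ (n := 2) (norm_nonneg _) hC
      linarith
    have t2 : ‖8 * π' * I2 * b * (s * (Complex.sin (π' * s) * Complex.cos (π' * s)))‖ ≤
        8 * Real.pi * (2 * Real.pi) * |b| * (1 * (1 * 1)) := by
      simp only [norm_mul, hπn, hbn, hI2n, Complex.norm_ofNat]
      gcongr
    have t3 : ‖2 * I2 * b * Complex.sin (π' * s) ^ 2‖ ≤ 2 * (2 * Real.pi) * |b| * 1 ^ 2 := by
      simp only [norm_mul, norm_pow, hbn, hI2n, Complex.norm_ofNat]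
      gcongr
    have t4 : ‖4 * I2 ^ 2 * b ^ 2 * ((s : ℂ) ^ 2 * Complex.sin (π' * s) ^ 2)‖ ≤
        4 * (2 * Real.pi) ^ 2 * |b| ^ 2 * (1 ^ 2 * 1 ^ 2) := by
      simp only [norm_mul, norm_pow, hbn, hI2n, Complex.norm_ofNat]
      gcongr
    refine (norm_add_le _ _).trans ((add_le_add_left ((norm_add_le _ _).trans
      (add_le_add_left (norm_add_le _ _) _)) _).trans ?_)
    -- the coefficients of `1`, `|b|`, `|b|²` are at most `4π²`, `16π² + 4π`, `16π²`
    have hpi : Real.pi ≤ 3.15 := Real.pi_lt_d2.le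
    have hpi0 := Real.pi_pos
    have hpi2 : Real.pi ^ 2 ≤ 10 := by nlinarith
    have hb := abs_nonneg b
    have hb1 : Real.pi ^ 2 * |b| ≤ 10 * |b| := by gcongr
    have hb2 : Real.pi ^ 2 * |b| ^ 2 ≤ 10 * |b| ^ 2 := by gcongr
    have hb3 : Real.pi * |b| ≤ 3.15 * |b| := by gcongr
    nlinarith [sq_nonneg |b|]
  rw [hE, eq1, eq2, neg_div, neg_div, norm_neg, neg_div, norm_neg, div_div, norm_div, norm_mul, norm_mul, hI2n,
    Complex.norm_real]
  have hint := intervalIntegral.norm_integral_le_of_norm_le_const (a := 0) (b := 1)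
    (f := fun s : ℝ => f2 s * v s) (C := 216 * (1 + |b|) ^ 2)
    (by rw [uIoc_of_le zero_le_one]; exact hb2)
  simp only [sub_zero, abs_one, mul_one] at hint
  have hu2 : 0 < u ^ 2 := by positivity
  have hden : (2 * Real.pi * ‖u‖) * (2 * Real.pi * ‖u‖) = 4 * Real.pi ^ 2 * u ^ 2 := by
    rw [Real.norm_eq_abs, ← sq_abs u]; ring
  rw [hden, div_le_div_iff₀ (by positivity) hu2]
  have h9 : 9 ≤ Real.pi ^ 2 := by nlinarith [Real.pi_gt_three]
  calc ‖∫ s in (0 : ℝ)..1, f2 s * v s‖ * u ^ 2 ≤ 216 * (1 + |b|) ^ 2 * u ^ 2 := by gcongr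
    _ = 6 * (1 + |b|) ^ 2 * (4 * 9 * u ^ 2) := by ring
    _ ≤ _ := by gcongr

/-- The kernel of the smooth cutoff is integrable in the first variable, with polynomial growth in
the second variable. -/
theorem lintegral_extC_cutoff_le (b : ℝ) :
    ∫⁻ u, ‖extC (Icc 0 1) cutoff (u, b)‖ₑ ≤ ENNReal.ofReal (48 * (1 + |b|) ^ 2) := by
  have h1 : ∀ u, ‖extC (Icc 0 1) cutoff (u, b)‖ₑ ≤
      ENNReal.ofReal (12 * (1 + |b|) ^ 2 * (1 + u ^ 2)⁻¹) := by
    intro u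
    rw [← ofReal_norm]
    refine ENNReal.ofReal_le_ofReal ?_
    rw [← div_eq_mul_inv, le_div_iff₀ (by positivity)]
    have hb := abs_nonneg b
    have hb1 : 1 ≤ (1 + |b|) ^ 2 := one_le_pow₀ (by linarith)
    have hn := norm_nonneg (extC (Icc 0 1) cutoff (u, b))
    by_cases hu : |u| ≤ 1
    · have : u ^ 2 ≤ 1 := by rw [← sq_abs]; exact pow_le_one₀ (abs_nonneg u) hu
      nlinarith [norm_extC_cutoff_le_one (u, b)]
    · push Not at hu
      have hu0 : u ≠ 0 := by rintro rfl; simp at hu; linarith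
      have hu2 : 1 ≤ u ^ 2 := by rw [← sq_abs]; exact one_le_pow₀ hu.le
      have := norm_extC_cutoff_le (b := b) hu0
      rw [le_div_iff₀ (by positivity)] at this
      nlinarith
  refine (lintegral_mono h1).trans ?_
  have hi : Integrable fun u : ℝ => 12 * (1 + |b|) ^ 2 * (1 + u ^ 2)⁻¹ :=
    integrable_inv_one_add_sq.const_mul _
  rw [← ofReal_integral_eq_lintegral_ofReal hi
    (Filter.Eventually.of_forall fun t => by simp only [Pi.zero_apply]; positivity),
    integral_const_mul, integral_univ_inv_one_add_sq]
  refine ENNReal.ofReal_le_ofReal ?_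
  have : 0 ≤ (1 + |b|) ^ 2 := by positivity
  nlinarith [Real.pi_le_four]

/-! ### Convolution with the kernel of the cutoff -/

/-- The reciprocal `1 + |t| / R` of the profile `decay 1 R`. -/
noncomputable def growth (R t : ℝ) : ℝ≥0∞ := ENNReal.ofReal (1 + |t| / R)

theorem measurable_growth (R : ℝ) : Measurable (growth R) := by
  unfold growth; fun_prop

/-- Submultiplicativity lets polynomial growth in `s - t` be absorbed by decay in `t`. -/
theorem growth_sub_le {R : ℝ} (hR : 0 < R) (s t : ℝ) :
    growth R (s - t) ≤ growth R s * growth R t := by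
  rw [growth, growth, growth, ← ENNReal.ofReal_mul (by positivity)]
  refine ENNReal.ofReal_le_ofReal ?_
  have h : |s - t| / R ≤ |s| / R + |t| / R := by
    rw [← add_div]; gcongr; exact abs_sub _ _
  have := mul_nonneg (show 0 ≤ |s| / R by positivity) (show 0 ≤ |t| / R by positivity)
  nlinarith

theorem growth_pow_mul_decay {R : ℝ} (hR : 0 < R) (j k : ℕ) (t : ℝ) :
    growth R t ^ j * decay (k + j) R t = decay k R t := by
  have : 0 < 1 + |t| / R := by positivity
  rw [growth, decay, decay, ← ENNReal.ofReal_pow (by positivity),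
    ← ENNReal.ofReal_mul (by positivity)]
  congr 1
  field_simp
  ring

theorem lintegral_growth_mul_decay_le {R : ℝ} (hR : 0 < R) {k : ℕ} (hk : 2 ≤ k) (s : ℝ) :
    ∫⁻ t, growth R (s - t) ^ 2 * decay (k + 2) R t ≤ growth R s ^ 2 * ENNReal.ofReal (4 * R) := by
  calc ∫⁻ t, growth R (s - t) ^ 2 * decay (k + 2) R t
      ≤ ∫⁻ t, growth R s ^ 2 * decay k R t := by
        refine lintegral_mono fun t => ?_
        rw [← growth_pow_mul_decay hR 2 k t, ← mul_assoc, ← mul_pow]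
        gcongr
        exact growth_sub_le hR s t
    _ ≤ _ := by
        rw [lintegral_const_mul _ (measurable_decay k R)]
        gcongr
        exact lintegral_decay_le hk hR

theorem growth_neg (R t : ℝ) : growth R (-t) = growth R t := by rw [growth, abs_neg, growth]

/-- The constant of `lintegral_convolution_pow_six_le`. -/
noncomputable def convC : ℝ≥0∞ := (192 * 10 ^ 600) ^ 6

/-- A weighted `L⁶` bound for convolution operators whose kernel is integrable in the first
variable, acting on functions which are localised by a rapidly decreasing factor. -/
theorem lintegral_convolution_pow_six_le {R : ℝ} (hR : 0 < R) {k a ψ : ℝ × ℝ → ℝ≥0∞}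
    (hk : Measurable k) (ha : Measurable a) (hψ : Measurable ψ)
    (hkint : ∀ y, ∫⁻ x, k (x, y) ≤ 48 * growth R y ^ 2)
    (hψle : ∀ z, ψ z ≤ 10 ^ 600 * (decay 120 R z.1 * decay 120 R z.2)) :
    ∫⁻ p, (∫⁻ z, a z * (ψ z * k (p - z))) ^ 6 * decay 100 R p.2 ≤
      convC * ENNReal.ofReal R ^ 6 * ∫⁻ z, a z ^ 6 * (decay 118 R z.1 * decay 118 R z.2) := by
  have hd := measurable_decay
  have hg := measurable_growth R
  have hkx : ∀ x y, ∫⁻ t, k (x - t, y) ≤ 48 * growth R y ^ 2 := fun x y => by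
    rw [lintegral_sub_left_eq_self (fun t => k (t, y)) x]; exact hkint y
  have hkx' : ∀ x y, ∫⁻ t, k (t - x, y) ≤ 48 * growth R y ^ 2 := fun x y => by
    rw [lintegral_sub_right_eq_self (fun t => k (t, y)) x]; exact hkint y
  have e4 : ENNReal.ofReal (4 * R) = 4 * ENNReal.ofReal R := by
    rw [ENNReal.ofReal_mul (by norm_num)]; norm_num
  -- the total mass of `ψ` times the kernel, used as a weight in Hölder's inequality below; its fifth
  -- power contains `growth ^ 10`, which lowers the exponent `100` to `90`
  have hA : ∀ p, ∫⁻ z, ψ z * k (p - z) ≤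
      (192 * 10 ^ 600) * ENNReal.ofReal R * growth R p.2 ^ 2 := by
    intro p
    calc ∫⁻ z, ψ z * k (p - z)
        ≤ ∫⁻ z : ℝ × ℝ, 10 ^ 600 * decay 120 R z.2 * k (p - z) := by
          refine lintegral_mono fun z => mul_le_mul_left ((hψle z).trans ?_) _
          gcongr
          exact mul_le_of_le_one_left' (decay_le_one hR _)
      _ = ∫⁻ t, 10 ^ 600 * decay 120 R t * ∫⁻ s, k (p.1 - s, p.2 - t) := by
          rw [Measure.volume_eq_prod, lintegral_prod_symm' _ (by fun_prop)]
          refine lintegral_congr fun t => ?_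
          rw [← lintegral_const_mul _ (by fun_prop)]
          rfl
      _ ≤ ∫⁻ t, 10 ^ 600 * decay 120 R t * (48 * growth R (p.2 - t) ^ 2) :=
          lintegral_mono fun t => mul_le_mul_right (hkx _ _) _
      _ = (48 * 10 ^ 600) * ∫⁻ t, growth R (p.2 - t) ^ 2 * decay (118 + 2) R t := by
          rw [← lintegral_const_mul _ (by fun_prop)]
          exact lintegral_congr fun t => by ring
      _ ≤ (48 * 10 ^ 600) * (growth R p.2 ^ 2 * ENNReal.ofReal (4 * R)) :=
          mul_le_mul_right (lintegral_growth_mul_decay_le hR (by norm_num) _) _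
      _ = _ := by rw [e4]; ring
  set K : ℝ≥0∞ := ((192 * 10 ^ 600) * ENNReal.ofReal R) ^ 5 with hK
  -- the remaining exponent `90` makes the kernel integrable from the other side
  have hB : ∀ z : ℝ × ℝ, ∫⁻ p : ℝ × ℝ, decay 90 R p.2 * k (p - z) ≤
      192 * ENNReal.ofReal R * growth R z.2 ^ 2 := by
    intro z
    calc ∫⁻ p : ℝ × ℝ, decay 90 R p.2 * k (p - z)
        = ∫⁻ t, decay 90 R t * ∫⁻ s, k (s - z.1, t - z.2) := by
          rw [Measure.volume_eq_prod, lintegral_prod_symm' _ (by fun_prop)]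
          refine lintegral_congr fun t => ?_
          rw [← lintegral_const_mul _ (by fun_prop)]
          rfl
      _ ≤ ∫⁻ t, decay 90 R t * (48 * growth R (t - z.2) ^ 2) :=
          lintegral_mono fun t => mul_le_mul_right (hkx' _ _) _
      _ = 48 * ∫⁻ t, growth R (z.2 - t) ^ 2 * decay (88 + 2) R t := by
          rw [← lintegral_const_mul _ (by fun_prop)]
          refine lintegral_congr fun t => ?_
          rw [← growth_neg, neg_sub]
          ring
      _ ≤ 48 * (growth R z.2 ^ 2 * ENNReal.ofReal (4 * R)) :=
          mul_le_mul_right (lintegral_growth_mul_decay_le hR (by norm_num) _) _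
      _ = _ := by rw [e4]; ring
  calc ∫⁻ p, (∫⁻ z, a z * (ψ z * k (p - z))) ^ 6 * decay 100 R p.2
      ≤ ∫⁻ p : ℝ × ℝ, ∫⁻ z, K * (decay 90 R p.2 * (a z ^ 6 * (ψ z * k (p - z)))) := by
        refine lintegral_mono fun p => ?_
        calc (∫⁻ z, a z * (ψ z * k (p - z))) ^ 6 * decay 100 R p.2
            ≤ ((∫⁻ z, ψ z * k (p - z)) ^ 5 * ∫⁻ z, a z ^ 6 * (ψ z * k (p - z))) *
                decay 100 R p.2 := by
              gcongr
              exact lintegral_mul_pow_six_le _ (by fun_prop) (by fun_prop)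
          _ ≤ (((192 * 10 ^ 600) * ENNReal.ofReal R * growth R p.2 ^ 2) ^ 5 *
                ∫⁻ z, a z ^ 6 * (ψ z * k (p - z))) * decay (90 + 10) R p.2 := by
              gcongr
              exact hA p
          _ = K * (growth R p.2 ^ 10 * decay (90 + 10) R p.2) *
                ∫⁻ z, a z ^ 6 * (ψ z * k (p - z)) := by rw [hK]; ring
          _ = _ := by
              rw [growth_pow_mul_decay hR, ← lintegral_const_mul _ (by fun_prop)]
              exact lintegral_congr fun z => by ring
    _ = ∫⁻ z, ∫⁻ p : ℝ × ℝ, K * (decay 90 R p.2 * (a z ^ 6 * (ψ z * k (p - z)))) :=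
        lintegral_lintegral_swap (by fun_prop)
    _ = ∫⁻ z, K * (a z ^ 6 * ψ z) * ∫⁻ p : ℝ × ℝ, decay 90 R p.2 * k (p - z) := by
        refine lintegral_congr fun z => ?_
        rw [← lintegral_const_mul _ (by fun_prop)]
        exact lintegral_congr fun p => by ring
    _ ≤ ∫⁻ z, convC * ENNReal.ofReal R ^ 6 * (a z ^ 6 * (decay 118 R z.1 * decay 118 R z.2)) := by
        refine lintegral_mono fun z => ?_
        calc K * (a z ^ 6 * ψ z) * ∫⁻ p : ℝ × ℝ, decay 90 R p.2 * k (p - z)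
            ≤ K * (a z ^ 6 * (10 ^ 600 * (decay 120 R z.1 * decay (118 + 2) R z.2))) *
                (192 * ENNReal.ofReal R * growth R z.2 ^ 2) := by
              gcongr
              · exact hψle z
              · exact hB z
          _ = convC * ENNReal.ofReal R ^ 6 * (a z ^ 6 * (decay 120 R z.1 *
                (growth R z.2 ^ 2 * decay (118 + 2) R z.2))) := by rw [hK, convC]; ring
          _ ≤ _ := by
              rw [growth_pow_mul_decay hR]
              gcongr
              refine ENNReal.ofReal_le_ofReal (inv_anti₀ (by positivity) ?_)
              have : 0 ≤ |z.1| / R := by positivity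
              exact pow_le_pow_right₀ (by linarith) (by norm_num)
    _ = _ := lintegral_const_mul _ (by fun_prop)

/-- The rescaled cutoff on the interval `[A, A + δ]`. -/
noncomputable def cutoffAt (A δ ξ : ℝ) : ℂ := cutoff ((ξ - A) / δ)

theorem continuous_cutoffAt (A δ : ℝ) : Continuous (cutoffAt A δ) :=
  continuous_cutoff.comp (by fun_prop)

theorem norm_cutoffAt_le (A δ ξ : ℝ) : ‖cutoffAt A δ ξ‖ ≤ 1 := norm_cutoff_le _

/-- The kernel of the cutoff at scale `1 / n` is integrable in the first variable, uniformly in `n`,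
and grows polynomially in the second variable only at the scale `n²`. -/
theorem lintegral_extC_cutoffAt_le (A : ℝ) {n : ℕ} (hn : 0 < n) (y : ℝ) :
    ∫⁻ x, ‖extC (Icc A (A + (n : ℝ)⁻¹)) (cutoffAt A (n : ℝ)⁻¹) (x, y)‖ₑ ≤
      48 * growth ((n : ℝ) ^ 2) y ^ 2 := by
  have hδ : (0 : ℝ) < (n : ℝ)⁻¹ := by positivity
  set δ : ℝ := (n : ℝ)⁻¹ with hδd
  have h1 : ∀ x, ‖extC (Icc A (A + δ)) (cutoffAt A δ) (x, y)‖ₑ =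
      ENNReal.ofReal δ * ‖extC (Icc 0 1) cutoff (δ * (x + 2 * A * y), δ ^ 2 * y)‖ₑ := by
    intro x
    have := enorm_extC_affine A δ zero_le_one hδ (cutoffAt A δ) (x, y)
    have e2 : (fun s => cutoffAt A δ (A + δ * s)) = cutoff := by
      funext s
      rw [cutoffAt]
      congr 1
      field_simp
      ring
    rw [e2, mul_zero, add_zero, mul_one] at this
    exact this
  simp_rw [h1]
  have hm : Measurable fun u => ‖extC (Icc 0 1) cutoff (u, δ ^ 2 * y)‖ₑ := by
    have := (continuous_extC (J := Icc 0 1) continuous_cutoff.integrableOn_Icc).measurable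
    fun_prop
  rw [lintegral_const_mul' _ _ ENNReal.ofReal_ne_top,
    lintegral_comp_mul_add hδ (2 * A * y) hm, ← mul_assoc, ← ENNReal.ofReal_mul hδ.le,
    mul_inv_cancel₀ hδ.ne', ENNReal.ofReal_one, one_mul]
  refine (lintegral_extC_cutoff_le _).trans (le_of_eq ?_)
  rw [ENNReal.ofReal_mul (by norm_num), growth, ENNReal.ofReal_pow (by positivity), abs_mul,
    abs_of_pos (by positivity : 0 < δ ^ 2), hδd, inv_pow, ← div_eq_inv_mul]
  norm_num

/-! ### Localisation at the scale of a square -/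

/-- `spec` rescaled to frequencies of size `1 / R`. -/
noncomputable def specAt (R w : ℝ) : ℂ := R * spec (R * w)

theorem continuous_specAt (R : ℝ) : Continuous (specAt R) :=
  continuous_const.mul (continuous_spec.comp (by fun_prop))

theorem specAt_eq_zero {R w : ℝ} (hR : 0 < R) (hw : 1 / (4 * R) < |w|) : specAt R w = 0 := by
  rw [specAt, spec_eq_zero, mul_zero]
  rw [abs_mul, abs_of_pos hR]
  rw [div_lt_iff₀ (by positivity)] at hw
  linarith

theorem exists_norm_specAt_le (R : ℝ) : ∃ B, 0 ≤ B ∧ ∀ w, ‖specAt R w‖ ≤ B := by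
  refine ⟨|R| * ∫ t, bump t, mul_nonneg (abs_nonneg R) (integral_nonneg bump_nonneg), fun w => ?_⟩
  rw [specAt, norm_mul, Complex.norm_real, Real.norm_eq_abs, ← integral_bump_mul_e]
  gcongr
  refine (norm_integral_le_integral_norm _).trans (le_of_eq ?_)
  refine integral_congr_ae (Filter.Eventually.of_forall fun t => ?_)
  simp only [norm_mul, norm_e, mul_one, Complex.norm_real, Real.norm_of_nonneg (bump_nonneg t)]

/-- Fourier inversion for `specAt` and the rescaled bump. -/
theorem integral_specAt_mul_e {R : ℝ} (hR : 0 < R) (t : ℝ) :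
    ∫ w, specAt R w * e (w * t) = bump (t / R) := by
  rw [← integral_spec_mul_e]
  have h := Measure.integral_comp_mul_left (fun w => spec w * e (w * (t / R))) R
  rw [abs_of_pos (by positivity)] at h
  have h2 : ∀ w, specAt R w * e (w * t) = R * (spec (R * w) * e (R * w * (t / R))) := by
    intro w
    have : w * t = R * w * (t / R) := by field_simp
    rw [specAt, mul_assoc, this]
  simp_rw [h2]
  rw [integral_const_mul, h, Complex.real_smul, ← mul_assoc, ← Complex.ofReal_mul,
    mul_inv_cancel₀ hR.ne', Complex.ofReal_one, one_mul]

theorem integral_bump_div_mul_e {R : ℝ} (hR : 0 < R) (w : ℝ) :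
    ∫ t, (bump (t / R) : ℂ) * e (-(w * t)) = specAt R w := by
  rw [specAt, ← integral_bump_mul_e]
  have h := Measure.integral_comp_mul_left (fun t => (bump t : ℂ) * e (-(R * w * t))) R⁻¹
  rw [inv_inv, abs_of_pos hR, Complex.real_smul] at h
  rw [← h]
  refine integral_congr_ae (Filter.Eventually.of_forall fun t => ?_)
  have h1 : R * w * (R⁻¹ * t) = w * t := by field_simp
  simp only [h1, div_eq_inv_mul]

theorem integrable_bump_div {R : ℝ} (hR : 0 < R) : Integrable fun t => bump (t / R) :=
  integrable_bump.comp_div hR.ne'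

/-- The localisation `bump (p₁ / R) bump (p₂ / R)` to the square of side length `R`. -/
noncomputable def bump2 (R : ℝ) (p : ℝ × ℝ) : ℝ := bump (p.1 / R) * bump (p.2 / R)

theorem continuous_bump2 (R : ℝ) : Continuous (bump2 R) := by
  have := continuous_bump
  unfold bump2
  fun_prop

theorem bump2_nonneg (R : ℝ) (p : ℝ × ℝ) : 0 ≤ bump2 R p :=
  mul_nonneg (bump_nonneg _) (bump_nonneg _)

theorem integrable_bump2 {R : ℝ} (hR : 0 < R) : Integrable (bump2 R) :=
  (integrable_bump_div hR).mul_prod (integrable_bump_div hR)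

theorem box2_le_bump2 {R : ℝ} (hR : 0 < R) (p : ℝ × ℝ) : box2 R p ≤ ENNReal.ofReal (bump2 R p) := by
  have hdiv : ∀ t : ℝ, |t| ≤ R / 2 → 1 ≤ bump (t / R) := by
    intro t ht
    refine one_le_bump ?_
    rw [abs_div, abs_of_pos hR, div_le_iff₀ hR]
    linarith
  by_cases hp : p ∈ {p : ℝ × ℝ | |p.1| ≤ R / 2 ∧ |p.2| ≤ R / 2}
  · rw [box2, indicator_of_mem hp, ← ENNReal.ofReal_one]
    exact ENNReal.ofReal_le_ofReal (one_le_mul_of_one_le_of_one_le (hdiv _ hp.1) (hdiv _ hp.2))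
  · rw [box2, indicator_of_notMem hp]
    exact zero_le

theorem bump2_le {R : ℝ} (hR : 0 < R) (p : ℝ × ℝ) :
    ENNReal.ofReal (bump2 R p) ≤ 10 ^ 600 * (decay 120 R p.1 * decay 120 R p.2) := by
  have h1 : ∀ t, ENNReal.ofReal (bump (t / R)) ≤ 10 ^ 300 * decay 120 R t := by
    intro t
    refine (ENNReal.ofReal_le_ofReal (bump_le _)).trans (le_of_eq ?_)
    rw [ENNReal.ofReal_mul (by unfold bumpC; positivity), bumpC, decay, abs_div, abs_of_pos hR,
      ENNReal.ofReal_pow (by norm_num), ENNReal.ofReal_ofNat]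
  rw [bump2, ENNReal.ofReal_mul (bump_nonneg _)]
  refine (mul_le_mul' (h1 _) (h1 _)).trans (le_of_eq ?_)
  rw [mul_mul_mul_comm, ← pow_add]

/-- The Fourier transform of `bump2 R`, supported in the square of side length `1 / (2 R)`. -/
theorem integral_bump2_mul_e {R : ℝ} (hR : 0 < R) (w₁ w₂ : ℝ) :
    ∫ p, (bump2 R p : ℂ) * e (-(w₁ * p.1 + w₂ * p.2)) = specAt R w₁ * specAt R w₂ := by
  rw [← integral_bump_div_mul_e hR, ← integral_bump_div_mul_e hR, ← integral_prod_mul,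
    Measure.volume_eq_prod]
  refine integral_congr_ae (Filter.Eventually.of_forall fun p => ?_)
  simp only [bump2, neg_add, e_add]
  push_cast
  ring

/-- Fubini for a bounded kernel and two integrable densities. -/
theorem integral_mul_integral_swap {α β : Type*} [MeasurableSpace α] [MeasurableSpace β]
    {μ : Measure α} {ν : Measure β} [SFinite μ] [SFinite ν] {f : α → ℂ} {g : β → ℂ}
    {K : α → β → ℂ} {C : ℝ} (hf : Integrable f μ) (hg : Integrable g ν)
    (hK : AEStronglyMeasurable (Function.uncurry K) (μ.prod ν)) (hC : ∀ x y, ‖K x y‖ ≤ C) :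
    ∫ x, f x * ∫ y, g y * K x y ∂ν ∂μ = ∫ y, g y * ∫ x, f x * K x y ∂μ ∂ν := by
  have h1 : ∀ x, f x * ∫ y, g y * K x y ∂ν = ∫ y, f x * g y * K x y ∂ν := fun x => by
    rw [← integral_const_mul]; simp only [mul_assoc]
  have h2 : ∀ y, g y * ∫ x, f x * K x y ∂μ = ∫ x, f x * g y * K x y ∂μ := fun y => by
    rw [← integral_const_mul]
    exact integral_congr_ae (Filter.Eventually.of_forall fun x => by ring)
  simp_rw [h1, h2]
  refine integral_integral_swap ?_
  exact (hf.mul_prod hg).mul_bdd (c := C) hK (Filter.Eventually.of_forall fun q => hC q.1 q.2)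

/-- The Fourier transform of `bump2 R * extC J g` at the point `(ξ, ξ² + τ)`, as a function of
`q = (τ, ξ)`. -/
noncomputable def slice (R : ℝ) (J : Set ℝ) (g : ℝ → ℂ) (q : ℝ × ℝ) : ℂ :=
  ∫ η in J, g η * (specAt R (q.2 - η) * specAt R (q.1 + q.2 ^ 2 - η ^ 2))

theorem continuous_slice (R : ℝ) {J : Set ℝ} {g : ℝ → ℂ} (hg : IntegrableOn g J) :
    Continuous (slice R J g) := by
  obtain ⟨B, hB0, hB⟩ := exists_norm_specAt_le R
  have hc := continuous_specAt R
  refine continuous_of_dominated (bound := fun η => ‖g η‖ * (B * B)) ?_ ?_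
    (hg.norm.mul_const _) ?_
  · intro q
    refine hg.aestronglyMeasurable.mul (Continuous.aestronglyMeasurable ?_)
    fun_prop
  · refine fun q => Filter.Eventually.of_forall fun η => ?_
    rw [norm_mul, norm_mul]
    gcongr
    · exact hB _
    · exact hB _
  · refine Filter.Eventually.of_forall fun η => ?_
    fun_prop

/-- The localisation changes frequencies by at most `1 / (4 R)` in each coordinate. -/
theorem slice_eq_zero {R : ℝ} (hR : 0 < R) {J : Set ℝ} (hJ : MeasurableSet J) (g : ℝ → ℂ)
    {q : ℝ × ℝ} (hq : ∀ η ∈ J, 1 / (4 * R) < |q.2 - η|) : slice R J g q = 0 := by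
  rw [slice, setIntegral_congr_fun hJ (g := fun _ => (0 : ℂ))]
  · simp
  · intro η hη
    simp only
    rw [specAt_eq_zero hR (hq η hη), zero_mul, mul_zero]

theorem integrable_bump2_mul_extC {R : ℝ} (hR : 0 < R) {J : Set ℝ} {g : ℝ → ℂ}
    (hg : IntegrableOn g J) : Integrable fun z => (bump2 R z : ℂ) * extC J g z :=
  (integrable_bump2 hR).ofReal.mul_bdd (c := ∫ ξ in J, ‖g ξ‖)
    (continuous_extC hg).aestronglyMeasurable
    (Filter.Eventually.of_forall fun z => norm_extC_le J g z)

/-- `slice` is the Fourier transform of the localised function along a translated parabola. -/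
theorem slice_eq_integral {R : ℝ} (hR : 0 < R) {J : Set ℝ} {g : ℝ → ℂ} (hg : IntegrableOn g J)
    (q : ℝ × ℝ) : slice R J g q =
      ∫ z : ℝ × ℝ, (bump2 R z : ℂ) * extC J g z * e (-(q.2 * z.1 + (q.2 ^ 2 + q.1) * z.2)) := by
  have h1 : ∀ z : ℝ × ℝ,
      (bump2 R z : ℂ) * extC J g z * e (-(q.2 * z.1 + (q.2 ^ 2 + q.1) * z.2)) =
      (bump2 R z : ℂ) * ∫ η in J, g η *
        e (-((q.2 - η) * z.1 + (q.1 + q.2 ^ 2 - η ^ 2) * z.2)) := by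
    intro z
    rw [mul_assoc, extC, ← integral_mul_const]
    congr 2
    funext η
    rw [mul_assoc, ← e_add]
    congr 2
    ring
  simp_rw [h1]
  have hc := continuous_e
  rw [integral_mul_integral_swap (C := 1) (f := fun z => (bump2 R z : ℂ))
    (K := fun (z : ℝ × ℝ) (η : ℝ) => e (-((q.2 - η) * z.1 + (q.1 + q.2 ^ 2 - η ^ 2) * z.2)))
    (integrable_bump2 hR).ofReal hg (Continuous.aestronglyMeasurable (by simp only [Function.uncurry_def]; fun_prop))
    (fun z η => (norm_e _).le), slice]
  congr 1
  funext η
  rw [integral_bump2_mul_e hR]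

/-- The localised function `bump2 R * extC J g` is recovered from its Fourier transform, which is
supported near the parabola. -/
theorem bump2_mul_extC {R : ℝ} (hR : 1 ≤ R) {J : Set ℝ} (hJm : MeasurableSet J)
    (hJ : J ⊆ Icc 0 1) {g : ℝ → ℂ} (hg : IntegrableOn g J) (p : ℝ × ℝ) :
    (bump2 R p : ℂ) * extC J g p = ∫ q in Icc (-(1 / R)) (1 / R) ×ˢ Icc (-1 : ℝ) 2,
      slice R J g q * e (q.2 * p.1 + (q.2 ^ 2 + q.1) * p.2) := by
  have hR0 : 0 < R := by linarith
  obtain ⟨B, hB0, hB⟩ := exists_norm_specAt_le R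
  have hc := continuous_specAt R
  have hce := continuous_e
  set S : Set (ℝ × ℝ) := Icc (-(1 / R)) (1 / R) ×ˢ Icc (-1 : ℝ) 2 with hS
  have hSm : MeasurableSet S := measurableSet_Icc.prod measurableSet_Icc
  have hSc : IsCompact S := isCompact_Icc.prod isCompact_Icc
  set K : ℝ × ℝ → ℝ → ℂ := fun q η => specAt R (q.2 - η) * specAt R (q.1 + q.2 ^ 2 - η ^ 2) *
    e (q.2 * p.1 + (q.2 ^ 2 + q.1) * p.2) with hK
  have hKc : Continuous (Function.uncurry K) := by
    simp only [hK, Function.uncurry_def]; fun_prop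
  -- `q.1 = (q.1 + q.2² - η²) - (q.2 - η) (q.2 + η)` is at most `1 / (4R) + 3 / (4R)` on the support
  have hzero : ∀ η ∈ J, ∀ q ∉ S, K q η = 0 := by
    intro η hη q hq
    have h01 := hJ hη
    by_cases h1 : 1 / (4 * R) < |q.2 - η|
    · simp only [hK]; rw [specAt_eq_zero hR0 h1]; ring
    by_cases h2 : 1 / (4 * R) < |q.1 + q.2 ^ 2 - η ^ 2|
    · simp only [hK]; rw [specAt_eq_zero hR0 h2]; ring
    exfalso
    push Not at h1 h2
    apply hq
    have e4 : 1 / (4 * R) = 1 / R / 4 := by field_simp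
    rw [e4] at h1 h2
    set r := 1 / R with hr
    have hr1 : r ≤ 1 := by rw [hr, div_le_one hR0]; exact hR
    have hr0 : 0 < r := by positivity
    have h1' := abs_le.1 h1
    have h2' := abs_le.1 h2
    have hsum : |q.2 + η| ≤ 3 := abs_le.2 ⟨by linarith [h01.1], by linarith [h01.2]⟩
    have hprod : |(q.2 - η) * (q.2 + η)| ≤ r / 4 * 3 := by
      rw [abs_mul]; gcongr
    have h3 := abs_le.1 hprod
    have h4 : q.1 = (q.1 + q.2 ^ 2 - η ^ 2) - (q.2 - η) * (q.2 + η) := by ring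
    refine ⟨⟨by linarith, by linarith⟩, ⟨by linarith [h01.1], by linarith [h01.2]⟩⟩
  have hinner : ∀ η ∈ J, ∫ q in S, K q η = e (η * p.1 + η ^ 2 * p.2) * bump2 R p := by
    intro η hη
    have hKη : Continuous fun q => K q η := by simp only [hK]; fun_prop
    rw [setIntegral_eq_integral_of_forall_compl_eq_zero (hzero η hη)]
    have hi : Integrable fun q => K q η := by
      rw [← integrableOn_iff_integrable_of_support_subset (s := S)]
      · exact hKη.continuousOn.integrableOn_compact hSc
      · intro q hq
        by_contra h
        exact hq (hzero η hη q h)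
    rw [Measure.volume_eq_prod] at hi ⊢
    rw [integral_prod_symm _ hi]
    -- after the shift `τ ↦ τ + η² - ξ²` the two variables separate
    have hτ : ∀ ξ : ℝ, ∫ τ, K (τ, ξ) η =
        specAt R (ξ - η) * e ((ξ - η) * p.1) * (e (η * p.1 + η ^ 2 * p.2) * bump (p.2 / R)) := by
      intro ξ
      rw [← integral_specAt_mul_e hR0, ← integral_const_mul, ← integral_const_mul,
        ← integral_add_right_eq_self _ (η ^ 2 - ξ ^ 2)]
      congr 1
      funext τ
      simp only [hK]
      rw [show τ + (η ^ 2 - ξ ^ 2) + ξ ^ 2 - η ^ 2 = τ by ring,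
        show ξ * p.1 + (ξ ^ 2 + (τ + (η ^ 2 - ξ ^ 2))) * p.2 = (ξ - η) * p.1 +
          ((η * p.1 + η ^ 2 * p.2) + τ * p.2) by ring, e_add, e_add]
      ring
    simp_rw [hτ]
    rw [integral_mul_const, integral_sub_right_eq_self (fun ξ => specAt R ξ * e (ξ * p.1)) η,
      integral_specAt_mul_e hR0, bump2]
    push_cast
    ring
  have h1 : ∀ q : ℝ × ℝ, slice R J g q * e (q.2 * p.1 + (q.2 ^ 2 + q.1) * p.2) =
      1 * ∫ η in J, g η * K q η := by
    intro q
    rw [slice, ← integral_mul_const, one_mul]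
    congr 1
    funext η
    simp only [hK]
    ring
  simp_rw [h1]
  rw [integral_mul_integral_swap (C := B * B) (f := fun _ => (1 : ℂ)) _ hg
    hKc.aestronglyMeasurable]
  · rw [extC, ← integral_const_mul]
    refine setIntegral_congr_fun hJm fun η hη => ?_
    simp only [one_mul]
    rw [hinner η hη]
    ring
  · intro q η
    simp only [hK]
    rw [norm_mul, norm_e, mul_one, norm_mul]
    exact mul_le_mul (hB _) (hB _) (norm_nonneg _) hB0
  · exact integrableOn_const hSc.measure_lt_top.ne

/-- Cutting off the Fourier transform of `bump2 R * extC J g` amounts to a convolution with the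
kernel of the cutoff. -/
theorem extC_cutoffAt_mul_slice {R : ℝ} (hR : 0 < R) {J : Set ℝ} {g : ℝ → ℂ}
    (hg : IntegrableOn g J) (A δ τ : ℝ) (p : ℝ × ℝ) :
    extC (Icc A (A + δ)) (fun ξ => cutoffAt A δ ξ * slice R J g (τ, ξ)) p =
      ∫ z : ℝ × ℝ, (bump2 R z : ℂ) * extC J g z *
        (e (-(τ * z.2)) * extC (Icc A (A + δ)) (cutoffAt A δ) (p - z)) := by
  have hce := continuous_e
  have hcut : IntegrableOn (cutoffAt A δ) (Icc A (A + δ)) :=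
    (continuous_cutoffAt A δ).integrableOn_Icc
  set K : ℝ → ℝ × ℝ → ℂ := fun ξ z =>
    e (-(τ * z.2)) * e (ξ * (p - z).1 + ξ ^ 2 * (p - z).2) with hK
  have h1 : ∀ ξ, cutoffAt A δ ξ * slice R J g (τ, ξ) * e (ξ * p.1 + ξ ^ 2 * p.2) =
      cutoffAt A δ ξ * ∫ z, (bump2 R z : ℂ) * extC J g z * K ξ z := by
    intro ξ
    rw [slice_eq_integral hR hg, mul_assoc, ← integral_mul_const]
    congr 2
    funext z
    simp only [hK]
    rw [mul_assoc, ← e_add, ← e_add]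
    congr 2
    simp only [Prod.fst_sub, Prod.snd_sub]
    ring
  rw [extC]
  simp_rw [h1]
  rw [integral_mul_integral_swap (C := 1) hcut (integrable_bump2_mul_extC hR hg)
    (Continuous.aestronglyMeasurable (by simp only [hK, Function.uncurry_def]; fun_prop))
    (fun ξ z => by simp [hK, norm_e])]
  congr 1
  funext z
  congr 1
  have h2 : extC (Icc A (A + δ)) (cutoffAt A δ) (p - z) =
    ∫ ξ in Icc A (A + δ), cutoffAt A δ ξ * e (ξ * (p - z).1 + ξ ^ 2 * (p - z).2) := rfl
  rw [h2, ← integral_const_mul]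
  congr 1
  funext ξ
  simp only [hK]
  ring

/-- A cut-off slice is controlled by `E_J g` itself, with weights of exponent `118`: the convolution
with the kernel costs at most two powers of the decay `120` of `bump2`. -/
theorem intSix_extC_cutoffAt_mul_slice_le {n : ℕ} (hn : 0 < n) {J : Set ℝ} {g : ℝ → ℂ}
    (hg : IntegrableOn g J) (A τ : ℝ) :
    intSix (fun p => decay 100 ((n : ℝ) ^ 2) p.2) (extC (Icc A (A + (n : ℝ)⁻¹))
        (fun ξ => cutoffAt A (n : ℝ)⁻¹ ξ * slice ((n : ℝ) ^ 2) J g (τ, ξ))) ≤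
      convC * ENNReal.ofReal ((n : ℝ) ^ 2) ^ 6 *
        intSix (fun z => decay 118 ((n : ℝ) ^ 2) z.1 * decay 118 ((n : ℝ) ^ 2) z.2) (extC J g) := by
  have hn' : (0 : ℝ) < n := by exact_mod_cast hn
  set R : ℝ := (n : ℝ) ^ 2 with hRd
  have hR : 0 < R := by positivity
  set δ : ℝ := (n : ℝ)⁻¹
  have hcut : IntegrableOn (cutoffAt A δ) (Icc A (A + δ)) :=
    (continuous_cutoffAt A δ).integrableOn_Icc
  refine le_trans (lintegral_mono fun p => ?_)
    (lintegral_convolution_pow_six_le hR (a := fun z => ‖extC J g z‖ₑ)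
      (ψ := fun z => ENNReal.ofReal (bump2 R z))
      (k := fun z => ‖extC (Icc A (A + δ)) (cutoffAt A δ) z‖ₑ)
      (continuous_extC hcut).measurable.enorm (continuous_extC hg).measurable.enorm
      (continuous_bump2 R).measurable.ennreal_ofReal
      (fun y => lintegral_extC_cutoffAt_le A hn y) (fun z => bump2_le hR z))
  gcongr
  rw [extC_cutoffAt_mul_slice hR hg]
  refine (enorm_integral_le_lintegral_enorm _).trans (lintegral_mono fun z => ?_)
  have h1 : ‖e (-(τ * z.2))‖ₑ = 1 := by rw [← ofReal_norm, norm_e]; simp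
  have h2 : ‖(bump2 R z : ℂ)‖ₑ = ENNReal.ofReal (bump2 R z) := by
    rw [← ofReal_norm, Complex.norm_real, Real.norm_of_nonneg (bump2_nonneg R z)]
  simp only [enorm_mul, h1, h2, one_mul]
  exact le_of_eq (by ring)

/-! ### Decoupling with rapidly decreasing weights -/

theorem cutoff_zero : cutoff 0 = 0 := by simp [cutoff]

theorem cutoff_one : cutoff 1 = 0 := by simp [cutoff]

/-- Translates of the cutoff by `1 / 2` sum to one, since `sin² + cos² = 1`. -/
theorem cutoff_add_half (s : ℝ) : cutoff s + cutoff (s + 1 / 2) = 1 := by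
  rw [cutoff, cutoff]
  have : (Real.pi : ℂ) * ((s + 1 / 2 : ℝ) : ℂ) = Real.pi * s + Real.pi / 2 := by push_cast; ring
  rw [this, Complex.sin_add_pi_div_two]
  exact Complex.sin_sq_add_cos_sq _

/-- The left endpoint of the support of the `s`-th cutoff belonging to the `i`-th interval. -/
noncomputable def cutStart (δ : ℝ) (i s : ℕ) : ℝ := ((s : ℝ) - 2) / 2 * δ + i * δ

/-- The five cutoffs, at distance `δ / 2` from each other, which form a partition of unity near the
`i`-th interval of length `δ`. -/
noncomputable def cut (δ : ℝ) (i s : ℕ) : ℝ → ℂ :=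
  (Icc (cutStart δ i s) (cutStart δ i s + δ)).indicator (cutoffAt (cutStart δ i s) δ)

theorem cut_eq_zero {δ : ℝ} (hδ : 0 < δ) (i s : ℕ) {ξ : ℝ}
    (h : ξ ≤ cutStart δ i s ∨ cutStart δ i s + δ ≤ ξ) : cut δ i s ξ = 0 := by
  rw [cut, indicator_apply]
  split_ifs with hm
  · rw [cutoffAt]
    rcases h with h | h
    · rw [le_antisymm h hm.1, sub_self, zero_div, cutoff_zero]
    · rw [le_antisymm hm.2 h, add_sub_cancel_left, div_self hδ.ne', cutoff_one]
  · rfl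

theorem cut_eq {δ : ℝ} {i s : ℕ} {ξ : ℝ} (h : ξ ∈ Icc (cutStart δ i s) (cutStart δ i s + δ)) :
    cut δ i s ξ = cutoff ((ξ - cutStart δ i s) / δ) := by
  rw [cut, indicator_of_mem h, cutoffAt]

/-- At each point at most two consecutive cutoffs are nonzero, and these two sum to one. -/
theorem sum_cut {δ : ℝ} (hδ : 0 < δ) (i : ℕ) {ξ : ℝ} (h₁ : i * δ - δ / 2 ≤ ξ)
    (h₂ : ξ ≤ (i + 1) * δ + δ / 2) : ∑ s ∈ Finset.range 5, cut δ i s ξ = 1 := by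
  have key : ∀ k : ℕ, k + 1 < 5 → cutStart δ i (k + 1) ≤ ξ → ξ ≤ cutStart δ i k + δ →
      ∑ s ∈ Finset.range 5, cut δ i s ξ = 1 := by
    intro k hk ha hb
    have hst : ∀ a b : ℕ, cutStart δ i a = cutStart δ i b + ((a : ℝ) - b) / 2 * δ := by
      intro a b; simp only [cutStart]; ring
    have hk1 := hst (k + 1) k
    push_cast at hk1
    have hzero : ∀ s ∈ Finset.range 5, s ∉ ({k, k + 1} : Finset ℕ) → cut δ i s ξ = 0 := by
      intro s _ hs
      simp only [Finset.mem_insert, Finset.mem_singleton, not_or] at hs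
      refine cut_eq_zero hδ i s ?_
      rcases lt_or_gt_of_ne hs.1 with h | h
      · right
        have h3 := hst s (k + 1)
        have h4 : (s : ℝ) + 1 ≤ k := by exact_mod_cast h
        push_cast at h3
        nlinarith
      · left
        have h3 := hst s k
        have h4 : (k : ℝ) + 2 ≤ s := by
          have : k + 2 ≤ s := by omega
          exact_mod_cast this
        nlinarith
    have hsub : ({k, k + 1} : Finset ℕ) ⊆ Finset.range 5 := by
      intro s hs
      simp only [Finset.mem_insert, Finset.mem_singleton] at hs
      simp only [Finset.mem_range]
      omega
    rw [← Finset.sum_subset hsub hzero, Finset.sum_pair (by omega),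
      cut_eq ⟨by linarith, hb⟩, cut_eq ⟨ha, by linarith⟩, add_comm, hk1,
      ← cutoff_add_half ((ξ - (cutStart δ i k + (↑k + 1 - ↑k) / 2 * δ)) / δ)]
    congr 2
    field_simp
    ring
  have c : ∀ s : ℕ, cutStart δ i s = ((s : ℝ) - 2) / 2 * δ + i * δ := fun s => rfl
  have n1 : ((1 : ℕ) : ℝ) = 1 := by norm_num
  by_cases a1 : ξ ≤ i * δ
  · exact key 0 (by norm_num) (by rw [c]; push_cast; linarith) (by rw [c]; push_cast; linarith)
  by_cases a2 : ξ ≤ i * δ + δ / 2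
  · exact key 1 (by norm_num) (by rw [c]; push_cast; linarith) (by rw [c]; push_cast; linarith)
  by_cases a3 : ξ ≤ i * δ + δ
  · exact key 2 (by norm_num) (by rw [c]; push_cast; linarith) (by rw [c]; push_cast; linarith)
  · exact key 3 (by norm_num) (by rw [c]; push_cast; linarith) (by rw [c]; push_cast; linarith)

theorem extC_eq_sum {n : ℕ} (hn : 0 < n) {g : ℝ → ℂ} (hg : IntegrableOn g (Icc 0 1))
    (p : ℝ × ℝ) : extC (Icc 0 1) g p = ∑ i ∈ Finset.range n, extC (piece (n : ℝ)⁻¹ i) g p := by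
  rw [← ext_toPlane, ext_eq_sum hn hg, Finset.sum_apply]
  simp only [ext_toPlane]

theorem piece_subset {n i : ℕ} (hi : i < n) : piece (n : ℝ)⁻¹ i ⊆ Icc 0 1 := by
  have hn' : (0 : ℝ) < n := by exact_mod_cast (Nat.zero_le i).trans_lt hi
  refine Icc_subset_Icc (by positivity) ?_
  rw [← div_eq_mul_inv, div_le_one hn']
  exact_mod_cast hi

/-- The part of the Fourier transform of `bump2 R * extC (Icc 0 1) g` that is selected by the
`s`-th family of cutoffs; a function of `q = (τ, ξ)`. -/
noncomputable def part (n : ℕ) (g : ℝ → ℂ) (s : ℕ) (q : ℝ × ℝ) : ℂ :=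
  ∑ i ∈ Finset.range n, cut (n : ℝ)⁻¹ i s q.2 *
    slice ((n : ℝ) ^ 2) (piece (n : ℝ)⁻¹ i) g q

/-- The left endpoint of the interval of length `1` carrying `part n g s`. -/
noncomputable def partStart (n s : ℕ) : ℝ := ((s : ℝ) - 2) / 2 * (n : ℝ)⁻¹

section Part

variable {n : ℕ} {g : ℝ → ℂ}

theorem measurable_cut (δ : ℝ) (i s : ℕ) : Measurable (cut δ i s) :=
  (continuous_cutoffAt _ _).measurable.indicator measurableSet_Icc

theorem norm_cut_le (δ : ℝ) (i s : ℕ) (ξ : ℝ) : ‖cut δ i s ξ‖ ≤ 1 := by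
  rw [cut, indicator_apply]
  split_ifs
  · exact norm_cutoffAt_le _ _ _
  · simp

theorem measurable_part (hg : IntegrableOn g (Icc 0 1)) (s : ℕ) : Measurable (part n g s) := by
  unfold part
  refine Finset.measurable_fun_sum _ fun i hi => ?_
  have h1 := measurable_cut (n : ℝ)⁻¹ i s
  have h2 := (continuous_slice ((n : ℝ) ^ 2)
    (hg.mono_set (piece_subset (Finset.mem_range.1 hi)))).measurable
  fun_prop

theorem integrableOn_part (hg : IntegrableOn g (Icc 0 1)) (s : ℕ) {S : Set (ℝ × ℝ)}
    (hS : IsCompact S) : IntegrableOn (part n g s) S := by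
  unfold part
  refine integrable_finsetSum _ fun i hi => ?_
  have h2 : IntegrableOn (slice ((n : ℝ) ^ 2) (piece (n : ℝ)⁻¹ i) g) S :=
    (continuous_slice ((n : ℝ) ^ 2)
      (hg.mono_set (piece_subset (Finset.mem_range.1 hi)))).continuousOn.integrableOn_compact hS
  have h1 := measurable_cut (n : ℝ)⁻¹ i s
  exact Integrable.bdd_mul (c := 1) h2
    (by fun_prop : Measurable fun q : ℝ × ℝ => cut (n : ℝ)⁻¹ i s q.2).aestronglyMeasurable
    (Filter.Eventually.of_forall fun q => norm_cut_le _ _ _ _)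

theorem integrableOn_part_right (hg : IntegrableOn g (Icc 0 1)) (s : ℕ) (τ : ℝ) {S : Set ℝ}
    (hS : IsCompact S) : IntegrableOn (fun ξ => part n g s (τ, ξ)) S := by
  unfold part
  refine integrable_finsetSum _ fun i hi => ?_
  have h3 := continuous_slice ((n : ℝ) ^ 2)
    (hg.mono_set (piece_subset (Finset.mem_range.1 hi)))
  have h4 : Continuous fun ξ => slice ((n : ℝ) ^ 2) (piece (n : ℝ)⁻¹ i) g (τ, ξ) := by fun_prop
  exact Integrable.bdd_mul (c := 1) (h4.continuousOn.integrableOn_compact hS)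
    (measurable_cut (n : ℝ)⁻¹ i s).aestronglyMeasurable
    (Filter.Eventually.of_forall fun q => norm_cut_le _ _ _ _)

theorem cutStart_eq (n i s : ℕ) : cutStart (n : ℝ)⁻¹ i s = partStart n s + i * (n : ℝ)⁻¹ := rfl

/-- All cutoffs of the `s`-th family lie in one interval of length `1`. -/
theorem part_eq_zero (hn : 0 < n) (s : ℕ) {q : ℝ × ℝ}
    (hq : q.2 ∉ Icc (partStart n s) (partStart n s + 1)) : part n g s q = 0 := by
  have hn' : (0 : ℝ) < n := by exact_mod_cast hn
  refine Finset.sum_eq_zero fun i hi => ?_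
  have hi' : (i : ℝ) + 1 ≤ n := by exact_mod_cast Finset.mem_range.1 hi
  have h1 : (i : ℝ) * (n : ℝ)⁻¹ + (n : ℝ)⁻¹ ≤ 1 := by
    have : ((i : ℝ) + 1) * (n : ℝ)⁻¹ ≤ n * (n : ℝ)⁻¹ := by gcongr
    rw [mul_inv_cancel₀ hn'.ne'] at this
    linarith
  have h0 : 0 ≤ (i : ℝ) * (n : ℝ)⁻¹ := by positivity
  rw [cut_eq_zero (by positivity), zero_mul]
  rw [cutStart_eq]
  by_contra! h
  exact hq ⟨by linarith, by linarith⟩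

/-- On the `i`-th shifted interval only the `i`-th summand of `part n g s` survives. -/
theorem part_eq (hn : 0 < n) {i : ℕ} (hi : i < n) (s : ℕ) {q : ℝ × ℝ}
    (hq : q.2 ∈ Icc (cutStart (n : ℝ)⁻¹ i s) (cutStart (n : ℝ)⁻¹ i s + (n : ℝ)⁻¹)) :
    part n g s q = cutoffAt (cutStart (n : ℝ)⁻¹ i s) (n : ℝ)⁻¹ q.2 *
      slice ((n : ℝ) ^ 2) (piece (n : ℝ)⁻¹ i) g q := by
  have hδ : (0 : ℝ) < (n : ℝ)⁻¹ := by positivity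
  rw [part, Finset.sum_eq_single i]
  · rw [cut, indicator_of_mem hq]
  · intro j _ hj
    rw [cut_eq_zero hδ, zero_mul]
    rw [cutStart_eq] at hq ⊢
    rcases lt_or_gt_of_ne hj with h | h
    · right
      have h' : (j : ℝ) + 1 ≤ i := by exact_mod_cast h
      have : ((j : ℝ) + 1) * (n : ℝ)⁻¹ ≤ i * (n : ℝ)⁻¹ := by gcongr
      linarith [hq.1]
    · left
      have h' : (i : ℝ) + 1 ≤ j := by exact_mod_cast h
      have : ((i : ℝ) + 1) * (n : ℝ)⁻¹ ≤ j * (n : ℝ)⁻¹ := by gcongr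
      linarith [hq.2]
  · intro h
    exact absurd (Finset.mem_range.2 hi) h

/-- The five families of cutoffs sum to one on the support of each slice, as the localisation moves
frequencies by at most `1 / (4 n²) < 1 / (2 n)`. -/
theorem sum_part (hn : 0 < n) (q : ℝ × ℝ) :
    ∑ s ∈ Finset.range 5, part n g s q =
      ∑ i ∈ Finset.range n, slice ((n : ℝ) ^ 2) (piece (n : ℝ)⁻¹ i) g q := by
  have hn' : (1 : ℝ) ≤ n := by exact_mod_cast hn
  simp only [part]
  rw [Finset.sum_comm]
  refine Finset.sum_congr rfl fun i _ => ?_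
  rw [← Finset.sum_mul]
  set δ : ℝ := (n : ℝ)⁻¹ with hδd
  have hδ : 0 < δ := by positivity
  by_cases h : (i : ℝ) * δ - δ / 2 ≤ q.2 ∧ q.2 ≤ (i + 1) * δ + δ / 2
  · rw [sum_cut hδ i h.1 h.2, one_mul]
  · rw [slice_eq_zero (J := piece δ i) (by positivity) measurableSet_Icc, mul_zero]
    intro η hη
    have h4 : 1 / (4 * (n : ℝ) ^ 2) < δ / 2 := by
      rw [hδd, div_lt_div_iff₀ (by positivity) (by norm_num), ← div_eq_inv_mul, lt_div_iff₀ (by linarith)]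
      nlinarith
    refine h4.trans ?_
    by_contra! hc
    have := abs_le.1 hc
    have h1 : (i : ℝ) * δ ≤ η := hη.1
    have h2 : η ≤ ((i : ℝ) + 1) * δ := hη.2
    exact h ⟨by linarith, by linarith⟩

theorem abs_partStart_le (hn : 0 < n) {s : ℕ} (hs : s < 5) : |partStart n s| ≤ 1 := by
  have h1 : (n : ℝ)⁻¹ ≤ 1 := inv_le_one_of_one_le₀ (by exact_mod_cast hn)
  have h0 : 0 ≤ (n : ℝ)⁻¹ := by positivity
  have hs' : (s : ℝ) ≤ 4 := by exact_mod_cast Nat.le_of_lt_succ hs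
  have hs0 : (0 : ℝ) ≤ s := by positivity
  rw [partStart, abs_mul, abs_of_nonneg h0]
  have : |((s : ℝ) - 2) / 2| ≤ 1 := abs_le.2 ⟨by linarith, by linarith⟩
  exact mul_le_one₀ this h0 h1

/-- The localised function is an average over `τ` of modulations of functions in the range of the
extension operator. -/
theorem bump2_mul_extC_eq_integral (hn : 0 < n) (hg : IntegrableOn g (Icc 0 1)) (p : ℝ × ℝ) :
    (bump2 ((n : ℝ) ^ 2) p : ℂ) * extC (Icc 0 1) g p =
      ∫ τ in Icc (-(1 / (n : ℝ) ^ 2)) (1 / (n : ℝ) ^ 2), ∑ s ∈ Finset.range 5, e (τ * p.2) *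
        extC (Icc (partStart n s) (partStart n s + 1)) (fun ξ => part n g s (τ, ξ)) p := by
  have hn' : (1 : ℝ) ≤ n := by exact_mod_cast hn
  have hce := continuous_e
  set R : ℝ := (n : ℝ) ^ 2 with hR
  have hR1 : 1 ≤ R := one_le_pow₀ hn'
  set T := Icc (-(1 / R)) (1 / R)
  set X := Icc (-1 : ℝ) 2
  have hS : IsCompact (T ×ˢ X) := isCompact_Icc.prod isCompact_Icc
  set ph : ℝ × ℝ → ℂ := fun q => e (q.2 * p.1 + (q.2 ^ 2 + q.1) * p.2) with hph
  have hphc : Continuous ph := by simp only [hph]; fun_prop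
  have hint : ∀ s, IntegrableOn (fun q => part n g s q * ph q) (T ×ˢ X) := fun s =>
    Integrable.mul_bdd (c := 1) (integrableOn_part hg s hS) hphc.aestronglyMeasurable
      (Filter.Eventually.of_forall fun q => (norm_e _).le)
  have hint' : ∀ i ∈ Finset.range n,
      IntegrableOn (fun q => slice R (piece (n : ℝ)⁻¹ i) g q * ph q) (T ×ˢ X) := fun i hi =>
    ((continuous_slice R (hg.mono_set (piece_subset (Finset.mem_range.1 hi)))).mul
      hphc).continuousOn.integrableOn_compact hS
  rw [extC_eq_sum hn hg, Finset.mul_sum]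
  calc ∑ i ∈ Finset.range n, (bump2 R p : ℂ) * extC (piece (n : ℝ)⁻¹ i) g p
      = ∑ i ∈ Finset.range n, ∫ q in T ×ˢ X, slice R (piece (n : ℝ)⁻¹ i) g q * ph q := by
        refine Finset.sum_congr rfl fun i hi => ?_
        have hi := piece_subset (Finset.mem_range.1 hi)
        exact bump2_mul_extC hR1 measurableSet_Icc hi (hg.mono_set hi) p
    _ = ∫ q in T ×ˢ X, ∑ s ∈ Finset.range 5, part n g s q * ph q := by
        rw [← integral_finsetSum _ hint']
        congr 1
        funext q
        rw [← Finset.sum_mul, ← Finset.sum_mul, sum_part hn]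
    _ = ∫ τ in T, ∫ ξ in X, ∑ s ∈ Finset.range 5, part n g s (τ, ξ) * ph (τ, ξ) := by
        have := integrable_finsetSum (Finset.range 5) fun s _ => hint s
        rw [Measure.volume_eq_prod, ← Measure.prod_restrict] at this ⊢
        rw [integral_prod _ this]
    _ = _ := by
        congr 1
        funext τ
        rw [integral_finsetSum]
        · refine Finset.sum_congr rfl fun s hs => ?_
          have ha := abs_le.1 (abs_partStart_le hn (Finset.mem_range.1 hs))
          rw [extC, ← integral_const_mul,
            setIntegral_eq_of_subset_of_forall_sdiff_eq_zero measurableSet_Icc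
              (Icc_subset_Icc (by linarith) (by linarith) :
                Icc (partStart n s) (partStart n s + 1) ⊆ X)]
          · congr 1
            funext ξ
            simp only [hph]
            rw [mul_left_comm, ← e_add]
            congr 2
            ring
          · intro ξ hξ
            rw [part_eq_zero hn s hξ.2, zero_mul]
        · intro s _
          exact Integrable.mul_bdd (c := 1) (integrableOn_part_right hg s τ isCompact_Icc)
            (by fun_prop : Continuous fun ξ => ph (τ, ξ)).aestronglyMeasurable
            (Filter.Eventually.of_forall fun q => (norm_e _).le)

end Part

/-- Hölder's inequality for a finite sum and an integral over a finite measure. -/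
theorem lintegral_sum_pow_six_le {α : Type*} [MeasurableSpace α] (μ : Measure α) (s : Finset ℕ)
    {f : ℕ → α → ℝ≥0∞} (hf : ∀ i, Measurable (f i)) :
    (∫⁻ x, ∑ i ∈ s, f i x ∂μ) ^ 6 ≤
      μ univ ^ 5 * (s.card : ℝ≥0∞) ^ 5 * ∫⁻ x, ∑ i ∈ s, f i x ^ 6 ∂μ := by
  have hs : Measurable fun x => ∑ i ∈ s, f i x := Finset.measurable_fun_sum _ fun i _ => hf i
  have h1 := lintegral_mul_pow_six_le μ hs.aemeasurable (b := fun _ => 1) aemeasurable_const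
  simp only [mul_one, lintegral_one] at h1
  refine h1.trans ?_
  rw [mul_assoc, ← lintegral_const_mul _
    (Finset.measurable_fun_sum _ fun i _ => (hf i).pow_const _)]
  refine mul_le_mul_right (lintegral_mono fun x => ?_) _
  have := ENNReal.rpow_sum_le_const_mul_sum_rpow s (fun i => f i x) (show (1 : ℝ) ≤ 6 by norm_num)
  norm_num at this
  exact_mod_cast this

/-- The constant of `decoupling_improved`. -/
noncomputable def impC : ℝ≥0∞ := 3 * 10 ^ 6 * convC

/-- The decoupling inequality with the same constant up to an absolute factor, and with weights of
much faster decay. -/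
theorem decoupling_improved {n : ℕ} (hn : 0 < n) {g : ℝ → ℂ} (hg : IntegrableOn g (Icc 0 1)) :
    intSix (box2 ((n : ℝ) ^ 2)) (extC (Icc 0 1) g) ≤
      impC * D (n : ℝ)⁻¹ ^ 6 * (∑ i ∈ Finset.range n,
        intSix (fun z => decay 118 ((n : ℝ) ^ 2) z.1 * decay 118 ((n : ℝ) ^ 2) z.2)
          (extC (piece (n : ℝ)⁻¹ i) g) ^ (1 / 3 : ℝ)) ^ 3 := by
  have hn' : (1 : ℝ) ≤ n := by exact_mod_cast hn
  set R : ℝ := (n : ℝ) ^ 2 with hRd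
  have hR0 : 0 < R := by positivity
  set T := Icc (-(1 / R)) (1 / R) with hT
  set S : ℝ≥0∞ := (∑ i ∈ Finset.range n,
        intSix (fun z => decay 118 R z.1 * decay 118 R z.2)
          (extC (piece (n : ℝ)⁻¹ i) g) ^ (1 / 3 : ℝ)) with hS
  set u : ℕ → ℝ → ℝ × ℝ → ℂ := fun s τ p =>
    extC (Icc (partStart n s) (partStart n s + 1)) (fun ξ => part n g s (τ, ξ)) p with hu
  have hvol : volume T = 2 * ENNReal.ofReal R⁻¹ := by
    rw [hT, Real.volume_Icc, show 1 / R - -(1 / R) = 2 * R⁻¹ by field_simp; norm_num,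
      ENNReal.ofReal_mul (by norm_num)]
    norm_num
  -- each `τ` contributes a function to which decoupling for a shifted partition applies
  have hτ : ∀ s ∈ Finset.range 5, ∀ τ, intSix (box2 R) (u s τ) ≤
      3 * D (n : ℝ)⁻¹ ^ 6 * (convC * ENNReal.ofReal R ^ 6) * S ^ 3 := by
    intro s hs τ
    refine (decoupling_shifted hn (abs_partStart_le hn (Finset.mem_range.1 hs))
      (integrableOn_part_right hg s τ isCompact_Icc)).trans ?_
    rw [mul_assoc (3 * D (n : ℝ)⁻¹ ^ 6)]
    refine mul_le_mul_right ?_ _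
    have h1 : ∀ i ∈ Finset.range n, intSix (fun p => decay 100 R p.2)
        (extC (Icc (partStart n s + i * (n : ℝ)⁻¹) (partStart n s + (i + 1) * (n : ℝ)⁻¹))
          fun ξ => part n g s (τ, ξ)) ^ (1 / 3 : ℝ) ≤
        (convC * ENNReal.ofReal R ^ 6) ^ (1 / 3 : ℝ) *
          intSix (fun z => decay 118 R z.1 * decay 118 R z.2)
            (extC (piece (n : ℝ)⁻¹ i) g) ^ (1 / 3 : ℝ) := by
      intro i hi
      have hi := Finset.mem_range.1 hi
      rw [← ENNReal.mul_rpow_of_nonneg _ _ (by norm_num)]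
      refine ENNReal.rpow_le_rpow ?_ (by norm_num)
      have he : extC (Icc (partStart n s + i * (n : ℝ)⁻¹) (partStart n s + (i + 1) * (n : ℝ)⁻¹))
          (fun ξ => part n g s (τ, ξ)) =
        extC (Icc (cutStart (n : ℝ)⁻¹ i s) (cutStart (n : ℝ)⁻¹ i s + (n : ℝ)⁻¹)) (fun ξ =>
          cutoffAt (cutStart (n : ℝ)⁻¹ i s) (n : ℝ)⁻¹ ξ *
            slice R (piece (n : ℝ)⁻¹ i) g (τ, ξ)) := by
        funext p
        have e1 : partStart n s + ((i : ℝ) + 1) * (n : ℝ)⁻¹ =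
          cutStart (n : ℝ)⁻¹ i s + (n : ℝ)⁻¹ := by rw [cutStart_eq]; ring
        rw [e1, ← cutStart_eq]
        refine setIntegral_congr_fun measurableSet_Icc fun ξ hξ => ?_
        simp only
        rw [part_eq hn hi s (q := (τ, ξ)) hξ]
      rw [he]
      exact intSix_extC_cutoffAt_mul_slice_le hn (hg.mono_set (piece_subset hi)) _ τ
    refine (pow_le_pow_left' (Finset.sum_le_sum h1) 3).trans (le_of_eq ?_)
    rw [← Finset.mul_sum, mul_pow, ← ENNReal.rpow_natCast ((convC * _) ^ _), ← ENNReal.rpow_mul]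
    norm_num
    rw [hS]
  -- joint measurability, needed to interchange the integrals over `τ` and over the plane
  have humeas : ∀ s, Measurable fun q : ℝ × (ℝ × ℝ) => ‖u s q.1 q.2‖ₑ := by
    intro s
    have h1 : Measurable fun q : (ℝ × (ℝ × ℝ)) × ℝ =>
        part n g s (q.1.1, q.2) * e (q.2 * q.1.2.1 + q.2 ^ 2 * q.1.2.2) := by
      have := measurable_part (n := n) hg s
      have := continuous_e.measurable
      fun_prop
    have h2 := h1.stronglyMeasurable.integral_prod_right'
      (ν := volume.restrict (Icc (partStart n s) (partStart n s + 1)))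
    exact h2.measurable.enorm
  have hpt : ∀ p, ‖extC (Icc 0 1) g p‖ₑ ^ 6 * box2 R p ≤
      (volume T) ^ 5 * 5 ^ 5 * ∫⁻ τ in T, ∑ s ∈ Finset.range 5, ‖u s τ p‖ₑ ^ 6 * box2 R p := by
    intro p
    by_cases hp : p ∈ {p : ℝ × ℝ | |p.1| ≤ R / 2 ∧ |p.2| ≤ R / 2}
    swap
    · simp only [box2]; rw [indicator_of_notMem hp, mul_zero]; exact zero_le
    have hb : box2 R p = 1 := by simp only [box2]; rw [indicator_of_mem hp]
    have hb1 : 1 ≤ ENNReal.ofReal (bump2 R p) := hb ▸ box2_le_bump2 hR0 p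
    simp only [hb, mul_one]
    have h1 : ‖extC (Icc 0 1) g p‖ₑ ≤ ∫⁻ τ in T, ∑ s ∈ Finset.range 5, ‖u s τ p‖ₑ := by
      calc ‖extC (Icc 0 1) g p‖ₑ ≤ ENNReal.ofReal (bump2 R p) * ‖extC (Icc 0 1) g p‖ₑ :=
            le_mul_of_one_le_left' hb1
        _ = ‖(bump2 R p : ℂ) * extC (Icc 0 1) g p‖ₑ := by
            rw [enorm_mul, ← ofReal_norm (bump2 R p : ℂ), Complex.norm_real,
              Real.norm_of_nonneg (bump2_nonneg R p)]
        _ ≤ _ := by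
            rw [bump2_mul_extC_eq_integral hn hg]
            refine (enorm_integral_le_lintegral_enorm _).trans (lintegral_mono fun τ => ?_)
            refine (enorm_sum_le _ _).trans (Finset.sum_le_sum fun s _ => ?_)
            rw [enorm_mul, ← ofReal_norm (e _), norm_e, ENNReal.ofReal_one, one_mul]
    have hum : ∀ s, Measurable fun τ => ‖u s τ p‖ₑ := fun s => by
      have := (humeas s).comp (by fun_prop : Measurable fun τ : ℝ => (τ, p))
      simpa only [Function.comp_def] using this
    refine (pow_le_pow_left' h1 6).trans ?_
    have := lintegral_sum_pow_six_le (volume.restrict T) (Finset.range 5) hum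
    rwa [Measure.restrict_apply_univ, Finset.card_range] at this
  have hbm := measurable_box2 R
  calc intSix (box2 R) (extC (Icc 0 1) g)
      ≤ ∫⁻ p, (volume T) ^ 5 * 5 ^ 5 *
          ∫⁻ τ in T, ∑ s ∈ Finset.range 5, ‖u s τ p‖ₑ ^ 6 * box2 R p := lintegral_mono hpt
    _ = (volume T) ^ 5 * 5 ^ 5 *
          ∫⁻ τ in T, ∑ s ∈ Finset.range 5, intSix (box2 R) (u s τ) := by
        have hm : Measurable fun q : (ℝ × ℝ) × ℝ =>
            ∑ s ∈ Finset.range 5, ‖u s q.2 q.1‖ₑ ^ 6 * box2 R q.1 := by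
          refine Finset.measurable_fun_sum _ fun s _ => ?_
          have := (humeas s).comp (measurable_swap (α := ℝ × ℝ) (β := ℝ))
          simp only [Function.comp_def, Prod.fst_swap, Prod.snd_swap] at this
          fun_prop
        rw [lintegral_const_mul _ hm.lintegral_prod_right',
          lintegral_lintegral_swap hm.aemeasurable]
        congr 1
        refine lintegral_congr fun τ => ?_
        rw [lintegral_finsetSum]
        · rfl
        · intro s _
          have := (humeas s).comp (by fun_prop : Measurable fun p : ℝ × ℝ => (τ, p))
          simp only [Function.comp_def] at this
          fun_prop
    _ ≤ (volume T) ^ 5 * 5 ^ 5 * ∫⁻ _ in T, ∑ s ∈ Finset.range 5,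
          3 * D (n : ℝ)⁻¹ ^ 6 * (convC * ENNReal.ofReal R ^ 6) * S ^ 3 := by
        gcongr with τ s hs
        exact hτ s hs τ
    _ = impC * D (n : ℝ)⁻¹ ^ 6 * S ^ 3 * (ENNReal.ofReal R⁻¹ * ENNReal.ofReal R) ^ 6 := by
        rw [lintegral_const, Measure.restrict_apply_univ, hvol, Finset.sum_const,
          Finset.card_range, nsmul_eq_mul, impC]
        push_cast
        ring
    _ = _ := by
        rw [← ENNReal.ofReal_mul (by positivity), inv_mul_cancel₀ hR0.ne', ENNReal.ofReal_one,
          one_pow, mul_one]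

/-- Translated form of `decoupling_improved`. -/
theorem decoupling_improved_translate {n : ℕ} (hn : 0 < n) {g : ℝ → ℂ}
    (hg : IntegrableOn g (Icc 0 1)) (c : ℝ × ℝ) :
    intSix (fun p => box2 ((n : ℝ) ^ 2) (p - c)) (extC (Icc 0 1) g) ≤
      impC * D (n : ℝ)⁻¹ ^ 6 * (∑ i ∈ Finset.range n,
        intSix (fun p => decay 118 ((n : ℝ) ^ 2) (p - c).1 * decay 118 ((n : ℝ) ^ 2) (p - c).2)
          (extC (piece (n : ℝ)⁻¹ i) g) ^ (1 / 3 : ℝ)) ^ 3 := by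
  have key : ∀ (w : ℝ × ℝ → ℝ≥0∞) (J : Set ℝ), intSix (fun p => w (p - c)) (extC J g) =
      intSix w (extC J fun ξ => g ξ * e (ξ * c.1 + ξ ^ 2 * c.2)) := by
    intro w J
    simp only [intSix, extC_modulate]
    rw [← lintegral_sub_right_eq_self (fun p => ‖extC J g (p + c)‖ₑ ^ 6 * w p) c]
    simp only [sub_add_cancel]
  rw [key]
  have key' : ∀ i : ℕ,
      intSix (fun p => decay 118 ((n : ℝ) ^ 2) (p - c).1 * decay 118 ((n : ℝ) ^ 2) (p - c).2)
          (extC (piece (n : ℝ)⁻¹ i) g) =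
        intSix (fun z => decay 118 ((n : ℝ) ^ 2) z.1 * decay 118 ((n : ℝ) ^ 2) z.2)
          (extC (piece (n : ℝ)⁻¹ i) fun ξ => g ξ * e (ξ * c.1 + ξ ^ 2 * c.2)) := fun i =>
    key (fun z => decay 118 ((n : ℝ) ^ 2) z.1 * decay 118 ((n : ℝ) ^ 2) z.2) _
  simp only [key']
  exact decoupling_improved hn (integrableOn_char hg c)

/-! ### Parabolic rescaling -/

theorem lintegral_box2 (R : ℝ) : ∫⁻ p, box2 R p = ENNReal.ofReal R ^ 2 := by
  have h : {p : ℝ × ℝ | |p.1| ≤ R / 2 ∧ |p.2| ≤ R / 2} =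
      Icc (-(R / 2)) (R / 2) ×ˢ Icc (-(R / 2)) (R / 2) := by
    ext p; simp only [mem_ofPred_eq, abs_le, mem_prod, mem_Icc]
  unfold box2
  rw [lintegral_indicator_const (measurableSet_box2 R), h, Measure.volume_eq_prod,
    Measure.prod_prod, Real.volume_Icc, one_mul, pow_two, sub_neg_eq_add, add_halves]

theorem lintegral_sub_swap (k W : ℝ × ℝ → ℝ≥0∞) (p : ℝ × ℝ) :
    ∫⁻ z, k (p - z) * W z = ∫⁻ u, k u * W (p - u) := by
  rw [← lintegral_sub_left_eq_self (fun u => k u * W (p - u)) p]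
  simp only [sub_sub_cancel]

/-- Change of variables in `∫ |E_J g|⁶ w`: the factor `σ⁶` of the extension operator meets the Jacobian
`σ⁻³`. -/
theorem lintegral_extC_affine_mul {α σ : ℝ} (hσ : 0 < σ) {u v : ℝ} (huv : u ≤ v) {g : ℝ → ℂ}
    (hg : IntegrableOn g (Icc (α + σ * u) (α + σ * v))) {w : ℝ × ℝ → ℝ≥0∞} (hw : Measurable w)
    (z : ℝ × ℝ) :
    ∫⁻ p, ‖extC (Icc (α + σ * u) (α + σ * v)) g p‖ₑ ^ 6 * w (para α σ (p - z)) =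
      ENNReal.ofReal σ ^ 3 *
        intSix (fun q => w (q - para α σ z)) (extC (Icc u v) fun s => g (α + σ * s)) := by
  have hm := (continuous_extC (integrableOn_comp_affine hσ hg)).measurable.enorm
  simp_rw [enorm_extC_affine α σ huv hσ g, para_sub, mul_pow, mul_assoc]
  rw [lintegral_const_mul' _ _ (by simp), lintegral_comp_para α hσ
    (F := fun q => ‖extC (Icc u v) (fun s => g (α + σ * s)) q‖ₑ ^ 6 * w (q - para α σ z))
    (by fun_prop), ← mul_assoc, intSix]
  congr 1
  rw [← ENNReal.ofReal_pow hσ.le, ← ENNReal.ofReal_mul (by positivity),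
    ← ENNReal.ofReal_pow hσ.le]
  congr 1
  field_simp

/-- The constant of `rescaling`. -/
noncomputable def resC : ℝ≥0∞ := 16 * 9 ^ 100 * impC

/-- A parallelogram adapted to an interval of length `σ` at scale `L = σ² R` has diameter at most `R`, up
to a constant. -/
theorem abs_add_abs_le_of_para {α σ R L : ℝ} (hα : α ∈ Icc 0 1) (hσ : 0 < σ) (hσ1 : σ ≤ 1)
    (hR : 0 < R) (hL : L = σ ^ 2 * R) (u : ℝ × ℝ) :
    (|u.1| + |u.2|) / R ≤ |(para α σ u).1| / L + 3 * (|(para α σ u).2| / L) := by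
  have h2 : |(para α σ u).2| / L = |u.2| / R := by
    simp only [para, hL, abs_mul, abs_pow, abs_of_pos hσ]
    field_simp
  have h1 : |u.1 + 2 * α * u.2| / R ≤ |(para α σ u).1| / L := by
    simp only [para, hL, abs_mul, abs_of_pos hσ]
    rw [pow_two, mul_assoc σ σ R, mul_div_mul_left _ _ hσ.ne']
    gcongr
    exact mul_le_of_le_one_left hR.le hσ1
  have h3 : |u.1| ≤ |u.1 + 2 * α * u.2| + 2 * |u.2| := by
    have h4 : |2 * α * u.2| ≤ 2 * |u.2| := by
      rw [abs_mul, abs_of_nonneg (by linarith [hα.1])]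
      gcongr
      linarith [hα.2]
    have := abs_sub (u.1 + 2 * α * u.2) (2 * α * u.2)
    rw [add_sub_cancel_right] at this
    linarith
  calc (|u.1| + |u.2|) / R ≤ (|u.1 + 2 * α * u.2| + 3 * |u.2|) / R :=
        (div_le_div_iff_of_pos_right hR).2 (by linarith)
    _ = |u.1 + 2 * α * u.2| / R + 3 * (|u.2| / R) := by ring
    _ ≤ _ := by rw [h2]; gcongr

section Average

variable {α σ R L : ℝ}

theorem wt_sub_le (hR : 0 < R) (c p u : ℝ × ℝ) :
    wt R c (p - u) ≤ ENNReal.ofReal (1 + (|u.1| + |u.2|) / R) ^ 100 * wt R c p := by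
  simpa using wt_le_mul hR c (p - u) p

theorem wt_le_sub (hR : 0 < R) (c p u : ℝ × ℝ) :
    wt R c p ≤ ENNReal.ofReal (1 + (|u.1| + |u.2|) / R) ^ 100 * wt R c (p - u) := by
  simpa using wt_le_mul hR c p (p - u)

/-- The weight is bounded by its average over translates of a parallelogram. -/
theorem wt_le_average (hα : α ∈ Icc 0 1) (hσ : 0 < σ) (hσ1 : σ ≤ 1) (hR : 0 < R)
    (hL : L = σ ^ 2 * R) (c p : ℝ × ℝ) :
    (∫⁻ u, box2 L (para α σ u)) * wt R c p ≤
      ∫⁻ z, (3 ^ 100 * box2 L (para α σ (p - z))) * wt R c z := by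
  have hL0 : 0 < L := by rw [hL]; positivity
  have hbm := measurable_box2 L
  have hTm : Measurable (para α σ) := (continuous_para α σ).measurable
  rw [lintegral_sub_swap (fun u => 3 ^ 100 * box2 L (para α σ u)),
    ← lintegral_mul_const _ (by fun_prop)]
  refine lintegral_mono fun u => ?_
  by_cases hu : para α σ u ∈ {p : ℝ × ℝ | |p.1| ≤ L / 2 ∧ |p.2| ≤ L / 2}
  · have hb : box2 L (para α σ u) = 1 := by simp only [box2]; rw [indicator_of_mem hu]
    simp only [hb, one_mul, mul_one]
    refine (wt_le_sub hR c p u).trans ?_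
    gcongr
    have h3 := abs_add_abs_le_of_para hα hσ hσ1 hR hL u
    have a1 : |(para α σ u).1| / L ≤ 1 / 2 := by rw [div_le_iff₀ hL0]; linarith [hu.1]
    have a2 : |(para α σ u).2| / L ≤ 1 / 2 := by rw [div_le_iff₀ hL0]; linarith [hu.2]
    refine (ENNReal.ofReal_le_ofReal (show _ ≤ (3 : ℝ) by linarith)).trans (by simp)
  · simp only [box2]
    rw [indicator_of_notMem hu, zero_mul]
    exact zero_le

/-- The average of the weight against a rapidly decreasing kernel adapted to a parallelogram is
bounded by the weight. Of the exponent `118`, the part `100` pays for the growth of the weight, and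
the rest for integrability. -/
theorem average_le_wt (hα : α ∈ Icc 0 1) (hσ : 0 < σ) (hσ1 : σ ≤ 1) (hR : 0 < R)
    (hL : L = σ ^ 2 * R) (c p : ℝ × ℝ) :
    ∫⁻ z, (decay 118 L (para α σ (p - z)).1 * decay 118 L (para α σ (p - z)).2) * wt R c z ≤
      (16 * 3 ^ 100 * ∫⁻ u, box2 L (para α σ u)) * wt R c p := by
  have hL0 : 0 < L := by rw [hL]; positivity
  rw [lintegral_sub_swap (fun u => decay 118 L (para α σ u).1 * decay 118 L (para α σ u).2)]
  have hd18 := measurable_decay 18 L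
  calc ∫⁻ u, (decay 118 L (para α σ u).1 * decay 118 L (para α σ u).2) * wt R c (p - u)
      ≤ ∫⁻ u, (3 ^ 100 * wt R c p) * (decay 18 L (para α σ u).1 * decay 18 L (para α σ u).2) := by
        refine lintegral_mono fun u => ?_
        have h3 := abs_add_abs_le_of_para hα hσ hσ1 hR hL u
        have h4 : ENNReal.ofReal (1 + (|u.1| + |u.2|) / R) ≤
            3 * (growth L (para α σ u).1 * growth L (para α σ u).2) := by
          rw [growth, growth, ← ENNReal.ofReal_mul (by positivity),
            ← ENNReal.ofReal_ofNat, ← ENNReal.ofReal_mul (by norm_num)]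
          refine ENNReal.ofReal_le_ofReal ?_
          have b1 : 0 ≤ |(para α σ u).1| / L := by positivity
          have b2 : 0 ≤ |(para α σ u).2| / L := by positivity
          have b3 := mul_nonneg b1 b2
          linarith
        calc (decay 118 L (para α σ u).1 * decay 118 L (para α σ u).2) * wt R c (p - u)
            ≤ (decay 118 L (para α σ u).1 * decay 118 L (para α σ u).2) *
                ((3 * (growth L (para α σ u).1 * growth L (para α σ u).2)) ^ 100 * wt R c p) := by
              refine mul_le_mul_right ((wt_sub_le hR c p u).trans ?_) _
              gcongr
          _ = (3 ^ 100 * wt R c p) * ((growth L (para α σ u).1 ^ 100 * decay (18 + 100) L (para α σ u).1) *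
                (growth L (para α σ u).2 ^ 100 * decay (18 + 100) L (para α σ u).2)) := by ring
          _ = _ := by rw [growth_pow_mul_decay hL0, growth_pow_mul_decay hL0]
    _ = (3 ^ 100 * wt R c p) * (ENNReal.ofReal (σ⁻¹ ^ 3) *
          ((∫⁻ x, decay 18 L x) * ∫⁻ x, decay 18 L x)) := by
        rw [lintegral_const_mul _ (by fun_prop), ← lintegral_mul_prod hd18 hd18,
          lintegral_comp_para α hσ (F := fun q => decay 18 L q.1 * decay 18 L q.2) (by fun_prop)]
    _ ≤ (3 ^ 100 * wt R c p) * (ENNReal.ofReal (σ⁻¹ ^ 3) *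
          (ENNReal.ofReal (4 * L) * ENNReal.ofReal (4 * L))) := by
        gcongr <;> exact lintegral_decay_le (by norm_num) hL0
    _ = _ := by
        rw [lintegral_comp_para α hσ (measurable_box2 L), lintegral_box2 L, ENNReal.ofReal_mul (by norm_num : (0 : ℝ) ≤ 4), ENNReal.ofReal_ofNat]
        ring

end Average

/-- **Parabolic rescaling**: decoupling of an interval of length `1 / k` into intervals of length
`1 / (k l)`, with the weight of a square of side length `(k l)²` on both sides. -/
theorem rescaling {n k l i : ℕ} (hk : 0 < k) (hl : 0 < l) (hn : n = k * l) (hi : i < k)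
    {g : ℝ → ℂ} (hg : IntegrableOn g (Icc 0 1)) (c : ℝ × ℝ) :
    intSix (wt ((n : ℝ) ^ 2) c) (extC (piece (k : ℝ)⁻¹ i) g) ≤
      resC * D (l : ℝ)⁻¹ ^ 6 * (∑ j ∈ Finset.range l,
        intSix (wt ((n : ℝ) ^ 2) c) (extC (piece (n : ℝ)⁻¹ (i * l + j)) g) ^ (1 / 3 : ℝ)) ^ 3 := by
  have hk' : (1 : ℝ) ≤ k := by exact_mod_cast hk
  have hl' : (1 : ℝ) ≤ l := by exact_mod_cast hl
  have hn0 : (n : ℝ) = k * l := by exact_mod_cast hn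
  set R : ℝ := (n : ℝ) ^ 2 with hRd
  have hR : 0 < R := by rw [hRd, hn0]; positivity
  set σ : ℝ := (k : ℝ)⁻¹ with hσd
  have hσ : 0 < σ := by positivity
  have hσ1 : σ ≤ 1 := inv_le_one_of_one_le₀ hk'
  set α : ℝ := i * σ with hαd
  set L : ℝ := (l : ℝ) ^ 2 with hLd
  have hL0 : 0 < L := by positivity
  have hL : L = σ ^ 2 * R := by
    rw [hRd, hn0, hσd, hLd]; field_simp
  have hα : α ∈ Icc (0 : ℝ) 1 := by
    refine ⟨by positivity, ?_⟩
    rw [hαd, hσd, ← div_eq_mul_inv, div_le_one (by linarith)]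
    exact_mod_cast hi.le
  set T := para α σ with hT
  have hTm : Measurable T := (continuous_para α σ).measurable
  have hbm := measurable_box2 L
  have hdm := measurable_decay 118 L
  have hWm := measurable_wt R c
  -- in the variable `s`, where `ξ = α + σ s`, the interval becomes `[0, 1]` and its pieces have length
  -- `1 / l`
  have hpk : piece σ i = Icc (α + σ * 0) (α + σ * 1) := by
    rw [piece]; congr 1 <;> ring
  have hpn : ∀ j : ℕ, piece (n : ℝ)⁻¹ (i * l + j) =
      Icc (α + σ * (j * (l : ℝ)⁻¹)) (α + σ * ((j + 1) * (l : ℝ)⁻¹)) := by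
    intro j
    have e1 : (n : ℝ)⁻¹ = σ * (l : ℝ)⁻¹ := by rw [hn0, mul_inv]
    have e2 : (l : ℝ) * (l : ℝ)⁻¹ = 1 := mul_inv_cancel₀ (by positivity)
    rw [piece, e1, hαd]
    push_cast
    congr 1
    · calc ((i : ℝ) * l + j) * (σ * (l : ℝ)⁻¹) = i * σ * (l * (l : ℝ)⁻¹) + σ * (j * (l : ℝ)⁻¹) := by ring
        _ = _ := by rw [e2]; ring
    · calc ((i : ℝ) * l + j + 1) * (σ * (l : ℝ)⁻¹) =
          i * σ * (l * (l : ℝ)⁻¹) + σ * ((j + 1) * (l : ℝ)⁻¹) := by ring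
        _ = _ := by rw [e2]; ring
  have hgk : IntegrableOn g (Icc (α + σ * 0) (α + σ * 1)) := by
    rw [← hpk]; exact hg.mono_set (piece_subset hi)
  have hgn : ∀ j, j < l → IntegrableOn g (piece (n : ℝ)⁻¹ (i * l + j)) := by
    intro j hj
    refine hg.mono_set (piece_subset ?_)
    rw [hn]
    calc i * l + j < i * l + l := by omega
      _ = (i + 1) * l := by ring
      _ ≤ k * l := Nat.mul_le_mul_right _ hi
  set g' : ℝ → ℂ := fun s => g (α + σ * s) with hg'
  have hg'i : IntegrableOn g' (Icc 0 1) := integrableOn_comp_affine hσ hgk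
  set V : ℝ≥0∞ := ∫⁻ u, box2 L (T u) with hV
  have hVeq : V = ENNReal.ofReal (σ⁻¹ ^ 3) * ENNReal.ofReal L ^ 2 := by
    rw [hV, lintegral_comp_para α hσ hbm, lintegral_box2 L]
  have hV0 : V ≠ 0 := by
    rw [hVeq]
    have h1 : 0 < ENNReal.ofReal (σ⁻¹ ^ 3) := ENNReal.ofReal_pos.2 (by positivity)
    have h2 : 0 < ENNReal.ofReal L := ENNReal.ofReal_pos.2 hL0
    exact mul_ne_zero h1.ne' (pow_ne_zero _ h2.ne')
  have hVt : V ≠ ∞ := by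
    rw [hVeq]; exact ENNReal.mul_ne_top ENNReal.ofReal_ne_top (by simp)
  have h₁ : ∀ p, V * wt R c p ≤ ∫⁻ z, (3 ^ 100 * box2 L (T (p - z))) * wt R c z :=
    wt_le_average hα hσ hσ1 hR hL c
  have h₂ : ∀ p, ∫⁻ z, (decay 118 L (T (p - z)).1 * decay 118 L (T (p - z)).2) * wt R c z ≤
      (16 * 3 ^ 100 * V) * wt R c p := average_le_wt hα hσ hσ1 hR hL c
  have hF : Measurable fun p => ‖extC (piece σ i) g p‖ₑ ^ 6 :=
    (continuous_extC (hg.mono_set (piece_subset hi))).measurable.enorm.pow_const _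
  -- outside the range of summation the functions are irrelevant
  set G : ℕ → ℝ × ℝ → ℝ≥0∞ := fun j p =>
    if j < l then ‖extC (piece (n : ℝ)⁻¹ (i * l + j)) g p‖ₑ ^ 6 else 0 with hGd
  have hG : ∀ j, Measurable (G j) := by
    intro j
    by_cases hj : j < l
    · simp only [hGd, hj, if_true]
      exact (continuous_extC (hgn j hj)).measurable.enorm.pow_const _
    · simp only [hGd, hj, if_false]
      exact measurable_const
  have hdec : ∀ z, ∫⁻ p, ‖extC (piece σ i) g p‖ₑ ^ 6 * (3 ^ 100 * box2 L (T (p - z))) ≤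
      (3 ^ 100 * (impC * D (l : ℝ)⁻¹ ^ 6)) * (∑ j ∈ Finset.range l,
        (∫⁻ p, G j p * (decay 118 L (T (p - z)).1 * decay 118 L (T (p - z)).2)) ^
          (1 / 3 : ℝ)) ^ 3 := by
    intro z
    have e1 : ∀ j ∈ Finset.range l,
        (∫⁻ p, G j p * (decay 118 L (T (p - z)).1 * decay 118 L (T (p - z)).2)) ^ (1 / 3 : ℝ) =
        ENNReal.ofReal σ * intSix (fun q => decay 118 L (q - T z).1 * decay 118 L (q - T z).2)
          (extC (piece (l : ℝ)⁻¹ j) g') ^ (1 / 3 : ℝ) := by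
      intro j hj
      have hj := Finset.mem_range.1 hj
      simp only [hGd, hj, if_true]
      have := hgn j hj
      rw [hpn] at this ⊢
      rw [lintegral_extC_affine_mul hσ (by gcongr; linarith) this
        (w := fun q => decay 118 L q.1 * decay 118 L q.2) (by fun_prop),
        ENNReal.mul_rpow_of_nonneg _ _ (by norm_num), ← ENNReal.rpow_natCast, ← ENNReal.rpow_mul]
      norm_num
      rfl
    rw [Finset.sum_congr rfl e1, ← Finset.mul_sum, mul_pow]
    have e2 : ∀ p, ‖extC (piece σ i) g p‖ₑ ^ 6 * (3 ^ 100 * box2 L (T (p - z))) =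
        3 ^ 100 * (‖extC (piece σ i) g p‖ₑ ^ 6 * box2 L (T (p - z))) := fun p => by ring
    simp_rw [e2]
    rw [lintegral_const_mul _ (by fun_prop), hpk,
      lintegral_extC_affine_mul hσ zero_le_one hgk hbm]
    calc 3 ^ 100 * (ENNReal.ofReal σ ^ 3 *
          intSix (fun q => box2 L (q - para α σ z)) (extC (Icc 0 1) g'))
        ≤ 3 ^ 100 * (ENNReal.ofReal σ ^ 3 * (impC * D (l : ℝ)⁻¹ ^ 6 * (∑ j ∈ Finset.range l,
          intSix (fun q => decay 118 L (q - T z).1 * decay 118 L (q - T z).2)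
            (extC (piece (l : ℝ)⁻¹ j) g') ^ (1 / 3 : ℝ)) ^ 3)) := by
          gcongr
          exact decoupling_improved_translate hl hg'i (T z)
      _ = _ := by ring
  have main := averaging (Finset.range l) (k₁ := fun u => 3 ^ 100 * box2 L (T u))
    (k₂ := fun u => decay 118 L (T u).1 * decay 118 L (T u).2) (by fun_prop) (by fun_prop) hWm hF
    hG hdec h₁ h₂
  have e3 : ∀ j ∈ Finset.range l, (∫⁻ p, G j p * wt R c p) ^ (1 / 3 : ℝ) =
      intSix (wt R c) (extC (piece (n : ℝ)⁻¹ (i * l + j)) g) ^ (1 / 3 : ℝ) := by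
    intro j hj
    simp only [hGd, Finset.mem_range.1 hj, if_true, intSix]
  rw [Finset.sum_congr rfl e3] at main
  -- the area `V` of the parallelogram occurs on both sides and cancels
  rw [← ENNReal.mul_le_mul_iff_right hV0 hVt]
  refine main.trans (le_of_eq ?_)
  have e9 : (9 : ℝ≥0∞) ^ 100 = 3 ^ 100 * 3 ^ 100 := by
    rw [← mul_pow]; norm_num
  rw [resC, e9]
  ring

/-! ### Bounded functions integrated against the localisation -/

open scoped BoundedContinuousFunction

/-- The bounded continuous function `extC J g`. -/
noncomputable def extB (J : Set ℝ) (g : ℝ → ℂ) (hg : IntegrableOn g J volume) : ℝ × ℝ →ᵇ ℂ :=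
  .ofNormedAddCommGroup (extC J g) (continuous_extC hg) (∫ ξ in J, ‖g ξ‖) (norm_extC_le J g)

/-- The bounded continuous function `p ↦ e(ξ p₁ + ξ² p₂)`. -/
noncomputable def charB (ξ : ℝ) : ℝ × ℝ →ᵇ ℂ :=
  .ofNormedAddCommGroup (fun p => e (ξ * p.1 + ξ ^ 2 * p.2))
    (by have := continuous_e; fun_prop) 1 (fun _ => (norm_e _).le)

/-- The integral of a bounded function against `bump2 R`. -/
noncomputable def bumpInt (R : ℝ) (U : ℝ × ℝ →ᵇ ℂ) : ℂ := ∫ p, (bump2 R p : ℂ) * U p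

@[simp]
theorem extB_apply {J : Set ℝ} {g : ℝ → ℂ} (hg : IntegrableOn g J volume) (p : ℝ × ℝ) :
    extB J g hg p = extC J g p := rfl

theorem charB_apply (ξ : ℝ) (p : ℝ × ℝ) : charB ξ p = e (ξ * p.1 + ξ ^ 2 * p.2) := rfl

theorem star_e (a : ℝ) : star (e a) = e (-a) := by
  simp only [e, Complex.star_def, ← Complex.exp_conj, map_mul, Complex.conj_ofReal, Complex.conj_I,
    map_ofNat]
  congr 1
  push_cast
  ring

section BumpInt

variable {R : ℝ}

theorem integrable_bump2_mul (hR : 0 < R) (U : ℝ × ℝ →ᵇ ℂ) :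
    Integrable fun p => (bump2 R p : ℂ) * U p :=
  (integrable_bump2 hR).ofReal.mul_bdd (c := ‖U‖) U.continuous.aestronglyMeasurable
    (Filter.Eventually.of_forall fun p => U.norm_coe_le_norm p)

theorem bumpInt_sum (hR : 0 < R) {ι : Type*} (s : Finset ι) (U : ι → ℝ × ℝ →ᵇ ℂ) :
    bumpInt R (∑ i ∈ s, U i) = ∑ i ∈ s, bumpInt R (U i) := by
  unfold bumpInt
  rw [← integral_finsetSum _ fun i _ => integrable_bump2_mul hR (U i)]
  simp only [BoundedContinuousFunction.coe_sum, Finset.sum_apply, Finset.mul_sum]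

theorem bumpInt_star (U : ℝ × ℝ →ᵇ ℂ) : bumpInt R (star U) = star (bumpInt R U) := by
  unfold bumpInt
  rw [Complex.star_def, ← integral_conj]
  congr 1
  funext p
  simp

/-- An extension operator may be pulled out of the integral against `bump2 R`. -/
theorem bumpInt_extB_mul (hR : 0 < R) {J : Set ℝ} {g : ℝ → ℂ} (hg : IntegrableOn g J volume)
    (U : ℝ × ℝ →ᵇ ℂ) : bumpInt R (extB J g hg * U) = ∫ ξ in J, g ξ * bumpInt R (charB ξ * U) := by
  have hce := continuous_e
  have hK : Continuous (Function.uncurry fun (p : ℝ × ℝ) (ξ : ℝ) => charB ξ p) := by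
    simp only [charB_apply, Function.uncurry_def]
    fun_prop
  have := integral_mul_integral_swap (μ := volume) (ν := volume.restrict J)
    (f := fun p => (bump2 R p : ℂ) * U p) (g := g) (K := fun p ξ => charB ξ p) (C := 1)
    (integrable_bump2_mul hR U) hg hK.aestronglyMeasurable (fun p ξ => (norm_e _).le)
  calc bumpInt R (extB J g hg * U)
      = ∫ p, ((bump2 R p : ℂ) * U p) * ∫ ξ in J, g ξ * charB ξ p := by
        unfold bumpInt
        congr 1
        funext p
        rw [BoundedContinuousFunction.mul_apply, extB_apply, extC, mul_comm (∫ ξ in J, _), mul_assoc]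
        rfl
    _ = _ := by
        rw [this]
        congr 1
        funext ξ
        congr 1
        unfold bumpInt
        congr 1
        funext p
        rw [BoundedContinuousFunction.mul_apply]
        ring

theorem bumpInt_extB_mul_eq_zero (hR : 0 < R) {J : Set ℝ} (hJ : MeasurableSet J) {g : ℝ → ℂ}
    (hg : IntegrableOn g J volume) (U : ℝ × ℝ →ᵇ ℂ) (h : ∀ ξ ∈ J, bumpInt R (charB ξ * U) = 0) :
    bumpInt R (extB J g hg * U) = 0 := by
  rw [bumpInt_extB_mul hR, setIntegral_congr_fun (g := fun _ => 0) hJ, integral_zero]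
  intro ξ hξ
  simp only [h ξ hξ, mul_zero]

theorem bumpInt_star_extB_mul_eq_zero (hR : 0 < R) {J : Set ℝ} (hJ : MeasurableSet J) {g : ℝ → ℂ}
    (hg : IntegrableOn g J volume) (U : ℝ × ℝ →ᵇ ℂ) (h : ∀ ξ ∈ J, bumpInt R (star (charB ξ) * U) = 0) :
    bumpInt R (star (extB J g hg) * U) = 0 := by
  have h1 : star (extB J g hg) * U = star (extB J g hg * star U) := by
    rw [star_mul', star_star]
  rw [h1, bumpInt_star, bumpInt_extB_mul_eq_zero hR hJ, star_zero]
  intro ξ hξ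
  rw [← star_star (charB ξ * star U), star_mul', star_star, bumpInt_star, h ξ hξ, star_zero]

/-- The integral of six characters against `bump2 R` is a value of its Fourier transform. -/
theorem bumpInt_charB (hR : 0 < R) (ξ₁ ξ₂ η₁ η₂ η₃ η₄ : ℝ) :
    bumpInt R (charB ξ₁ * star (charB ξ₂) * charB η₁ * star (charB η₂) * charB η₃ *
      star (charB η₄)) = specAt R (-(ξ₁ - ξ₂ + η₁ - η₂ + η₃ - η₄)) *
        specAt R (-(ξ₁ ^ 2 - ξ₂ ^ 2 + η₁ ^ 2 - η₂ ^ 2 + η₃ ^ 2 - η₄ ^ 2)) := by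
  rw [← integral_bump2_mul_e hR, bumpInt]
  congr 1
  funext p
  simp only [BoundedContinuousFunction.mul_apply, BoundedContinuousFunction.star_apply, charB_apply,
    star_e, ← e_add]
  congr 2
  ring

/-- A six-fold product of extensions integrates to zero if no six frequencies are resonant. -/
theorem bumpInt_extB_eq_zero (hR : 0 < R) {J₁ J₂ J : Set ℝ} (hJ₁ : MeasurableSet J₁)
    (hJ₂ : MeasurableSet J₂) (hJ : MeasurableSet J) {g : ℝ → ℂ} (hg₁ : IntegrableOn g J₁ volume)
    (hg₂ : IntegrableOn g J₂ volume) (hg : IntegrableOn g J volume)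
    (h : ∀ ξ₁ ∈ J₁, ∀ ξ₂ ∈ J₂, ∀ η₁ ∈ J, ∀ η₂ ∈ J, ∀ η₃ ∈ J, ∀ η₄ ∈ J,
      1 / (4 * R) < |-(ξ₁ - ξ₂ + η₁ - η₂ + η₃ - η₄)| ∨
      1 / (4 * R) < |-(ξ₁ ^ 2 - ξ₂ ^ 2 + η₁ ^ 2 - η₂ ^ 2 + η₃ ^ 2 - η₄ ^ 2)|)
    {E₁ E₂ E : ℝ × ℝ →ᵇ ℂ} (hE₁ : E₁ = extB J₁ g hg₁) (hE₂ : E₂ = extB J₂ g hg₂)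
    (hE : E = extB J g hg) :
    bumpInt R (E₁ * star E₂ * (E * star E) ^ 2) = 0 := by
  have key : ∀ {A B : ℝ × ℝ →ᵇ ℂ}, A = B → bumpInt R B = 0 → bumpInt R A = 0 :=
    fun h h' => h ▸ h'
  have p₁ : ∀ U, (∀ ξ ∈ J₁, bumpInt R (charB ξ * U) = 0) → bumpInt R (E₁ * U) = 0 := fun U hU =>
    hE₁ ▸ bumpInt_extB_mul_eq_zero hR hJ₁ hg₁ U hU
  have p₂ : ∀ U, (∀ ξ ∈ J₂, bumpInt R (star (charB ξ) * U) = 0) → bumpInt R (star E₂ * U) = 0 :=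
    fun U hU => hE₂ ▸ bumpInt_star_extB_mul_eq_zero hR hJ₂ hg₂ U hU
  have p₃ : ∀ U, (∀ ξ ∈ J, bumpInt R (charB ξ * U) = 0) → bumpInt R (E * U) = 0 := fun U hU =>
    hE ▸ bumpInt_extB_mul_eq_zero hR hJ hg U hU
  have p₄ : ∀ U, (∀ ξ ∈ J, bumpInt R (star (charB ξ) * U) = 0) → bumpInt R (star E * U) = 0 :=
    fun U hU => hE ▸ bumpInt_star_extB_mul_eq_zero hR hJ hg U hU
  clear hE₁ hE₂ hE
  -- replace the six factors by characters, one at a time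
  refine key (by ring) (p₁ (star E₂ * (E * star E) ^ 2) fun ξ₁ h₁ => ?_)
  refine key (by ring) (p₂ (charB ξ₁ * (E * star E) ^ 2) fun ξ₂ h₂ => ?_)
  refine key (by ring) (p₃ (charB ξ₁ * star (charB ξ₂) * (E * star E ^ 2)) fun η₁ h₃ => ?_)
  refine key (by ring) (p₄ (charB ξ₁ * star (charB ξ₂) * charB η₁ * (E * star E)) fun η₂ h₄ => ?_)
  refine key (by ring)
    (p₃ (charB ξ₁ * star (charB ξ₂) * charB η₁ * star (charB η₂) * star E) fun η₃ h₅ => ?_)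
  refine key (by ring)
    (p₄ (charB ξ₁ * star (charB ξ₂) * charB η₁ * star (charB η₂) * charB η₃) fun η₄ h₆ => ?_)
  rw [mul_comm, bumpInt_charB hR]
  rcases h ξ₁ h₁ ξ₂ h₂ η₁ h₃ η₂ h₄ η₃ h₅ η₄ h₆ with h | h
  · rw [specAt_eq_zero hR h, zero_mul]
  · rw [specAt_eq_zero hR h, mul_zero]

/-- The integral of `|U|² |V|⁴` against `bump2 R`. -/
noncomputable def bumpNorm (R : ℝ) (V U : ℝ × ℝ →ᵇ ℂ) : ℝ :=
  ∫ p, bump2 R p * (‖U p‖ ^ 2 * ‖V p‖ ^ 4)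

theorem integrable_bumpNorm (hR : 0 < R) (V U : ℝ × ℝ →ᵇ ℂ) :
    Integrable fun p => bump2 R p * (‖U p‖ ^ 2 * ‖V p‖ ^ 4) := by
  refine (integrable_bump2 hR).mul_bdd (c := ‖U‖ ^ 2 * ‖V‖ ^ 4)
    (by fun_prop : Continuous fun p => ‖U p‖ ^ 2 * ‖V p‖ ^ 4).aestronglyMeasurable
    (Filter.Eventually.of_forall fun p => ?_)
  rw [Real.norm_of_nonneg (by positivity)]
  gcongr
  · exact U.norm_coe_le_norm p
  · exact V.norm_coe_le_norm p

theorem lintegral_eq_bumpNorm (hR : 0 < R) (V U : ℝ × ℝ →ᵇ ℂ) :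
    ∫⁻ p, (‖U p‖ₑ ^ 2 * ‖V p‖ₑ ^ 4) * ENNReal.ofReal (bump2 R p) =
      ENNReal.ofReal (bumpNorm R V U) := by
  rw [bumpNorm, ofReal_integral_eq_lintegral_ofReal (integrable_bumpNorm hR V U)
    (Filter.Eventually.of_forall fun p => mul_nonneg (bump2_nonneg R p) (by positivity))]
  refine lintegral_congr fun p => ?_
  rw [ENNReal.ofReal_mul (bump2_nonneg R p), ENNReal.ofReal_mul (by positivity),
    ENNReal.ofReal_pow (norm_nonneg _), ENNReal.ofReal_pow (norm_nonneg _), ofReal_norm,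
    ofReal_norm, mul_comm]

theorem re_bump2_mul_apply (R : ℝ) (V U U' : ℝ × ℝ →ᵇ ℂ) (p : ℝ × ℝ) :
    ((bump2 R p : ℂ) * (U * star U' * (V * star V) ^ 2 : ℝ × ℝ →ᵇ ℂ) p).re =
      bump2 R p * ((U p * star (U' p)).re * ‖V p‖ ^ 4) := by
  have h : ((V * star V) ^ 2 : ℝ × ℝ →ᵇ ℂ) p = ((‖V p‖ ^ 4 : ℝ) : ℂ) := by
    rw [pow_two, BoundedContinuousFunction.mul_apply, BoundedContinuousFunction.mul_apply,
      BoundedContinuousFunction.star_apply, Complex.star_def, Complex.mul_conj']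
    push_cast
    ring
  rw [BoundedContinuousFunction.mul_apply, h, BoundedContinuousFunction.mul_apply,
    BoundedContinuousFunction.star_apply]
  simp only [Complex.re_ofReal_mul, Complex.re_mul_ofReal]

theorem re_bumpInt (hR : 0 < R) (V U U' : ℝ × ℝ →ᵇ ℂ) :
    (bumpInt R (U * star U' * (V * star V) ^ 2)).re =
      ∫ p, bump2 R p * ((U p * star (U' p)).re * ‖V p‖ ^ 4) := by
  rw [bumpInt]
  refine (integral_re (𝕜 := ℂ) (integrable_bump2_mul hR _)).symm.trans ?_
  congr 1
  funext p
  exact re_bump2_mul_apply R V U U' p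

theorem re_bumpInt_self (hR : 0 < R) (V U : ℝ × ℝ →ᵇ ℂ) :
    (bumpInt R (U * star U * (V * star V) ^ 2)).re = bumpNorm R V U := by
  rw [re_bumpInt hR, bumpNorm]
  congr 1
  funext p
  rw [Complex.star_def, Complex.mul_conj', ← Complex.ofReal_pow, Complex.ofReal_re]

/-- The inequality `Re (U * conj U') ≤ (|U|² + |U'|²) / 2`, weighted by `|V|⁴` and `bump2 R`. -/
theorem re_bumpInt_le (hR : 0 < R) (V U U' : ℝ × ℝ →ᵇ ℂ) :
    (bumpInt R (U * star U' * (V * star V) ^ 2)).re ≤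
      1 / 2 * bumpNorm R V U + 1 / 2 * bumpNorm R V U' := by
  rw [bumpNorm, bumpNorm, ← integral_const_mul, ← integral_const_mul,
    ← integral_add ((integrable_bumpNorm hR V U).const_mul _)
      ((integrable_bumpNorm hR V U').const_mul _), re_bumpInt hR]
  refine integral_mono ?_ (((integrable_bumpNorm hR V U).const_mul _).add
    ((integrable_bumpNorm hR V U').const_mul _)) fun p => ?_
  · refine (integrable_bump2_mul hR (U * star U' * (V * star V) ^ 2)).re.congr
      (Filter.Eventually.of_forall fun p => ?_)
    exact re_bump2_mul_apply R V U U' p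
  · have h1 : (U p * star (U' p)).re ≤ 1 / 2 * ‖U p‖ ^ 2 + 1 / 2 * ‖U' p‖ ^ 2 := by
      have h2 := (Complex.re_le_norm (U p * star (U' p)))
      rw [norm_mul, norm_star] at h2
      nlinarith [sq_nonneg (‖U p‖ - ‖U' p‖)]
    have h3 : 0 ≤ bump2 R p * ‖V p‖ ^ 4 := mul_nonneg (bump2_nonneg R p) (by positivity)
    have := mul_le_mul_of_nonneg_left h1 h3
    simp only
    linarith

/-- **Almost orthogonality**: if the mixed terms with distant indices vanish, the square of a sum
is controlled by the sum of the squares. -/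
theorem lintegral_sum_sq_le (hR : 0 < R) (V : ℝ × ℝ →ᵇ ℂ) (f : ℕ → ℝ × ℝ →ᵇ ℂ) (s : Finset ℕ)
    (K : ℕ) (hK : ∀ j ∈ s, ∀ j' ∈ s, (j' + K ≤ j ∨ j + K ≤ j') →
      bumpInt R (f j * star (f j') * (V * star V) ^ 2) = 0) :
    ∫⁻ p, (‖∑ j ∈ s, f j p‖ₑ ^ 2 * ‖V p‖ₑ ^ 4) * ENNReal.ofReal (bump2 R p) ≤
      (2 * K : ℕ) * ∑ j ∈ s,
        ∫⁻ p, (‖f j p‖ₑ ^ 2 * ‖V p‖ₑ ^ 4) * ENNReal.ofReal (bump2 R p) := by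
  have h0 : ∀ U, 0 ≤ bumpNorm R V U := fun U =>
    integral_nonneg fun p => mul_nonneg (bump2_nonneg R p) (by positivity)
  simp_rw [lintegral_eq_bumpNorm hR V]
  rw [← ENNReal.ofReal_sum_of_nonneg fun j _ => h0 _, ← ENNReal.ofReal_natCast,
    ← ENNReal.ofReal_mul (by positivity)]
  have e1 : ∀ p, ∑ j ∈ s, f j p = (∑ j ∈ s, f j) p := fun p => by simp
  simp_rw [e1, lintegral_eq_bumpNorm hR V]
  refine ENNReal.ofReal_le_ofReal ?_
  rw [← re_bumpInt_self hR, star_sum, Finset.sum_mul_sum, Finset.sum_mul, bumpInt_sum hR,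
    Complex.re_sum]
  -- only pairs of indices at distance less than `K` contribute
  set near : ℕ → ℕ → Prop := fun j j' => j < j' + K ∧ j' < j + K with hnear
  have hcard : ∀ j, ((s.filter (near j)).card : ℝ) ≤ (2 * K : ℕ) := by
    intro j
    have : s.filter (near j) ⊆ Finset.Ico (j + 1 - K) (j + K) := by
      intro j' hj'
      have := (Finset.mem_filter.1 hj').2
      rw [Finset.mem_Ico]
      simp only [hnear] at this
      omega
    have := Finset.card_le_card this
    rw [Nat.card_Ico] at this
    exact_mod_cast (by omega : _ ≤ 2 * K)
  have hsymm : ∀ j j', near j j' ↔ near j' j := fun j j' => and_comm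
  have hswap : ∑ j ∈ s, ∑ j' ∈ s with near j j', bumpNorm R V (f j') =
      ∑ j ∈ s, ∑ j' ∈ s with near j j', bumpNorm R V (f j) := by
    simp_rw [Finset.sum_filter]
    rw [Finset.sum_comm]
    simp_rw [hsymm]
  calc ∑ j ∈ s, (bumpInt R ((∑ j' ∈ s, f j * star (f j')) * (V * star V) ^ 2)).re
      ≤ ∑ j ∈ s, ∑ j' ∈ s with near j j',
          (1 / 2 * bumpNorm R V (f j) + 1 / 2 * bumpNorm R V (f j')) := by
        refine Finset.sum_le_sum fun j hj => ?_
        rw [Finset.sum_mul, bumpInt_sum hR, Complex.re_sum, Finset.sum_filter]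
        refine Finset.sum_le_sum fun j' hj' => ?_
        split_ifs with h
        · exact re_bumpInt_le hR V _ _
        · rw [hK j hj j' hj' (by simp only [hnear] at h; omega), Complex.zero_re]
    _ = ∑ j ∈ s, ∑ j' ∈ s with near j j', bumpNorm R V (f j) := by
        simp_rw [Finset.sum_add_distrib, ← Finset.mul_sum]
        rw [hswap]
        ring
    _ = ∑ j ∈ s, ((s.filter (near j)).card : ℝ) * bumpNorm R V (f j) := by
        simp_rw [Finset.sum_const, nsmul_eq_mul]
    _ ≤ ∑ j ∈ s, ((2 * K : ℕ) : ℝ) * bumpNorm R V (f j) := by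
        gcongr with j hj
        · exact h0 _
        · exact_mod_cast hcard j
    _ = _ := by rw [← Finset.mul_sum]

end BumpInt

/-! ### Orthogonality of the pieces of an interval against a separated interval -/

open scoped BoundedContinuousFunction

/-- The sets `I` and `I'` lie on different sides of a gap of length `r`. -/
def Separated (r : ℝ) (I I' : Set ℝ) : Prop :=
  (∀ ξ ∈ I, ∀ η ∈ I', η + r ≤ ξ) ∨ ∀ ξ ∈ I, ∀ η ∈ I', ξ + r ≤ η

theorem Separated.symm {r : ℝ} {I I' : Set ℝ} (h : Separated r I I') : Separated r I' I :=
  Or.elim h (fun h => Or.inr fun ξ hξ η hη => h η hη ξ hξ)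
    fun h => Or.inl fun ξ hξ η hη => h η hη ξ hξ

theorem Separated.mono {r : ℝ} {I I' J : Set ℝ} (h : Separated r I I') (hJ : J ⊆ I) :
    Separated r J I' :=
  Or.imp (fun h ξ hξ => h ξ (hJ hξ)) (fun h ξ hξ => h ξ (hJ hξ)) h

/-- Six frequencies, of which four lie within `√h` of each other and at distance at least `1 / m`
from the remaining two, are not resonant if those two are further apart than about `2 m h`. -/
theorem not_resonant {m h ρ η₀ ξ₁ ξ₂ u₁ u₂ u₃ u₄ : ℝ} (hm : 3 ≤ m) (hh : 0 < h)
    (hρ : ρ ≤ h / 4) (hη₀ : 0 ≤ η₀) (hη₁ : η₀ ≤ 1)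
    (hs : (η₀ + m⁻¹ ≤ ξ₁ ∧ η₀ + m⁻¹ ≤ ξ₂) ∨ (ξ₁ + m⁻¹ ≤ η₀ ∧ ξ₂ + m⁻¹ ≤ η₀))
    (hd : (2 * m - 1) * h ≤ |ξ₁ - ξ₂|) (h₁ : u₁ ^ 2 ≤ h) (h₂ : u₂ ^ 2 ≤ h) (h₃ : u₃ ^ 2 ≤ h)
    (h₄ : u₄ ^ 2 ≤ h) :
    ρ < |-(ξ₁ - ξ₂ + (η₀ + u₁) - (η₀ + u₂) + (η₀ + u₃) - (η₀ + u₄))| ∨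
      ρ < |-(ξ₁ ^ 2 - ξ₂ ^ 2 + (η₀ + u₁) ^ 2 - (η₀ + u₂) ^ 2 + (η₀ + u₃) ^ 2 -
        (η₀ + u₄) ^ 2)| := by
  by_contra! hc
  obtain ⟨hc₁, hc₂⟩ := hc
  rw [abs_neg] at hc₁ hc₂
  have hm0 : (0 : ℝ) < m := by linarith
  -- The second combination minus `2 η₀` times the first is `(ξ₁ - ξ₂) (ξ₁ + ξ₂ - 2 η₀)` plus squares
  -- of the `uᵢ`: the terms linear in the `uᵢ` cancel. The gap makes the second factor at least `2 / m`.
  have hlow : 2 * m⁻¹ ≤ |ξ₁ + ξ₂ - 2 * η₀| := by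
    rcases hs with hs | hs
    · exact le_trans (by linarith) (le_abs_self _)
    · exact le_trans (by linarith) (neg_le_abs _)
  have hprod : (2 * m - 1) * h * (2 * m⁻¹) ≤ |(ξ₁ - ξ₂) * (ξ₁ + ξ₂ - 2 * η₀)| := by
    rw [abs_mul]
    exact mul_le_mul hd hlow (by positivity) (abs_nonneg _)
  have hup : |(ξ₁ - ξ₂) * (ξ₁ + ξ₂ - 2 * η₀)| ≤ 3 * ρ + 2 * h := by
    have hρ0 : 0 ≤ ρ := (abs_nonneg _).trans hc₁
    rw [abs_le] at hc₁ hc₂ ⊢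
    have a₁ := mul_le_mul_of_nonneg_left hc₁.1 hη₀
    have a₂ := mul_le_mul_of_nonneg_left hc₁.2 hη₀
    have a₃ : η₀ * ρ ≤ ρ := mul_le_of_le_one_left hρ0 hη₁
    have b₁ := sq_nonneg u₁
    have b₂ := sq_nonneg u₂
    have b₃ := sq_nonneg u₃
    have b₄ := sq_nonneg u₄
    constructor <;> nlinarith
  have h5 : (2 * m - 1) * h * (2 * m⁻¹) = (4 - 2 * m⁻¹) * h := by field_simp; ring
  have h6 : m⁻¹ ≤ 3⁻¹ := by gcongr
  have h7 : (4 - 2 * 3⁻¹) * h ≤ (4 - 2 * m⁻¹) * h := by gcongr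
  rw [h5] at hprod
  linarith

theorem mem_piece_sub {δ ξ : ℝ} {j : ℕ} (h : ξ ∈ piece δ j) : 0 ≤ ξ - j * δ ∧ ξ - j * δ ≤ δ :=
  ⟨by linarith [h.1], by linarith [h.2]⟩

theorem le_abs_sub_of_mem_piece {δ ξ₁ ξ₂ : ℝ} {j₁ j₂ m : ℕ} (hδ : 0 ≤ δ) (h₁ : ξ₁ ∈ piece δ j₁)
    (h₂ : ξ₂ ∈ piece δ j₂) (h : j₂ + 2 * m ≤ j₁ ∨ j₁ + 2 * m ≤ j₂) :
    (2 * m - 1) * δ ≤ |ξ₁ - ξ₂| := by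
  have a := mem_piece_sub h₁
  have b := mem_piece_sub h₂
  rcases h with h | h
  · have h' : (j₂ : ℝ) + 2 * m ≤ j₁ := by exact_mod_cast h
    have := mul_le_mul_of_nonneg_right h' hδ
    exact le_trans (by linarith) (le_abs_self _)
  · have h' : (j₁ : ℝ) + 2 * m ≤ j₂ := by exact_mod_cast h
    have := mul_le_mul_of_nonneg_right h' hδ
    exact le_trans (by linarith) (neg_le_abs _)

/-- Pieces of length `1 / M²` whose indices differ by at least `2 m` are orthogonal against the fourth
power of an interval of length `1 / M`: then `h = 1 / M²` in `not_resonant`, which is the square of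
the length of that interval. -/
theorem bumpInt_piece_eq_zero {m M n i' j₁ j₂ : ℕ} {I : Set ℝ} (hm : 3 ≤ m) (hM : 0 < M)
    (hMn : M ^ 2 ≤ n) (hi' : i' < M) (hI : Separated (m : ℝ)⁻¹ I (piece (M : ℝ)⁻¹ i'))
    (hj₁ : piece ((M ^ 2 : ℕ) : ℝ)⁻¹ j₁ ⊆ I) (hj₂ : piece ((M ^ 2 : ℕ) : ℝ)⁻¹ j₂ ⊆ I)
    (hj : j₂ + 2 * m ≤ j₁ ∨ j₁ + 2 * m ≤ j₂) {g : ℝ → ℂ}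
    (hg₁ : IntegrableOn g (piece ((M ^ 2 : ℕ) : ℝ)⁻¹ j₁) volume)
    (hg₂ : IntegrableOn g (piece ((M ^ 2 : ℕ) : ℝ)⁻¹ j₂) volume)
    (hg : IntegrableOn g (piece (M : ℝ)⁻¹ i') volume)
    {E₁ E₂ E : ℝ × ℝ →ᵇ ℂ} (hE₁ : E₁ = extB _ g hg₁) (hE₂ : E₂ = extB _ g hg₂)
    (hE : E = extB _ g hg) :
    bumpInt ((n : ℝ) ^ 2) (E₁ * star E₂ * (E * star E) ^ 2) = 0 := by
  have hM' : (1 : ℝ) ≤ M := by exact_mod_cast hM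
  have hn : (1 : ℝ) ≤ n := by exact_mod_cast (Nat.one_le_pow _ _ hM).trans hMn
  have hm' : (3 : ℝ) ≤ m := by exact_mod_cast hm
  have hmi : 0 < (m : ℝ)⁻¹ := by positivity
  refine bumpInt_extB_eq_zero (by positivity) measurableSet_Icc measurableSet_Icc measurableSet_Icc
    hg₁ hg₂ hg ?_ hE₁ hE₂ hE
  intro ξ₁ h₁ ξ₂ h₂ η₁ k₁ η₂ k₂ η₃ k₃ η₄ k₄
  set η₀ : ℝ := i' * (M : ℝ)⁻¹ with hη₀
  have hmem : η₀ ∈ piece (M : ℝ)⁻¹ i' :=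
    ⟨le_rfl, by rw [hη₀]; gcongr; linarith⟩
  have h01 := piece_subset hi' hmem
  have hsq : ∀ η ∈ piece (M : ℝ)⁻¹ i', (η - η₀) ^ 2 ≤ ((M ^ 2 : ℕ) : ℝ)⁻¹ := by
    intro η hη
    have := mem_piece_sub hη
    rw [Nat.cast_pow, ← inv_pow]
    exact pow_le_pow_left₀ this.1 this.2 2
  have hρ : 1 / (4 * (n : ℝ) ^ 2) ≤ ((M ^ 2 : ℕ) : ℝ)⁻¹ / 4 := by
    have h5 : ((M ^ 2 : ℕ) : ℝ) ≤ n := by exact_mod_cast hMn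
    have h6 : (n : ℝ) ≤ n ^ 2 := by nlinarith
    rw [one_div, mul_inv, div_eq_inv_mul]
    gcongr
    exact h5.trans h6
  have := not_resonant (u₁ := η₁ - η₀) (u₂ := η₂ - η₀) (u₃ := η₃ - η₀) (u₄ := η₄ - η₀) hm'
    (by positivity) hρ h01.1 h01.2 ?_ (le_abs_sub_of_mem_piece (by positivity) h₁ h₂ hj)
    (hsq _ k₁) (hsq _ k₂) (hsq _ k₃) (hsq _ k₄)
  · simpa only [add_sub_cancel] using this
  · rcases hI with hI | hI
    · exact Or.inl ⟨hI _ (hj₁ h₁) _ hmem, hI _ (hj₂ h₂) _ hmem⟩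
    · exact Or.inr ⟨hI _ (hj₁ h₁) _ hmem, hI _ (hj₂ h₂) _ hmem⟩

/-- The left endpoint of the `t`-th of the `L` pieces of the `i`-th interval of length `1 / k`. -/
theorem mul_inv_mul_mul {k L i t : ℕ} (hL : 0 < L) :
    ((i * L + t : ℕ) : ℝ) * ((k * L : ℕ) : ℝ)⁻¹ = (i + t * (L : ℝ)⁻¹) * (k : ℝ)⁻¹ := by
  have : (L : ℝ) * (L : ℝ)⁻¹ = 1 := mul_inv_cancel₀ (by positivity)
  push_cast
  rw [mul_inv]
  linear_combination (i : ℝ) * (k : ℝ)⁻¹ * this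

theorem piece_subset_piece {k L i t : ℕ} (hL : 0 < L) (ht : t < L) :
    piece ((k * L : ℕ) : ℝ)⁻¹ (i * L + t) ⊆ piece (k : ℝ)⁻¹ i := by
  have h1 := mul_inv_mul_mul (k := k) (i := i) (t := t) hL
  have h2 := mul_inv_mul_mul (k := k) (i := i) (t := t + 1) hL
  have hL' : (L : ℝ) * (L : ℝ)⁻¹ = 1 := mul_inv_cancel₀ (by positivity)
  have ht' : ((t + 1 : ℕ) : ℝ) ≤ L := by exact_mod_cast ht
  refine Icc_subset_Icc ?_ ?_
  · rw [h1]
    gcongr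
    exact le_add_of_nonneg_right (by positivity)
  · rw [← add_assoc, Nat.cast_add (i * L + t), Nat.cast_one] at h2
    rw [h2]
    gcongr
    rw [← hL']
    gcongr

/-- The extension operator of an interval is the sum over its pieces. -/
theorem extC_piece_eq_sum {k L i : ℕ} (hL : 0 < L) {g : ℝ → ℂ}
    (hg : IntegrableOn g (piece (k : ℝ)⁻¹ i) volume) (p : ℝ × ℝ) :
    extC (piece (k : ℝ)⁻¹ i) g p =
      ∑ t ∈ Finset.range L, extC (piece ((k * L : ℕ) : ℝ)⁻¹ (i * L + t)) g p := by
  set F : ℝ → ℂ := fun ξ => g ξ * e (ξ * p.1 + ξ ^ 2 * p.2) with hF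
  have hFi : IntegrableOn F (piece (k : ℝ)⁻¹ i) := integrableOn_char hg p
  set a : ℕ → ℝ := fun t => ((i * L + t : ℕ) : ℝ) * ((k * L : ℕ) : ℝ)⁻¹ with ha
  have hle : ∀ t, a t ≤ a (t + 1) := by
    intro t
    simp only [ha]
    gcongr
    omega
  have hp : ∀ t, piece ((k * L : ℕ) : ℝ)⁻¹ (i * L + t) = Icc (a t) (a (t + 1)) := by
    intro t
    simp only [piece, ha, ← add_assoc, Nat.cast_add (i * L + t), Nat.cast_one]
  have h0 : piece (k : ℝ)⁻¹ i = Icc (a 0) (a L) := by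
    simp only [ha, mul_inv_mul_mul hL, piece]
    rw [mul_inv_cancel₀ (by positivity)]
    simp
  have key := intervalIntegral.sum_integral_adjacent_intervals (μ := volume) (f := F) (a := a)
    (n := L) fun t ht => by
      rw [intervalIntegrable_iff_integrableOn_Ioc_of_le (hle t)]
      refine hFi.mono_set (Ioc_subset_Icc_self.trans ?_)
      rw [← hp]
      exact piece_subset_piece hL ht
  rw [intervalIntegral.integral_of_le (monotone_nat_of_le_succ hle (Nat.zero_le L)),
    ← integral_Icc_eq_integral_Ioc, ← h0] at key
  rw [extC, ← key]
  refine Finset.sum_congr rfl fun t _ => ?_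
  rw [intervalIntegral.integral_of_le (hle t), ← integral_Icc_eq_integral_Ioc, ← hp]
  rfl

/-- The mixed integral `∫ |E_J g|² |E_{J'} g|⁴ w`. -/
noncomputable def mixed (w : ℝ × ℝ → ℝ≥0∞) (g : ℝ → ℂ) (J J' : Set ℝ) : ℝ≥0∞ :=
  ∫⁻ p, (‖extC J g p‖ₑ ^ 2 * ‖extC J' g p‖ₑ ^ 4) * w p

/-- The constant of `mixed_le_sum_mixed`. -/
noncomputable def orthC : ℝ≥0∞ := 16 * 9 ^ 100 * 10 ^ 600

theorem decay_anti {j k : ℕ} (h : j ≤ k) {R : ℝ} (hR : 0 < R) (t : ℝ) :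
    decay k R t ≤ decay j R t := by
  refine ENNReal.ofReal_le_ofReal ?_
  gcongr
  have : 0 ≤ |t| / R := by positivity
  linarith

/-- Orthogonality against the localisation to the square around the origin. -/
theorem mixed_bump2_le {m M k L n i i' : ℕ} (hm : 3 ≤ m) (hM : 0 < M)
    (hMn : M ^ 2 ≤ n) (hkL : M ^ 2 = k * L) (hi : i < k) (hi' : i' < M)
    (hsep : Separated (m : ℝ)⁻¹ (piece (k : ℝ)⁻¹ i) (piece (M : ℝ)⁻¹ i'))
    {g : ℝ → ℂ} (hg : IntegrableOn g (Icc 0 1) volume) :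
    mixed (fun p => ENNReal.ofReal (bump2 ((n : ℝ) ^ 2) p)) g (piece (k : ℝ)⁻¹ i)
        (piece (M : ℝ)⁻¹ i') ≤
      (4 * m : ℕ) * ∑ t ∈ Finset.range L,
        mixed (fun p => ENNReal.ofReal (bump2 ((n : ℝ) ^ 2) p)) g
          (piece ((M ^ 2 : ℕ) : ℝ)⁻¹ (i * L + t)) (piece (M : ℝ)⁻¹ i') := by
  have hL : 0 < L := Nat.pos_of_ne_zero fun h => by
    rw [h, mul_zero] at hkL; exact (pow_pos hM 2).ne' hkL
  have hn : 0 < n := (pow_pos hM 2).trans_le hMn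
  have hgi : IntegrableOn g (piece (k : ℝ)⁻¹ i) := hg.mono_set (piece_subset hi)
  have hg' : IntegrableOn g (piece (M : ℝ)⁻¹ i') := hg.mono_set (piece_subset hi')
  have hsub : ∀ t, t < L → piece ((M ^ 2 : ℕ) : ℝ)⁻¹ (i * L + t) ⊆ piece (k : ℝ)⁻¹ i := by
    intro t ht
    rw [hkL]
    exact piece_subset_piece hL ht
  classical
  set f : ℕ → ℝ × ℝ →ᵇ ℂ := fun t => if ht : t < L then
    extB (piece ((M ^ 2 : ℕ) : ℝ)⁻¹ (i * L + t)) g (hgi.mono_set (hsub t ht)) else 0 with hf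
  have hft : ∀ t (ht : t < L), f t =
      extB (piece ((M ^ 2 : ℕ) : ℝ)⁻¹ (i * L + t)) g (hgi.mono_set (hsub t ht)) := by
    intro t ht
    simp only [hf, ht, dif_pos]
  have hfp : ∀ t ∈ Finset.range L, ∀ p,
      f t p = extC (piece ((M ^ 2 : ℕ) : ℝ)⁻¹ (i * L + t)) g p := by
    intro t ht p
    rw [hft t (Finset.mem_range.1 ht), extB_apply]
  have key := lintegral_sum_sq_le (R := (n : ℝ) ^ 2) (by positivity) (extB _ g hg') f
    (Finset.range L) (2 * m) ?_
  · have h1 : ∀ p, extC (piece (k : ℝ)⁻¹ i) g p = ∑ t ∈ Finset.range L, f t p := by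
      intro p
      rw [extC_piece_eq_sum hL hgi, ← hkL]
      exact Finset.sum_congr rfl fun t ht => (hfp t ht p).symm
    have h2 : ∀ t ∈ Finset.range L, mixed (fun p => ENNReal.ofReal (bump2 ((n : ℝ) ^ 2) p)) g
        (piece ((M ^ 2 : ℕ) : ℝ)⁻¹ (i * L + t)) (piece (M : ℝ)⁻¹ i') =
        ∫⁻ p, (‖f t p‖ₑ ^ 2 * ‖extB _ g hg' p‖ₑ ^ 4) *
          ENNReal.ofReal (bump2 ((n : ℝ) ^ 2) p) := by
      intro t ht
      simp only [mixed, hfp t ht, extB_apply]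
    rw [Finset.sum_congr rfl h2, show 4 * m = 2 * (2 * m) by ring]
    simp only [mixed, h1]
    exact key
  · intro t ht t' ht' h
    have ht := Finset.mem_range.1 ht
    have ht' := Finset.mem_range.1 ht'
    exact bumpInt_piece_eq_zero hm hM hMn hi' hsep (hsub t ht) (hsub t' ht') (by omega)
      (hgi.mono_set (hsub t ht)) (hgi.mono_set (hsub t' ht')) hg' (hft t ht) (hft t' ht') rfl

/-- Translating the weight amounts to modulating `g`. -/
theorem mixed_translate (w : ℝ × ℝ → ℝ≥0∞) (g : ℝ → ℂ) (z : ℝ × ℝ) (J J' : Set ℝ) :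
    mixed (fun p => w (p - z)) g J J' =
      mixed w (fun ξ => g ξ * e (ξ * z.1 + ξ ^ 2 * z.2)) J J' := by
  simp only [mixed, extC_modulate]
  rw [← lintegral_sub_right_eq_self
    (fun p => ‖extC J g (p + z)‖ₑ ^ 2 * ‖extC J' g (p + z)‖ₑ ^ 4 * w p) z]
  simp only [sub_add_cancel]

/-- Orthogonality localised to the square around an arbitrary point. -/
theorem mixed_box2_le {m M k L n i i' : ℕ} (hm : 3 ≤ m) (hM : 0 < M)
    (hMn : M ^ 2 ≤ n) (hkL : M ^ 2 = k * L) (hi : i < k) (hi' : i' < M)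
    (hsep : Separated (m : ℝ)⁻¹ (piece (k : ℝ)⁻¹ i) (piece (M : ℝ)⁻¹ i'))
    {g : ℝ → ℂ} (hg : IntegrableOn g (Icc 0 1) volume)
    {R : ℝ} (hRd : R = (n : ℝ) ^ 2) (z : ℝ × ℝ) :
    mixed (fun p => box2 R (p - z)) g (piece (k : ℝ)⁻¹ i) (piece (M : ℝ)⁻¹ i') ≤
      (4 * m : ℕ) * 10 ^ 600 * ∑ t ∈ Finset.range L,
        mixed (fun p => decay 118 R (p - z).1 * decay 118 R (p - z).2) g
          (piece ((M ^ 2 : ℕ) : ℝ)⁻¹ (i * L + t)) (piece (M : ℝ)⁻¹ i') := by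
  have hn : 0 < n := (pow_pos hM 2).trans_le hMn
  have hR : 0 < R := by rw [hRd]; positivity
  calc mixed (fun p => box2 R (p - z)) g (piece (k : ℝ)⁻¹ i) (piece (M : ℝ)⁻¹ i')
      ≤ mixed (fun p => ENNReal.ofReal (bump2 R (p - z))) g (piece (k : ℝ)⁻¹ i)
          (piece (M : ℝ)⁻¹ i') := lintegral_mono fun p => mul_le_mul_right (box2_le_bump2 hR _) _
    _ = mixed (fun p => ENNReal.ofReal (bump2 R p))
          (fun ξ => g ξ * e (ξ * z.1 + ξ ^ 2 * z.2)) (piece (k : ℝ)⁻¹ i)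
            (piece (M : ℝ)⁻¹ i') :=
        mixed_translate (fun p => ENNReal.ofReal (bump2 R p)) g z _ _
    _ ≤ (4 * m : ℕ) * ∑ t ∈ Finset.range L,
          mixed (fun p => ENNReal.ofReal (bump2 R p))
            (fun ξ => g ξ * e (ξ * z.1 + ξ ^ 2 * z.2))
            (piece ((M ^ 2 : ℕ) : ℝ)⁻¹ (i * L + t)) (piece (M : ℝ)⁻¹ i') := by
        rw [hRd]
        exact mixed_bump2_le hm hM hMn hkL hi hi' hsep (integrableOn_char hg z)
    _ ≤ (4 * m : ℕ) * ∑ t ∈ Finset.range L, 10 ^ 600 *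
          mixed (fun p => decay 118 R p.1 * decay 118 R p.2)
            (fun ξ => g ξ * e (ξ * z.1 + ξ ^ 2 * z.2))
            (piece ((M ^ 2 : ℕ) : ℝ)⁻¹ (i * L + t)) (piece (M : ℝ)⁻¹ i') := by
        gcongr with t ht
        rw [mixed, mixed, ← lintegral_const_mul' _ _ (by simp)]
        refine lintegral_mono fun p => ?_
        rw [mul_left_comm]
        refine mul_le_mul_right ((bump2_le hR p).trans ?_) _
        gcongr <;> exact decay_anti (by norm_num) hR _
    _ = _ := by
        simp only [mixed_translate (fun p => decay 118 R p.1 * decay 118 R p.2)]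
        rw [← Finset.mul_sum, mul_assoc]

/-- **Orthogonality**: in `∫ |E_I g|² |E_{I'} g|⁴`, where `I'` has length `1 / M`, the interval `I`
may be replaced by its pieces of length `1 / M²`. -/
theorem mixed_le_sum_mixed {m M k L n i i' : ℕ} (hm : 3 ≤ m) (hM : 0 < M)
    (hMn : M ^ 2 ≤ n) (hkL : M ^ 2 = k * L) (hi : i < k) (hi' : i' < M)
    (hsep : Separated (m : ℝ)⁻¹ (piece (k : ℝ)⁻¹ i) (piece (M : ℝ)⁻¹ i'))
    {g : ℝ → ℂ} (hg : IntegrableOn g (Icc 0 1) volume)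
    (c : ℝ × ℝ) :
    mixed (wt ((n : ℝ) ^ 2) c) g (piece (k : ℝ)⁻¹ i) (piece (M : ℝ)⁻¹ i') ≤
      orthC * (4 * m : ℕ) * ∑ t ∈ Finset.range L,
        mixed (wt ((n : ℝ) ^ 2) c) g (piece ((M ^ 2 : ℕ) : ℝ)⁻¹ (i * L + t))
          (piece (M : ℝ)⁻¹ i') := by
  have hn : 0 < n := (pow_pos hM 2).trans_le hMn
  obtain ⟨R, hRd⟩ : ∃ R : ℝ, R = (n : ℝ) ^ 2 := ⟨_, rfl⟩
  rw [← hRd]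
  have hR : 0 < R := by rw [hRd]; positivity
  have hL : 0 < L := Nat.pos_of_ne_zero fun h => by
    rw [h, mul_zero] at hkL; exact (pow_pos hM 2).ne' hkL
  have hpi : ∀ J : Set ℝ, J ⊆ Icc 0 1 → Measurable fun p => ‖extC J g p‖ₑ := fun J hJ =>
    (continuous_extC (hg.mono_set hJ)).measurable.enorm
  have hI := hpi _ (piece_subset hi)
  have hI' := hpi _ (piece_subset hi')
  have hJ : ∀ t, t < L →
      Measurable fun p => ‖extC (piece ((M ^ 2 : ℕ) : ℝ)⁻¹ (i * L + t)) g p‖ₑ := by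
    intro t ht
    refine hpi _ (Subset.trans ?_ (piece_subset hi))
    rw [hkL]
    exact piece_subset_piece hL ht
  have hWm := measurable_wt R c
  have hbm := measurable_box2 R
  have hdm := measurable_decay 118 R
  set G : ℝ × ℝ → ℝ≥0∞ := fun p => ∑ t ∈ Finset.range L,
    ‖extC (piece ((M ^ 2 : ℕ) : ℝ)⁻¹ (i * L + t)) g p‖ₑ ^ 2 *
      ‖extC (piece (M : ℝ)⁻¹ i') g p‖ₑ ^ 4 with hG
  have hGm : Measurable G := Finset.measurable_fun_sum _ fun t ht => by
    have := hJ t (Finset.mem_range.1 ht)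
    fun_prop
  have hGw : ∀ w : ℝ × ℝ → ℝ≥0∞, Measurable w → ∑ t ∈ Finset.range L,
      mixed w g (piece ((M ^ 2 : ℕ) : ℝ)⁻¹ (i * L + t)) (piece (M : ℝ)⁻¹ i') =
        ∫⁻ p, G p * w p := by
    intro w hw
    simp only [mixed, hG, Finset.sum_mul]
    rw [lintegral_finsetSum' _ fun t ht => ?_]
    have := hJ t (Finset.mem_range.1 ht)
    exact Measurable.aemeasurable (by fun_prop)
  have hloc : ∀ z, ∫⁻ p, (‖extC (piece (k : ℝ)⁻¹ i) g p‖ₑ ^ 2 *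
        ‖extC (piece (M : ℝ)⁻¹ i') g p‖ₑ ^ 4) * (3 ^ 100 * box2 R (para 0 1 (p - z))) ≤
      (3 ^ 100 * ((4 * m : ℕ) * 10 ^ 600)) * ∫⁻ p, G p *
        (decay 118 R (para 0 1 (p - z)).1 * decay 118 R (para 0 1 (p - z)).2) := by
    intro z
    have hpara : ∀ p : ℝ × ℝ, para 0 1 p = p := fun p => by simp [para]
    simp only [hpara]
    have hdz : Measurable fun p : ℝ × ℝ => decay 118 R (p - z).1 * decay 118 R (p - z).2 := by
      fun_prop
    rw [← hGw _ hdz]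
    simp only [mul_left_comm _ ((3 : ℝ≥0∞) ^ 100)]
    rw [lintegral_const_mul' _ _ (by simp), mul_assoc]
    exact mul_le_mul_right (mixed_box2_le hm hM hMn hkL hi hi' hsep hg hRd z) _
  -- the square itself is the parallelogram with `α = 0`, `σ = 1`
  have h0 : (0 : ℝ) ∈ Icc (0 : ℝ) 1 := ⟨le_rfl, zero_le_one⟩
  have hRR : R = 1 ^ 2 * R := by ring
  obtain ⟨V, hV⟩ : ∃ V, ∫⁻ u, box2 R (para 0 1 u) = V := ⟨_, rfl⟩
  have hVeq : V = ENNReal.ofReal R ^ 2 := by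
    rw [← hV, ← lintegral_box2]
    simp [para]
  have hV0 : V ≠ 0 := by
    rw [hVeq]
    exact pow_ne_zero _ (ENNReal.ofReal_pos.2 hR).ne'
  have hVt : V ≠ ∞ := by rw [hVeq]; simp
  have hpm : Measurable (para 0 1) := (continuous_para 0 1).measurable
  have h₁ := wt_le_average h0 one_pos le_rfl hR hRR c
  have h₂ := average_le_wt h0 one_pos le_rfl hR hRR c
  rw [hV] at h₁ h₂
  have hk₁ : Measurable fun u => 3 ^ 100 * box2 R (para 0 1 u) := by fun_prop
  have hk₂ : Measurable fun u =>
      decay 118 R (para 0 1 u).1 * decay 118 R (para 0 1 u).2 := by fun_prop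
  have hFm : Measurable fun p =>
      ‖extC (piece (k : ℝ)⁻¹ i) g p‖ₑ ^ 2 * ‖extC (piece (M : ℝ)⁻¹ i') g p‖ₑ ^ 4 :=
    (hI.pow_const 2).mul (hI'.pow_const 4)
  have hone : ∀ x : ℝ≥0∞, (∑ _ ∈ Finset.range 1, x ^ (1 / 3 : ℝ)) ^ 3 = x := fun x => by
    rw [Finset.sum_range_one, ← ENNReal.rpow_natCast, ← ENNReal.rpow_mul]
    norm_num
  have main := averaging (Finset.range 1) hk₁ hk₂ hWm hFm (fun _ => hGm)
    (fun z => (hloc z).trans_eq (by rw [hone])) h₁ h₂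
  rw [hone, ← hGw _ hWm] at main
  rw [← ENNReal.mul_le_mul_iff_right hV0 hVt]
  refine main.trans (le_of_eq ?_)
  have e9 : (9 : ℝ≥0∞) ^ 100 = 3 ^ 100 * 3 ^ 100 := by
    rw [← mul_pow]; norm_num
  rw [orthC, e9]
  ring

/-! ### The bilinear iteration -/

/-- Hölder's inequality with a weight. -/
theorem lintegral_mul_mul_le {p q : ℝ} (hpq : p.HolderConjugate q) {f h w : ℝ × ℝ → ℝ≥0∞}
    (hf : Measurable f) (hh : Measurable h) (hw : Measurable w) :
    ∫⁻ x, f x * h x * w x ≤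
      (∫⁻ x, f x ^ p * w x) ^ (1 / p) * (∫⁻ x, h x ^ q * w x) ^ (1 / q) := by
  have key := ENNReal.lintegral_mul_le_Lp_mul_Lq (volume.withDensity w) hpq hf.aemeasurable
    hh.aemeasurable
  rw [lintegral_withDensity_eq_lintegral_mul _ hw (hf.mul hh),
    lintegral_withDensity_eq_lintegral_mul _ hw (hf.pow_const p),
    lintegral_withDensity_eq_lintegral_mul _ hw (hh.pow_const q)] at key
  simpa only [Pi.mul_apply, mul_comm (w _)] using key

theorem holderConjugate_two : (2 : ℝ).HolderConjugate 2 := by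
  rw [Real.holderConjugate_iff]; norm_num

section Mixed

variable {w : ℝ × ℝ → ℝ≥0∞} {g : ℝ → ℂ} {J J' : Set ℝ}

/-- Cauchy–Schwarz, from `|E|² |E'|⁴ = (|E|² |E'|) |E'|³`. -/
theorem mixed_le_mixed_mul_intSix (hw : Measurable w) (hJ : IntegrableOn g J volume)
    (hJ' : IntegrableOn g J' volume) :
    mixed w g J J' ≤ (mixed w g J' J) ^ (1 / 2 : ℝ) * intSix w (extC J' g) ^ (1 / 2 : ℝ) := by
  have h1 := (continuous_extC hJ).measurable.enorm
  have h2 := (continuous_extC hJ').measurable.enorm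
  have key := lintegral_mul_mul_le holderConjugate_two
    (f := fun p => ‖extC J g p‖ₑ ^ 2 * ‖extC J' g p‖ₑ) (h := fun p => ‖extC J' g p‖ₑ ^ 3)
    ((h1.pow_const 2).mul h2) (h2.pow_const 3) hw
  refine Eq.trans_le (lintegral_congr fun p => ?_) (key.trans_eq ?_)
  · ring
  · congr 1 <;> congr 1 <;> refine lintegral_congr fun x => ?_
    all_goals
      simp only [ENNReal.rpow_ofNat]
      ring

theorem mixed_le_intSix (hw : Measurable w) (hJ : IntegrableOn g J volume)
    (hJ' : IntegrableOn g J' volume) :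
    mixed w g J J' ≤ intSix w (extC J g) ^ (1 / 3 : ℝ) * intSix w (extC J' g) ^ (2 / 3 : ℝ) := by
  have h1 := (continuous_extC hJ).measurable.enorm
  have h2 := (continuous_extC hJ').measurable.enorm
  have hpq : (3 : ℝ).HolderConjugate (3 / 2) := by
    rw [Real.holderConjugate_iff]; norm_num
  have key := lintegral_mul_mul_le hpq (h1.pow_const 2) (h2.pow_const 4) hw
  have e1 : ∀ x : ℝ≥0∞, (x ^ 4) ^ (3 / 2 : ℝ) = x ^ 6 := fun x => by
    rw [← ENNReal.rpow_natCast, ← ENNReal.rpow_mul]; norm_num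
  have e2 : ∀ x : ℝ≥0∞, (x ^ 2) ^ (3 : ℝ) = x ^ 6 := fun x => by
    rw [← ENNReal.rpow_natCast, ← ENNReal.rpow_mul]; norm_num
  simp only [e1, e2, one_div_div] at key
  exact key

theorem lintegral_cube_mul_cube_le_mixed (hw : Measurable w) (hJ : IntegrableOn g J volume)
    (hJ' : IntegrableOn g J' volume) :
    ∫⁻ p, ‖extC J g p‖ₑ ^ 3 * ‖extC J' g p‖ₑ ^ 3 * w p ≤
      (mixed w g J J') ^ (1 / 2 : ℝ) * (mixed w g J' J) ^ (1 / 2 : ℝ) := by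
  have h1 := (continuous_extC hJ).measurable.enorm
  have h2 := (continuous_extC hJ').measurable.enorm
  have key := lintegral_mul_mul_le holderConjugate_two
    (f := fun p => ‖extC J g p‖ₑ * ‖extC J' g p‖ₑ ^ 2)
    (h := fun p => ‖extC J' g p‖ₑ * ‖extC J g p‖ₑ ^ 2) (h1.mul (h2.pow_const 2))
    (h2.mul (h1.pow_const 2)) hw
  refine Eq.trans_le (lintegral_congr fun p => ?_) (key.trans_eq ?_)
  · ring
  · congr 1 <;> congr 1 <;> refine lintegral_congr fun x => ?_
    all_goals
      simp only [ENNReal.rpow_ofNat]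
      ring

theorem lintegral_cube_mul_cube_le_intSix (hw : Measurable w) (hJ : IntegrableOn g J volume)
    (hJ' : IntegrableOn g J' volume) :
    ∫⁻ p, ‖extC J g p‖ₑ ^ 3 * ‖extC J' g p‖ₑ ^ 3 * w p ≤
      intSix w (extC J g) ^ (1 / 2 : ℝ) * intSix w (extC J' g) ^ (1 / 2 : ℝ) := by
  have h1 := (continuous_extC hJ).measurable.enorm
  have h2 := (continuous_extC hJ').measurable.enorm
  have key := lintegral_mul_mul_le holderConjugate_two (h1.pow_const 3) (h2.pow_const 3) hw
  have e1 : ∀ x : ℝ≥0∞, (x ^ 3) ^ (2 : ℝ) = x ^ 6 := fun x => by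
    rw [← ENNReal.rpow_natCast, ← ENNReal.rpow_mul]; norm_num
  simp only [e1] at key
  exact key

end Mixed

/-- The sum of `‖E_J g‖²_{L⁶(w_B)}` over the `i`-th block of `l` consecutive intervals `J` of length
`1 / n`, where `B` has side length `n²`. -/
noncomputable def blockSum (n : ℕ) (c : ℝ × ℝ) (g : ℝ → ℂ) (l i : ℕ) : ℝ≥0∞ :=
  ∑ j ∈ Finset.range l,
    intSix (wt ((n : ℝ) ^ 2) c) (extC (piece (n : ℝ)⁻¹ (i * l + j)) g) ^ (1 / 3 : ℝ)

/-- A block of `L l` intervals is made up of `L` blocks of `l` intervals. -/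
theorem blockSum_mul (n : ℕ) (c : ℝ × ℝ) (g : ℝ → ℂ) (L l i : ℕ) :
    ∑ t ∈ Finset.range L, blockSum n c g l (i * L + t) = blockSum n c g (L * l) i := by
  have key : ∀ (f : ℕ → ℝ≥0∞) (L : ℕ), ∑ t ∈ Finset.range L, ∑ j ∈ Finset.range l, f (t * l + j) =
      ∑ j ∈ Finset.range (L * l), f j := by
    intro f L
    induction L with
    | zero => simp
    | succ L ih => rw [Finset.sum_range_succ, ih, add_mul, one_mul, Finset.sum_range_add]
  unfold blockSum
  rw [← key (fun j => intSix (wt ((n : ℝ) ^ 2) c) (extC (piece (n : ℝ)⁻¹ (i * (L * l) + j)) g) ^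
    (1 / 3 : ℝ))]
  refine Finset.sum_congr rfl fun t _ => Finset.sum_congr rfl fun j _ => ?_
  rw [show (i * L + t) * l + j = i * (L * l) + (t * l + j) by ring]

/-- The bilinear estimate `∫ |E_I g|² |E_{I'} g|⁴ w_B ≤ X S_I S_{I'}²` for separated intervals `I`
and `I'` of lengths `m⁻ᵃ` and `m⁻ᵇ`, where `S` denotes the sum of `‖E_J g‖²_{L⁶(w_B)}` over
intervals `J` of length `m⁻ᵀ`. -/
def MixedBound (m T : ℕ) (c : ℝ × ℝ) (g : ℝ → ℂ) (a b : ℕ) (X : ℝ≥0∞) : Prop :=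
  ∀ i < m ^ a, ∀ i' < m ^ b,
    Separated (m : ℝ)⁻¹ (piece ((m ^ a : ℕ) : ℝ)⁻¹ i) (piece ((m ^ b : ℕ) : ℝ)⁻¹ i') →
    mixed (wt (((m ^ T : ℕ) : ℝ) ^ 2) c) g (piece ((m ^ a : ℕ) : ℝ)⁻¹ i)
        (piece ((m ^ b : ℕ) : ℝ)⁻¹ i') ≤
      X * (blockSum (m ^ T) c g (m ^ (T - a)) i * blockSum (m ^ T) c g (m ^ (T - b)) i' ^ 2)

section Iteration

variable {m T a b : ℕ} {c : ℝ × ℝ} {g : ℝ → ℂ} {X : ℝ≥0∞}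

/-- Parabolic rescaling in terms of block sums. -/
theorem intSix_piece_le (hm : 0 < m) (ha : a ≤ T) (hg : IntegrableOn g (Icc 0 1) volume)
    {i : ℕ} (hi : i < m ^ a) :
    intSix (wt (((m ^ T : ℕ) : ℝ) ^ 2) c) (extC (piece ((m ^ a : ℕ) : ℝ)⁻¹ i) g) ≤
      resC * D ((m ^ (T - a) : ℕ) : ℝ)⁻¹ ^ 6 * blockSum (m ^ T) c g (m ^ (T - a)) i ^ 3 :=
  rescaling (pow_pos hm _) (pow_pos hm _) (by rw [← pow_add, Nat.add_sub_cancel' ha]) hi hg c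

/-- The starting point of the iteration. -/
theorem mixedBound_base (hm : 0 < m) (ha : a ≤ T) (hb : b ≤ T)
    (hg : IntegrableOn g (Icc 0 1) volume) :
    MixedBound m T c g a b
      (resC * D ((m ^ (T - a) : ℕ) : ℝ)⁻¹ ^ 2 * D ((m ^ (T - b) : ℕ) : ℝ)⁻¹ ^ 4) := by
  intro i hi i' hi' _
  refine (mixed_le_intSix (measurable_wt _ _) (hg.mono_set (piece_subset hi))
    (hg.mono_set (piece_subset hi'))).trans ?_
  have h1 := ENNReal.rpow_le_rpow (intSix_piece_le (c := c) hm ha hg hi)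
    (show (0 : ℝ) ≤ 1 / 3 by norm_num)
  have h2 := ENNReal.rpow_le_rpow (intSix_piece_le (c := c) hm hb hg hi')
    (show (0 : ℝ) ≤ 2 / 3 by norm_num)
  refine (mul_le_mul' h1 h2).trans (le_of_eq ?_)
  have e1 : ∀ x : ℝ≥0∞, x ^ (1 / 3 : ℝ) * x ^ (2 / 3 : ℝ) = x := fun x => by
    rw [← ENNReal.rpow_add_of_nonneg _ _ (by norm_num) (by norm_num)]; norm_num
  have e2 : ∀ x : ℝ≥0∞, (x ^ 6) ^ (1 / 3 : ℝ) = x ^ 2 := fun x => by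
    rw [← ENNReal.rpow_natCast, ← ENNReal.rpow_mul]; norm_num
  have e3 : ∀ x : ℝ≥0∞, (x ^ 6) ^ (2 / 3 : ℝ) = x ^ 4 := fun x => by
    rw [← ENNReal.rpow_natCast, ← ENNReal.rpow_mul]; norm_num
  have e4 : ∀ x : ℝ≥0∞, (x ^ 3) ^ (1 / 3 : ℝ) = x := fun x => by
    rw [← ENNReal.rpow_natCast, ← ENNReal.rpow_mul]; norm_num
  have e5 : ∀ x : ℝ≥0∞, (x ^ 3) ^ (2 / 3 : ℝ) = x ^ 2 := fun x => by
    rw [← ENNReal.rpow_natCast, ← ENNReal.rpow_mul]; norm_num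
  simp only [ENNReal.mul_rpow_of_nonneg _ _ (show (0 : ℝ) ≤ 1 / 3 by norm_num),
    ENNReal.mul_rpow_of_nonneg _ _ (show (0 : ℝ) ≤ 2 / 3 by norm_num), e2, e3, e4, e5]
  nth_rewrite 3 [← e1 resC]
  ring

/-- By the Cauchy–Schwarz inequality the roles of the exponents `2` and `4` may be exchanged. -/
theorem MixedBound.swap (hm : 0 < m) (ha : a ≤ T) (hg : IntegrableOn g (Icc 0 1) volume)
    (h : MixedBound m T c g a b X) :
    MixedBound m T c g b a
      ((X * (resC * D ((m ^ (T - a) : ℕ) : ℝ)⁻¹ ^ 6)) ^ (1 / 2 : ℝ)) := by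
  intro i hi i' hi' hs
  refine (mixed_le_mixed_mul_intSix (measurable_wt _ _) (hg.mono_set (piece_subset hi))
    (hg.mono_set (piece_subset hi'))).trans ?_
  rw [← ENNReal.mul_rpow_of_nonneg _ _ (by norm_num)]
  have e1 : ∀ x : ℝ≥0∞, (x ^ 2) ^ (1 / 2 : ℝ) = x := fun x => by
    rw [← ENNReal.rpow_natCast, ← ENNReal.rpow_mul]; norm_num
  rw [← e1 (blockSum (m ^ T) c g (m ^ (T - b)) i * blockSum (m ^ T) c g (m ^ (T - a)) i' ^ 2),
    ← ENNReal.mul_rpow_of_nonneg _ _ (by norm_num)]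
  refine ENNReal.rpow_le_rpow ?_ (by norm_num)
  refine (mul_le_mul' (h i' hi' i hi hs.symm) (intSix_piece_le hm ha hg hi')).trans (le_of_eq ?_)
  ring

/-- Orthogonality coarsens the first interval. -/
theorem MixedBound.coarsen (hm : 3 ≤ m) (hab : a ≤ 2 * b) (hb : 2 * b ≤ T)
    (hg : IntegrableOn g (Icc 0 1) volume) (h : MixedBound m T c g (2 * b) b X) :
    MixedBound m T c g a b (orthC * (4 * m : ℕ) * X) := by
  intro i hi i' hi' hs
  have hm0 : 0 < m := by omega
  have hbT : (m ^ b) ^ 2 = m ^ (2 * b) := by rw [← pow_mul, mul_comm]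
  have hk : (m ^ b) ^ 2 = m ^ a * m ^ (2 * b - a) := by
    rw [hbT, ← pow_add, Nat.add_sub_cancel' hab]
  have key := mixed_le_sum_mixed hm (pow_pos hm0 b)
    (n := m ^ T) (by rw [hbT]; exact Nat.pow_le_pow_right hm0 hb) hk hi hi' hs hg c
  rw [hbT] at key hk
  refine key.trans ?_
  have hTa : m ^ (T - a) = m ^ (2 * b - a) * m ^ (T - 2 * b) := by
    rw [← pow_add]; congr 1; omega
  rw [hTa, ← blockSum_mul, mul_assoc _ X]
  refine mul_le_mul_right ?_ _
  rw [Finset.sum_mul, Finset.mul_sum]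
  refine Finset.sum_le_sum fun t ht => ?_
  have ht := Finset.mem_range.1 ht
  refine h _ ?_ i' hi' (hs.mono ?_)
  · rw [hk]
    calc i * m ^ (2 * b - a) + t < i * m ^ (2 * b - a) + m ^ (2 * b - a) := by omega
      _ = (i + 1) * m ^ (2 * b - a) := by ring
      _ ≤ _ := Nat.mul_le_mul_right _ hi
  · rw [hk]
    exact piece_subset_piece (pow_pos hm0 _) ht

end Iteration

/-- The constant of one step of the iteration. -/
noncomputable def iterC : ℝ≥0∞ := 4 * orthC * resC ^ (1 / 2 : ℝ)

section Iteration

variable {m T a b : ℕ} {c : ℝ × ℝ} {g : ℝ → ℂ} {X : ℝ≥0∞}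

/-- One step of the iteration. -/
theorem MixedBound.step (hm : 3 ≤ m) (hab : a ≤ 2 * b) (hb : 2 * b ≤ T)
    (hg : IntegrableOn g (Icc 0 1) volume) (h : MixedBound m T c g b (2 * b) X) :
    MixedBound m T c g a b
      (iterC * m * D ((m ^ (T - b) : ℕ) : ℝ)⁻¹ ^ (3 : ℝ) * X ^ (1 / 2 : ℝ)) := by
  have key := (h.swap (by omega) (by omega) hg).coarsen hm hab hb hg
  have e1 : ∀ x : ℝ≥0∞, (x ^ 6) ^ (1 / 2 : ℝ) = x ^ (3 : ℝ) := fun x => by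
    rw [← ENNReal.rpow_natCast, ← ENNReal.rpow_mul]; norm_num
  rw [ENNReal.mul_rpow_of_nonneg _ _ (by norm_num), ENNReal.mul_rpow_of_nonneg _ _ (by norm_num),
    e1] at key
  convert key using 1
  rw [iterC]
  push_cast
  ring

/-- The iteration from the scales `2ᵏ`, `2ᵏ⁺¹` down to the scales `1`, `1`. -/
theorem MixedBound.iterate (hm : 3 ≤ m) (hg : IntegrableOn g (Icc 0 1) volume) (k : ℕ)
    (hk : 2 ^ (k + 1) ≤ T) (X : ℝ≥0∞) (h : MixedBound m T c g (2 ^ k) (2 ^ (k + 1)) X) :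
    MixedBound m T c g 1 1 ((iterC * m) ^ (2 - 1 / 2 ^ k : ℝ) *
      (∏ j ∈ Finset.range (k + 1), D ((m ^ (T - 2 ^ j) : ℕ) : ℝ)⁻¹ ^ (3 / 2 ^ j : ℝ)) *
        X ^ (1 / 2 ^ (k + 1) : ℝ)) := by
  induction k generalizing X with
  | zero =>
    have := MixedBound.step (a := 1) (b := 1) hm (by norm_num) hk hg h
    norm_num at this ⊢
    exact this
  | succ k ih =>
    have h2 : 2 ^ (k + 1) ≤ T := le_trans (Nat.pow_le_pow_right (by norm_num) (by omega)) hk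
    rw [pow_succ' 2 (k + 1)] at h hk
    have := ih h2 _ (h.step (a := 2 ^ k) (b := 2 ^ (k + 1)) hm (by rw [pow_succ']; omega) hk hg)
    convert this using 1
    have hp : (0 : ℝ) ≤ 1 / 2 ^ (k + 1) := by positivity
    have hk1 : (1 : ℝ) / 2 ^ k ≤ 1 := by
      rw [div_le_one (by positivity)]; exact one_le_pow₀ (by norm_num)
    rw [Finset.prod_range_succ _ (k + 1), ENNReal.mul_rpow_of_nonneg _ _ hp,
      ENNReal.mul_rpow_of_nonneg _ _ hp, ← ENNReal.rpow_mul, ← ENNReal.rpow_mul]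
    -- the exponents of one step, raised to the power `1 / 2ᵏ⁺¹`, add up geometrically
    have e1 : (2 - 1 / 2 ^ (k + 1) : ℝ) = (2 - 1 / 2 ^ k) + 1 / 2 ^ (k + 1) := by
      rw [pow_succ]; field_simp; ring
    have e2 : (3 * (1 / 2 ^ (k + 1)) : ℝ) = 3 / 2 ^ (k + 1) := by ring
    have e3 : (1 / 2 * (1 / 2 ^ (k + 1)) : ℝ) = 1 / 2 ^ (k + 1 + 1) := by
      rw [pow_succ _ (k + 1)]; field_simp
    rw [e1, e2, e3, ENNReal.rpow_add_of_nonneg _ _ (by linarith) hp]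
    ring

end Iteration

/-! ### From the bilinear to the linear estimate -/

/-- A weak form of the inequality between geometric and arithmetic means. -/
theorem rpow_half_mul_rpow_half_le (x y : ℝ≥0∞) : x ^ (1 / 2 : ℝ) * y ^ (1 / 2 : ℝ) ≤ x + y := by
  have e1 : ∀ x : ℝ≥0∞, x ^ (1 / 2 : ℝ) * x ^ (1 / 2 : ℝ) = x := fun x => by
    rw [← ENNReal.rpow_add_of_nonneg _ _ (by norm_num) (by norm_num)]; norm_num
  rcases le_total x y with h | h
  · calc x ^ (1 / 2 : ℝ) * y ^ (1 / 2 : ℝ) ≤ y ^ (1 / 2 : ℝ) * y ^ (1 / 2 : ℝ) := by gcongr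
      _ = y := e1 y
      _ ≤ x + y := le_add_self
  · calc x ^ (1 / 2 : ℝ) * y ^ (1 / 2 : ℝ) ≤ x ^ (1 / 2 : ℝ) * x ^ (1 / 2 : ℝ) := by gcongr
      _ = x := e1 x
      _ ≤ x + y := le_self_add

theorem separated_piece {m i i' : ℕ} (h : i + 2 ≤ i' ∨ i' + 2 ≤ i) :
    Separated (m : ℝ)⁻¹ (piece (m : ℝ)⁻¹ i) (piece (m : ℝ)⁻¹ i') := by
  have hm : (0 : ℝ) ≤ (m : ℝ)⁻¹ := by positivity
  have key : ∀ {i i' : ℕ}, i + 2 ≤ i' → ∀ ξ ∈ piece (m : ℝ)⁻¹ i, ∀ η ∈ piece (m : ℝ)⁻¹ i',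
      ξ + (m : ℝ)⁻¹ ≤ η := by
    intro i i' h ξ hξ η hη
    have h' : (i : ℝ) + 2 ≤ i' := by exact_mod_cast h
    have := mul_le_mul_of_nonneg_right h' hm
    linarith [hξ.2, hη.1]
  rcases h with h | h
  · exact Or.inr (key h)
  · exact Or.inl fun ξ hξ η hη => key h η hη ξ hξ

/-- Each interval has at most three neighbours, itself included. -/
theorem sum_near_le (m : ℕ) (S : ℕ → ℝ≥0∞) :
    ∑ i ∈ Finset.range m, ∑ i' ∈ Finset.range m with i' ≤ i + 1 ∧ i ≤ i' + 1, (S i + S i') ≤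
      6 * ∑ i ∈ Finset.range m, S i := by
  have hcard : ∀ i, (((Finset.range m).filter fun i' => i' ≤ i + 1 ∧ i ≤ i' + 1).card : ℝ≥0∞) ≤
      3 := by
    intro i
    have : (Finset.range m).filter (fun i' => i' ≤ i + 1 ∧ i ≤ i' + 1) ⊆
        Finset.Ico (i - 1) (i + 2) := by
      intro i' h
      have := (Finset.mem_filter.1 h).2
      rw [Finset.mem_Ico]
      omega
    have := Finset.card_le_card this
    rw [Nat.card_Ico] at this
    exact_mod_cast (by omega : _ ≤ 3)
  have hswap : ∑ i ∈ Finset.range m, ∑ i' ∈ Finset.range m with i' ≤ i + 1 ∧ i ≤ i' + 1, S i' =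
      ∑ i ∈ Finset.range m, ∑ i' ∈ Finset.range m with i' ≤ i + 1 ∧ i ≤ i' + 1, S i := by
    simp_rw [Finset.sum_filter]
    rw [Finset.sum_comm]
    simp_rw [and_comm]
  simp_rw [Finset.sum_add_distrib]
  rw [hswap, ← two_mul]
  simp_rw [Finset.sum_const, nsmul_eq_mul]
  calc 2 * ∑ i ∈ Finset.range m,
        (((Finset.range m).filter fun i' => i' ≤ i + 1 ∧ i ≤ i' + 1).card : ℝ≥0∞) * S i
      ≤ 2 * ∑ i ∈ Finset.range m, 3 * S i := by
        gcongr with i hi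
        exact hcard i
    _ = _ := by rw [← Finset.mul_sum, ← mul_assoc]; norm_num

/-- The bilinear estimate at the coarsest scale, together with decoupling at a larger scale for the
contributions of neighbouring intervals, yields a linear estimate. -/
theorem intSix_le_of_mixedBound {m T : ℕ} (hm : 0 < m) (hT : 1 ≤ T) {c : ℝ × ℝ} {g : ℝ → ℂ}
    (hg : IntegrableOn g (Icc 0 1) volume) {Y : ℝ≥0∞} (hY : MixedBound m T c g 1 1 Y) :
    intSix (wt (((m ^ T : ℕ) : ℝ) ^ 2) c) (extC (Icc 0 1) g) ≤
      ((6 * (resC ^ (1 / 3 : ℝ) * D ((m ^ (T - 1) : ℕ) : ℝ)⁻¹ ^ 2) + 2 * m * Y ^ (1 / 3 : ℝ)) *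
        ∑ i ∈ Finset.range (m ^ T), intSix (wt (((m ^ T : ℕ) : ℝ) ^ 2) c)
          (extC (piece ((m ^ T : ℕ) : ℝ)⁻¹ i) g) ^ (1 / 3 : ℝ)) ^ 3 := by
  set W := wt (((m ^ T : ℕ) : ℝ) ^ 2) c with hW
  have hWm : Measurable W := measurable_wt _ _
  set S : ℕ → ℝ≥0∞ := blockSum (m ^ T) c g (m ^ (T - 1)) with hS
  set α : ℝ≥0∞ := resC ^ (1 / 3 : ℝ) * D ((m ^ (T - 1) : ℕ) : ℝ)⁻¹ ^ 2 with hα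
  have hSsum : ∑ i ∈ Finset.range (m ^ T), intSix W
      (extC (piece ((m ^ T : ℕ) : ℝ)⁻¹ i) g) ^ (1 / 3 : ℝ) = ∑ i ∈ Finset.range m, S i := by
    have := blockSum_mul (m ^ T) c g m (m ^ (T - 1)) 0
    rw [← pow_succ', Nat.sub_add_cancel hT] at this
    simp only [zero_mul, zero_add] at this
    rw [hS, this]
    simp [blockSum, hW]
  rw [hSsum]
  have hgi : ∀ i ∈ Finset.range m, IntegrableOn g (piece (m : ℝ)⁻¹ i) volume := fun i hi =>
    hg.mono_set (piece_subset (Finset.mem_range.1 hi))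
  have hE : ∀ i ∈ Finset.range m, Measurable fun p => ‖extC (piece (m : ℝ)⁻¹ i) g p‖ₑ :=
    fun i hi => (continuous_extC (hgi i hi)).measurable.enorm
  have r1 : ∀ x : ℝ≥0∞, (x ^ 6) ^ (1 / 3 : ℝ) = x ^ 2 := fun x => by
    rw [← ENNReal.rpow_natCast, ← ENNReal.rpow_mul]; norm_num
  have r2 : ∀ x : ℝ≥0∞, (x ^ 3) ^ (1 / 3 : ℝ) = x := fun x => by
    rw [← ENNReal.rpow_natCast, ← ENNReal.rpow_mul]; norm_num
  have r3 : ∀ x : ℝ≥0∞, (x ^ (1 / 3 : ℝ)) ^ 3 = x := fun x => by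
    rw [← ENNReal.rpow_natCast, ← ENNReal.rpow_mul]; norm_num
  -- contributions of neighbouring intervals
  have hA : ∀ i ∈ Finset.range m,
      intSix W (extC (piece (m : ℝ)⁻¹ i) g) ^ (1 / 3 : ℝ) ≤ α * S i := by
    intro i hi
    have := intSix_piece_le (c := c) hm hT hg (i := i) (by simpa using hi)
    rw [pow_one] at this
    refine (ENNReal.rpow_le_rpow this (by norm_num)).trans (le_of_eq ?_)
    rw [ENNReal.mul_rpow_of_nonneg _ _ (by norm_num), ENNReal.mul_rpow_of_nonneg _ _ (by norm_num),
      r1, r2]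
  set f : ℕ × ℕ → ℝ × ℝ → ℝ≥0∞ := fun q p => ‖extC (piece (m : ℝ)⁻¹ q.1) g p‖ₑ ^ 3 *
    ‖extC (piece (m : ℝ)⁻¹ q.2) g p‖ₑ ^ 3 * W p with hf
  have hnear : ∀ i ∈ Finset.range m, ∀ i' ∈ Finset.range m,
      (∫⁻ p, f (i, i') p) ^ (1 / 3 : ℝ) ≤ α * (S i + S i') := by
    intro i hi i' hi'
    have := lintegral_cube_mul_cube_le_intSix hWm (hgi i hi) (hgi i' hi')
    refine (ENNReal.rpow_le_rpow this (by norm_num)).trans ?_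
    rw [ENNReal.mul_rpow_of_nonneg _ _ (by norm_num), ← ENNReal.rpow_mul, ← ENNReal.rpow_mul,
      mul_comm (1 / 2 : ℝ), ENNReal.rpow_mul, ENNReal.rpow_mul, mul_add]
    exact (rpow_half_mul_rpow_half_le _ _).trans (add_le_add (hA i hi) (hA i' hi'))
  -- contributions of separated intervals, where the bilinear estimate is used in both orders
  have hfar : ∀ i ∈ Finset.range m, ∀ i' ∈ Finset.range m, (i + 2 ≤ i' ∨ i' + 2 ≤ i) →
      (∫⁻ p, f (i, i') p) ^ (1 / 3 : ℝ) ≤ Y ^ (1 / 3 : ℝ) * (S i + S i') := by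
    intro i hi i' hi' h
    have h1 := hY i (by simpa using hi) i' (by simpa using hi') (by simpa using separated_piece h)
    have h2 := hY i' (by simpa using hi') i (by simpa using hi)
      (by simpa using separated_piece h.symm)
    rw [pow_one] at h1 h2
    have := lintegral_cube_mul_cube_le_mixed hWm (hgi i hi) (hgi i' hi')
    have h3 := this.trans (mul_le_mul' (ENNReal.rpow_le_rpow h1 (by norm_num))
      (ENNReal.rpow_le_rpow h2 (by norm_num)))
    refine (ENNReal.rpow_le_rpow h3 (by norm_num)).trans ?_
    rw [← ENNReal.mul_rpow_of_nonneg _ _ (by norm_num), ← ENNReal.rpow_mul,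
      mul_comm (1 / 2 : ℝ), ENNReal.rpow_mul]
    have e1 : Y * (S i * S i' ^ 2) * (Y * (S i' * S i ^ 2)) = Y ^ 2 * (S i ^ 3 * S i' ^ 3) := by
      ring
    rw [e1, ENNReal.mul_rpow_of_nonneg _ _ (by norm_num : (0 : ℝ) ≤ 1 / 3),
      ENNReal.mul_rpow_of_nonneg _ _ (by norm_num : (0 : ℝ) ≤ 1 / 3), r2, r2,
      ENNReal.mul_rpow_of_nonneg _ _ (by norm_num : (0 : ℝ) ≤ 1 / 2),
      ENNReal.mul_rpow_of_nonneg _ _ (by norm_num : (0 : ℝ) ≤ 1 / 2)]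
    have e2 : ((Y ^ 2) ^ (1 / 3 : ℝ)) ^ (1 / 2 : ℝ) = Y ^ (1 / 3 : ℝ) := by
      rw [← ENNReal.rpow_natCast, ← ENNReal.rpow_mul, ← ENNReal.rpow_mul]; norm_num
    rw [e2]
    gcongr
    exact rpow_half_mul_rpow_half_le _ _
  -- for the separated pairs, `S i + S i'` is summed over all pairs, which gives the factor `2 * m`
  have hsum : ∑ q ∈ Finset.range m ×ˢ Finset.range m, (∫⁻ p, f q p) ^ (1 / 3 : ℝ) ≤
      (6 * α + 2 * m * Y ^ (1 / 3 : ℝ)) * ∑ i ∈ Finset.range m, S i := by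
    rw [Finset.sum_product]
    calc ∑ i ∈ Finset.range m, ∑ i' ∈ Finset.range m, (∫⁻ p, f (i, i') p) ^ (1 / 3 : ℝ)
        ≤ ∑ i ∈ Finset.range m, ∑ i' ∈ Finset.range m,
            ((if i' ≤ i + 1 ∧ i ≤ i' + 1 then α * (S i + S i') else 0) +
              Y ^ (1 / 3 : ℝ) * (S i + S i')) := by
          refine Finset.sum_le_sum fun i hi => Finset.sum_le_sum fun i' hi' => ?_
          split_ifs with h
          · exact (hnear i hi i' hi').trans le_self_add
          · exact (hfar i hi i' hi' (by omega)).trans le_add_self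
      _ = α * ∑ i ∈ Finset.range m, ∑ i' ∈ Finset.range m with i' ≤ i + 1 ∧ i ≤ i' + 1,
            (S i + S i') + Y ^ (1 / 3 : ℝ) * (2 * m * ∑ i ∈ Finset.range m, S i) := by
          simp_rw [Finset.sum_add_distrib, ← Finset.sum_filter, ← Finset.mul_sum,
            Finset.sum_add_distrib, Finset.sum_const, ← Finset.smul_sum, nsmul_eq_mul,
            Finset.card_range]
          ring
      _ ≤ α * (6 * ∑ i ∈ Finset.range m, S i) +
            Y ^ (1 / 3 : ℝ) * (2 * m * ∑ i ∈ Finset.range m, S i) := by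
          gcongr
          exact sum_near_le m S
      _ = _ := by ring
  -- Minkowski in `L³` for `|E g|² ≤ ∑ |E_i g| |E_{i'} g|`
  refine le_trans ?_ (pow_le_pow_left' hsum 3)
  refine le_trans ?_ (lintegral_sum_rpow_third_pow_le _ _ fun q hq => ?_)
  · refine lintegral_mono fun p => ?_
    have h1 : ‖extC (Icc 0 1) g p‖ₑ ≤ ∑ i ∈ Finset.range m, ‖extC (piece (m : ℝ)⁻¹ i) g p‖ₑ := by
      rw [extC_eq_sum hm hg]
      exact enorm_sum_le _ _
    have h2 : ∀ q : ℕ × ℕ, f q p ^ (1 / 3 : ℝ) = ‖extC (piece (m : ℝ)⁻¹ q.1) g p‖ₑ *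
        ‖extC (piece (m : ℝ)⁻¹ q.2) g p‖ₑ * W p ^ (1 / 3 : ℝ) := fun q => by
      simp only [hf]
      rw [ENNReal.mul_rpow_of_nonneg _ _ (by norm_num), ENNReal.mul_rpow_of_nonneg _ _ (by norm_num),
        r2, r2]
    simp_rw [h2]
    rw [← Finset.sum_mul, mul_pow, r3, Finset.sum_product]
    dsimp only
    rw [← Finset.sum_mul_sum, ← pow_two, ← pow_mul]
    gcongr
  · rw [Finset.mem_product] at hq
    have h1 := hE q.1 hq.1
    have h2 := hE q.2 hq.2
    exact (((h1.pow_const 3).mul (h2.pow_const 3)).mul hWm).aemeasurable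

theorem wt_self (R : ℝ) (c : ℝ × ℝ) : wt R c c = 1 := by
  simp [wt, weight]

/-- The weight is bounded below on its square. -/
theorem box2_le_wt {R : ℝ} (hR : 0 < R) (c p : ℝ × ℝ) : box2 R (p - c) ≤ 2 ^ 100 * wt R c p := by
  by_cases hp : p - c ∈ {p : ℝ × ℝ | |p.1| ≤ R / 2 ∧ |p.2| ≤ R / 2}
  · have hb : box2 R (p - c) = 1 := by simp only [box2]; rw [indicator_of_mem hp]
    rw [hb, ← wt_self R c]
    refine (wt_le_mul hR c c p).trans ?_
    gcongr
    have h1 : |c.1 - p.1| ≤ R / 2 := by rw [abs_sub_comm]; exact hp.1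
    have h2 : |c.2 - p.2| ≤ R / 2 := by rw [abs_sub_comm]; exact hp.2
    have h3 : (|c.1 - p.1| + |c.2 - p.2|) / R ≤ 1 := by rw [div_le_one hR]; linarith
    exact (ENNReal.ofReal_le_ofReal (show _ ≤ (2 : ℝ) by linarith)).trans (by simp)
  · simp only [box2]
    rw [indicator_of_notMem hp]
    exact zero_le

theorem intSix_box2_le {R : ℝ} (hR : 0 < R) (c : ℝ × ℝ) (f : ℝ × ℝ → ℂ) :
    intSix (fun p => box2 R (p - c)) f ≤ 2 ^ 100 * intSix (wt R c) f := by
  rw [intSix, intSix, ← lintegral_const_mul' _ _ (by simp)]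
  refine lintegral_mono fun p => ?_
  rw [mul_left_comm]
  exact mul_le_mul_right (box2_le_wt hR c p) _

/-- For `δ = 1` only the change from the indicator function to the weight is paid for. -/
theorem D_one_le : D ((1 : ℕ) : ℝ)⁻¹ ≤ 2 ^ 17 := by
  refine sInf_le ((isDecouplingBound_iff 1 _).2 fun g _ c => ?_)
  refine (intSix_box2_le (by norm_num) c _).trans ?_
  have h1 : piece (((1 : ℕ) : ℝ)⁻¹) 0 = Icc 0 1 := by simp [piece]
  rw [Finset.sum_range_one, h1, ← ENNReal.rpow_natCast (_ ^ (1 / 3 : ℝ)), ← ENNReal.rpow_mul]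
  norm_num
  gcongr
  norm_num

/-- The linear consequence of a bilinear estimate which is uniform in `g` and in the square. -/
theorem D_le_of_mixedBound {m T : ℕ} (hm : 0 < m) (hT : 1 ≤ T) {Y : ℝ≥0∞}
    (hY : ∀ g : ℝ → ℂ, IntegrableOn g (Icc 0 1) volume → ∀ c, MixedBound m T c g 1 1 Y) :
    D ((m ^ T : ℕ) : ℝ)⁻¹ ≤ 2 ^ 17 *
      (6 * (resC ^ (1 / 3 : ℝ) * D ((m ^ (T - 1) : ℕ) : ℝ)⁻¹ ^ 2) +
        2 * m * Y ^ (1 / 3 : ℝ)) ^ (1 / 2 : ℝ) := by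
  refine sInf_le ((isDecouplingBound_iff _ _).2 fun g hg c => ?_)
  have hn : (0 : ℝ) < ((m ^ T : ℕ) : ℝ) ^ 2 := by positivity
  refine (intSix_box2_le hn c _).trans ?_
  refine (mul_le_mul_right (intSix_le_of_mixedBound hm hT hg (hY g hg c)) _).trans ?_
  rw [mul_pow, mul_pow, ← mul_assoc]
  have e1 : ∀ x : ℝ≥0∞, (x ^ (1 / 2 : ℝ)) ^ 6 = x ^ 3 := fun x => by
    rw [← ENNReal.rpow_natCast, ← ENNReal.rpow_mul, ← ENNReal.rpow_natCast]; norm_num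
  -- `100 / 6 < 17`
  have e2 : (2 : ℝ≥0∞) ^ 100 ≤ (2 ^ 17) ^ 6 := by
    rw [← pow_mul]
    exact pow_le_pow_right₀ one_le_two (by norm_num)
  rw [e1]
  exact mul_le_mul_left (mul_le_mul_left e2 _) _

/-! ### Constants and exponents -/

theorem one_le_resC : 1 ≤ resC := by
  rw [resC, impC, convC]
  exact_mod_cast (by positivity : 0 < 16 * 9 ^ 100 * (3 * 10 ^ 6 * (192 * 10 ^ 600) ^ 6))

theorem resC_le : resC ≤ 10 ^ 3800 := by
  have h1 : (192 * 10 ^ 600 : ℝ≥0∞) ≤ 10 ^ 603 := by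
    rw [show 603 = 3 + 600 from rfl, pow_add]
    gcongr
    norm_num
  have h2 : (16 : ℝ≥0∞) * 9 ^ 100 ≤ 10 ^ 102 := by
    rw [show 102 = 2 + 100 from rfl, pow_add]
    gcongr <;> norm_num
  have h3 : (3 * 10 ^ 6 : ℝ≥0∞) ≤ 10 ^ 7 := by norm_num
  rw [resC, impC, convC]
  calc (16 : ℝ≥0∞) * 9 ^ 100 * (3 * 10 ^ 6 * (192 * 10 ^ 600) ^ 6)
      ≤ 10 ^ 102 * (10 ^ 7 * (10 ^ 603) ^ 6) := by gcongr
    _ = 10 ^ 3727 := by rw [← pow_mul, ← pow_add, ← pow_add]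
    _ ≤ _ := pow_le_pow_right₀ (by norm_num) (by norm_num)

theorem one_le_orthC : 1 ≤ orthC := by
  rw [orthC]
  exact_mod_cast (by positivity : 0 < 16 * 9 ^ 100 * 10 ^ 600)

theorem orthC_le : orthC ≤ 10 ^ 702 := by
  have h2 : (16 : ℝ≥0∞) * 9 ^ 100 ≤ 10 ^ 102 := by
    rw [show 102 = 2 + 100 from rfl, pow_add]
    gcongr <;> norm_num
  rw [orthC, show 702 = 102 + 600 from rfl, pow_add]
  gcongr

theorem rpow_le_self_of_one_le {x : ℝ≥0∞} (hx : 1 ≤ x) {r : ℝ} (hr : r ≤ 1) : x ^ r ≤ x := by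
  calc x ^ r ≤ x ^ (1 : ℝ) := ENNReal.rpow_le_rpow_of_exponent_le hx hr
    _ = x := ENNReal.rpow_one x

theorem one_le_iterC : 1 ≤ iterC := by
  rw [iterC]
  refine one_le_mul (one_le_mul (by norm_num) one_le_orthC) ?_
  exact ENNReal.one_le_rpow one_le_resC (by norm_num)

theorem iterC_le : iterC ≤ 10 ^ 4503 := by
  rw [iterC]
  calc 4 * orthC * resC ^ (1 / 2 : ℝ) ≤ 10 ^ 1 * 10 ^ 702 * 10 ^ 3800 := by
        gcongr
        · norm_num
        · exact orthC_le
        · exact (rpow_le_self_of_one_le one_le_resC (by norm_num)).trans resC_le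
    _ = _ := by rw [← pow_add, ← pow_add]

/-- The bilinear estimate at the coarsest scale. -/
theorem mixedBound_one {m N : ℕ} (hm : 3 ≤ m) (hN : 1 ≤ N) {g : ℝ → ℂ}
    (hg : IntegrableOn g (Icc 0 1) volume) (c : ℝ × ℝ) :
    MixedBound m (2 ^ N) c g 1 1 ((iterC * m) ^ (2 - 1 / 2 ^ (N - 1) : ℝ) *
      (∏ j ∈ Finset.range N, D ((m ^ (2 ^ N - 2 ^ j) : ℕ) : ℝ)⁻¹ ^ (3 / 2 ^ j : ℝ)) *
        (resC * D ((m ^ (2 ^ N - 2 ^ (N - 1)) : ℕ) : ℝ)⁻¹ ^ 2 *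
          D ((1 : ℕ) : ℝ)⁻¹ ^ 4) ^ (1 / 2 ^ N : ℝ)) := by
  obtain ⟨k, rfl⟩ : ∃ k, N = k + 1 := ⟨N - 1, by omega⟩
  have hk : 2 ^ k ≤ 2 ^ (k + 1) := Nat.pow_le_pow_right (by norm_num) (by omega)
  have base := mixedBound_base (c := c) (a := 2 ^ k) (b := 2 ^ (k + 1)) (by omega : 0 < m) hk le_rfl
    hg
  have := base.iterate hm hg k le_rfl
  simpa only [Nat.sub_self, pow_zero, Nat.add_sub_cancel] using this

/-- The recursive inequality at integer scales. -/
theorem D_le_recursive {m N : ℕ} (hm : 3 ≤ m) (hN : 1 ≤ N) :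
    D ((m ^ 2 ^ N : ℕ) : ℝ)⁻¹ ≤ 10 ^ (10 ^ 5) *
      (D ((m ^ (2 ^ N - 1) : ℕ) : ℝ)⁻¹ + (m : ℝ≥0∞) ^ (4 / 3 : ℝ) *
        D ((m ^ (2 ^ N - 2 ^ (N - 1)) : ℕ) : ℝ)⁻¹ ^ (1 / (3 * 2 ^ N) : ℝ) *
        ∏ j ∈ Finset.range N, D ((m ^ (2 ^ N - 2 ^ j) : ℕ) : ℝ)⁻¹ ^ (1 / 2 ^ (j + 1) : ℝ)) := by
  have hm1 : (1 : ℝ≥0∞) ≤ m := by exact_mod_cast (by omega : 1 ≤ m)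
  refine (D_le_of_mixedBound (by omega : 0 < m) Nat.one_le_two_pow
    fun g hg c => mixedBound_one hm hN hg c).trans ?_
  set D₁ := D ((m ^ (2 ^ N - 1) : ℕ) : ℝ)⁻¹
  set Dh := D ((m ^ (2 ^ N - 2 ^ (N - 1)) : ℕ) : ℝ)⁻¹
  set d : ℕ → ℝ≥0∞ := fun j => D ((m ^ (2 ^ N - 2 ^ j) : ℕ) : ℝ)⁻¹
  have hd : ∀ j, D ((m ^ (2 ^ N - 2 ^ j) : ℕ) : ℝ)⁻¹ = d j := fun _ => rfl
  simp only [hd]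
  have hN2 : (2 : ℝ) ≤ 2 ^ N := by
    calc (2 : ℝ) = 2 ^ 1 := by norm_num
      _ ≤ 2 ^ N := pow_le_pow_right₀ (by norm_num) hN
  have q1 : (1 / 2 ^ N : ℝ) ≤ 1 / 2 := one_div_le_one_div_of_le (by norm_num) hN2
  have q0 : (0 : ℝ) ≤ 1 / 2 ^ N := by positivity
  set P := ∏ j ∈ Finset.range N, d j ^ (1 / 2 ^ (j + 1) : ℝ) with hP
  set Y := (iterC * m) ^ (2 - 1 / 2 ^ (N - 1) : ℝ) * (∏ j ∈ Finset.range N, d j ^ (3 / 2 ^ j : ℝ)) *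
        (resC * Dh ^ 2 * D ((1 : ℕ) : ℝ)⁻¹ ^ 4) ^ (1 / 2 ^ N : ℝ) with hY
  -- `Y` occurs with the exponent `1/3` in the square of the constant, hence with `1/6` here
  have hY6 : Y ^ (1 / 6 : ℝ) ≤ iterC * (m : ℝ≥0∞) ^ (1 / 3 : ℝ) * P *
      (resC * Dh ^ (1 / (3 * 2 ^ N) : ℝ) * 2 ^ 17) := by
    rw [hY, ENNReal.mul_rpow_of_nonneg _ _ (by norm_num), ENNReal.mul_rpow_of_nonneg _ _ (by norm_num)]
    refine mul_le_mul' (mul_le_mul' ?_ (le_of_eq ?_)) ?_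
    · rw [← ENNReal.rpow_mul]
      calc (iterC * m) ^ ((2 - 1 / 2 ^ (N - 1) : ℝ) * (1 / 6))
          ≤ (iterC * m) ^ (1 / 3 : ℝ) := by
            refine ENNReal.rpow_le_rpow_of_exponent_le (one_le_mul one_le_iterC hm1) ?_
            have : (0 : ℝ) ≤ 1 / 2 ^ (N - 1) := by positivity
            linarith
        _ ≤ _ := by
            rw [ENNReal.mul_rpow_of_nonneg _ _ (by norm_num)]
            gcongr
            exact rpow_le_self_of_one_le one_le_iterC (by norm_num)
    · rw [← ENNReal.prod_rpow_of_nonneg (by norm_num)]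
      refine Finset.prod_congr rfl fun j _ => ?_
      rw [← ENNReal.rpow_mul]
      congr 1
      rw [pow_succ]
      field_simp
      norm_num
    · rw [← ENNReal.rpow_mul, ENNReal.mul_rpow_of_nonneg _ _ (by positivity),
        ENNReal.mul_rpow_of_nonneg _ _ (by positivity)]
      refine mul_le_mul' (mul_le_mul' ?_ (le_of_eq ?_)) ?_
      · exact rpow_le_self_of_one_le one_le_resC (by linarith)
      · rw [← ENNReal.rpow_natCast, ← ENNReal.rpow_mul]
        congr 1
        field_simp
        norm_num
      · rw [← ENNReal.rpow_natCast, ← ENNReal.rpow_mul]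
        calc D ((1 : ℕ) : ℝ)⁻¹ ^ (((4 : ℕ) : ℝ) * (1 / 2 ^ N * (1 / 6)))
            ≤ (2 ^ 17) ^ (((4 : ℕ) : ℝ) * (1 / 2 ^ N * (1 / 6))) :=
              ENNReal.rpow_le_rpow D_one_le (by positivity)
          _ ≤ 2 ^ 17 := by
              refine rpow_le_self_of_one_le (by norm_num) ?_
              push_cast
              linarith
  have hsq : ∀ x : ℝ≥0∞, (x ^ 2) ^ (1 / 2 : ℝ) = x := fun x => by
    rw [← ENNReal.rpow_natCast, ← ENNReal.rpow_mul]; norm_num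
  have h6 : (6 : ℝ≥0∞) ^ (1 / 2 : ℝ) ≤ 6 := rpow_le_self_of_one_le (by norm_num) (by norm_num)
  have h2 : (2 : ℝ≥0∞) ^ (1 / 2 : ℝ) ≤ 2 := rpow_le_self_of_one_le (by norm_num) (by norm_num)
  have hres : (resC ^ (1 / 3 : ℝ)) ^ (1 / 2 : ℝ) ≤ resC := by
    rw [← ENNReal.rpow_mul]
    exact rpow_le_self_of_one_le one_le_resC (by norm_num)
  -- the argument gives `m ^ (5/6)`, which is better than needed
  have hmm : (m : ℝ≥0∞) ^ (1 / 2 : ℝ) * (m : ℝ≥0∞) ^ (1 / 3 : ℝ) ≤ (m : ℝ≥0∞) ^ (4 / 3 : ℝ) := by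
    rw [← ENNReal.rpow_add_of_nonneg _ _ (by norm_num) (by norm_num)]
    exact ENNReal.rpow_le_rpow_of_exponent_le hm1 (by norm_num)
  have c1 : (2 : ℝ≥0∞) ^ 17 * 6 ≤ 10 ^ 10 := by norm_num
  have c2 : (2 : ℝ≥0∞) ^ 17 * 2 * 2 ^ 17 ≤ 10 ^ 20 := by norm_num
  calc 2 ^ 17 * (6 * (resC ^ (1 / 3 : ℝ) * D₁ ^ 2) + 2 * m * Y ^ (1 / 3 : ℝ)) ^ (1 / 2 : ℝ)
      ≤ 2 ^ 17 * ((6 * (resC ^ (1 / 3 : ℝ) * D₁ ^ 2)) ^ (1 / 2 : ℝ) +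
          (2 * m * Y ^ (1 / 3 : ℝ)) ^ (1 / 2 : ℝ)) := by
        gcongr
        exact ENNReal.rpow_add_le_add_rpow _ _ (by norm_num) (by norm_num)
    _ = 2 ^ 17 * (6 ^ (1 / 2 : ℝ) * ((resC ^ (1 / 3 : ℝ)) ^ (1 / 2 : ℝ) * D₁) +
          2 ^ (1 / 2 : ℝ) * (m : ℝ≥0∞) ^ (1 / 2 : ℝ) * Y ^ (1 / 6 : ℝ)) := by
        have e3 : (Y ^ (1 / 3 : ℝ)) ^ (1 / 2 : ℝ) = Y ^ (1 / 6 : ℝ) := by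
          rw [← ENNReal.rpow_mul]; norm_num
        simp only [ENNReal.mul_rpow_of_nonneg _ _ (show (0 : ℝ) ≤ 1 / 2 by norm_num), hsq, e3]
    _ ≤ 2 ^ 17 * (6 * (resC * D₁) + 2 * (m : ℝ≥0∞) ^ (1 / 2 : ℝ) *
          (iterC * (m : ℝ≥0∞) ^ (1 / 3 : ℝ) * P *
            (resC * Dh ^ (1 / (3 * 2 ^ N) : ℝ) * 2 ^ 17))) := by gcongr
    _ = 2 ^ 17 * 6 * resC * D₁ + (2 ^ 17 * 2 * 2 ^ 17) * iterC * resC *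
          ((m : ℝ≥0∞) ^ (1 / 2 : ℝ) * (m : ℝ≥0∞) ^ (1 / 3 : ℝ) *
            Dh ^ (1 / (3 * 2 ^ N) : ℝ) * P) := by ring
    _ ≤ 10 ^ 10 * 10 ^ 3800 * D₁ + 10 ^ 20 * 10 ^ 4503 * 10 ^ 3800 *
          ((m : ℝ≥0∞) ^ (4 / 3 : ℝ) * Dh ^ (1 / (3 * 2 ^ N) : ℝ) * P) := by
        gcongr
        · exact resC_le
        · exact iterC_le
        · exact resC_le
    _ ≤ 10 ^ (10 ^ 5) * D₁ + 10 ^ (10 ^ 5) *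
          ((m : ℝ≥0∞) ^ (4 / 3 : ℝ) * Dh ^ (1 / (3 * 2 ^ N) : ℝ) * P) := by
        rw [← pow_add, ← pow_add, ← pow_add]
        gcongr <;> norm_num
    _ = _ := by rw [← mul_add]

/-- Powers of `δ = m ^ (-T)` with exponent in `ℕ / T` are reciprocals of integers. -/
theorem rpow_eq_inv_pow {m T s : ℕ} (hm : 0 < m) {δ x : ℝ} (hδ : δ = ((m ^ T : ℕ) : ℝ)⁻¹)
    (hx : (T : ℝ) * x = s) : δ ^ x = ((m ^ s : ℕ) : ℝ)⁻¹ := by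
  have hm' : (0 : ℝ) ≤ m := by positivity
  rw [hδ, Real.inv_rpow (by positivity), Nat.cast_pow, Nat.cast_pow, ← Real.rpow_natCast,
    ← Real.rpow_mul hm', hx, Real.rpow_natCast]

end ParabolaDecoupling

theorem corollary2p8 (N : ℕ) (hN : 1 ≤ N) (δ : ℝ) (hδ : 0 < δ)
    (hint : ∃ m : ℕ, δ ^ (-(1 / (2 : ℝ) ^ N)) = (m : ℝ))
    (hsmall : δ < (100 : ℝ) ^ (-((2 : ℝ) ^ N))) :
    ParabolaDecoupling.D δ ≤
      (10 : ℝ≥0∞) ^ (10 ^ 5 : ℕ) *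
        (ParabolaDecoupling.D (δ ^ (1 - 1 / (2 : ℝ) ^ N)) +
          ENNReal.ofReal (δ ^ (-(4 / (3 * (2 : ℝ) ^ N)))) *
            ParabolaDecoupling.D (δ ^ (1 / 2 : ℝ)) ^ (1 / (3 * (2 : ℝ) ^ N)) *
            ∏ j ∈ Finset.range N,
              ParabolaDecoupling.D (δ ^ (1 - 1 / (2 : ℝ) ^ (N - j))) ^ (1 / (2 : ℝ) ^ (j + 1))) := by
  obtain ⟨m, hm⟩ := hint
  have hT0 : (0 : ℝ) < 2 ^ N := by positivity
  have hT : (((2 ^ N : ℕ)) : ℝ) = 2 ^ N := by push_cast; rfl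
  -- with `m = δ ^ (-1 / 2^N)` all scales are powers of `m`
  have hm100 : (100 : ℝ) < m := by
    rw [← hm]
    have h1 := Real.rpow_lt_rpow_of_neg hδ hsmall
      (show -(1 / (2 : ℝ) ^ N) < 0 by rw [neg_lt_zero]; positivity)
    rw [← Real.rpow_mul (by norm_num), neg_mul_neg, mul_one_div_cancel hT0.ne', Real.rpow_one] at h1
    exact h1
  have hm0 : 0 < m := by exact_mod_cast (by linarith : (0 : ℝ) < m)
  have hm3 : 3 ≤ m := by exact_mod_cast (by linarith : (3 : ℝ) ≤ m)
  have hδm : δ = ((m ^ 2 ^ N : ℕ) : ℝ)⁻¹ := by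
    rw [Nat.cast_pow, ← hm, ← Real.rpow_natCast, ← Real.rpow_mul hδ.le, hT, neg_mul,
      one_div_mul_cancel hT0.ne', Real.rpow_neg_one, inv_inv]
  have e1 : δ ^ (1 - 1 / (2 : ℝ) ^ N) = ((m ^ (2 ^ N - 1) : ℕ) : ℝ)⁻¹ := by
    refine ParabolaDecoupling.rpow_eq_inv_pow hm0 hδm ?_
    rw [Nat.cast_sub Nat.one_le_two_pow, hT]
    field_simp
    simp
  have e2 : δ ^ (1 / 2 : ℝ) = ((m ^ (2 ^ N - 2 ^ (N - 1)) : ℕ) : ℝ)⁻¹ := by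
    refine ParabolaDecoupling.rpow_eq_inv_pow hm0 hδm ?_
    obtain ⟨k, rfl⟩ : ∃ k, N = k + 1 := ⟨N - 1, by omega⟩
    rw [Nat.add_sub_cancel, pow_succ, show 2 ^ k * 2 - 2 ^ k = 2 ^ k by omega]
    push_cast
    ring
  have e3 : ∀ j ∈ Finset.range N,
      δ ^ (1 - 1 / (2 : ℝ) ^ (N - j)) = ((m ^ (2 ^ N - 2 ^ j) : ℕ) : ℝ)⁻¹ := by
    intro j hj
    have hj := (Finset.mem_range.1 hj).le
    refine ParabolaDecoupling.rpow_eq_inv_pow hm0 hδm ?_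
    rw [Nat.cast_sub (Nat.pow_le_pow_right (by norm_num) hj), hT]
    have : (2 : ℝ) ^ N = 2 ^ (N - j) * 2 ^ j := by rw [← pow_add, Nat.sub_add_cancel hj]
    rw [this]
    push_cast
    field_simp
  have e4 : ENNReal.ofReal (δ ^ (-(4 / (3 * (2 : ℝ) ^ N)))) = (m : ℝ≥0∞) ^ (4 / 3 : ℝ) := by
    have h1 : -(4 / (3 * (2 : ℝ) ^ N)) = -(1 / (2 : ℝ) ^ N) * (4 / 3) := by field_simp
    rw [h1, Real.rpow_mul hδ.le, hm, ← ENNReal.ofReal_rpow_of_nonneg (by positivity) (by norm_num),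
      ENNReal.ofReal_natCast]
  rw [e1, e2, e4, Finset.prod_congr rfl fun j hj => by rw [e3 j hj]]
  conv_lhs => rw [hδm]
  exact ParabolaDecoupling.D_le_recursive hm3 hN
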